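/- A compact polyhedron is the underlying set of a finite simplicial complex in a finite-dimensional real normed space. A map between compact polyhedra is PL if it is affine on each simplex of some finite triangulation of its domain; a PL embedding is a PL map which is a PL homeomorphism onto its image. A PL map is non-degenerate if it has no point-inverses of dimension $>0$. A map $e\colon N\to M\times\mathbb R^k$ lifts $f\colon N\to M$ if its composition with the projection onto $M$ is $f$; likewise, for a set $S$, a map $N\times S\to M\times\mathbb R^k\times S$ lifts $f\times\mathrm{id}_S$ if its composition with the projection onto $M\times S$ is $f\times\mathrm{id}_S$. Let $B^n=[-1,1]^n$ and let $\partial B^n$ be its boundary (so $B^0$ is a point and $\partial B^0=\emptyset$). Two maps into a metric space are $r$-close if their values at each point are at distance $<r$; products carry the maximum metric. Let $f\colon N\to M$ be a non-degenerate PL map between compact polyhedra and let $k\ge 0$. (a) The space of topological embeddings $N\to M\times\mathbb R^k$ which lift $f$, with the compact-open topology (equivalently, the topology of uniform convergence), is locally contractible: every neighborhood $U$ of each of its points contains a neighborhood $V$ of that point such that the inclusion $V\to U$ is null-homotopic. (b) Let $e\colon N\to M\times\mathbb R^k$ be a topological embedding which lifts $f$. For each $\varepsilon>0$ there exists a $\delta>0$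 such that for each $n=0,1,2,\dots$, every PL embedding $N\times\partial B^n\to M\times\mathbb R^k\times\partial B^n$ which lifts $f\times\mathrm{id}_{\partial B^n}$ and is $\delta$-close to $e\times\mathrm{id}_{\partial B^n}$ extends to a PL embedding $N\times B^n\to M\times\mathbb R^k\times B^n$ which lifts $f\times\mathrm{id}_{B^n}$ and is $\varepsilon$-close to $e\times\mathrm{id}_{B^n}$. -/

import Mathlib

open Set Topology

section PL

variable {V W : Type*} [AddCommGroup V] [Module ℝ V] [AddCommGroup W] [Module ℝ W]

/-- A compact polyhedron in a real vector space: the underlying set of a finite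
(geometric) simplicial complex. -/
def IsCompactPolyhedron (X : Set V) : Prop :=
  ∃ K : Geometry.SimplicialComplex ℝ V, K.faces.Finite ∧ K.space = X

/-- `F` is piecewise linear on the compact polyhedron `X`: for some finite triangulation of `X`,
it is affine on every simplex. Only the values of `F` on `X` matter. -/
def IsPLOn (F : V → W) (X : Set V) : Prop :=
  ∃ K : Geometry.SimplicialComplex ℝ V, K.faces.Finite ∧ K.space = X ∧
    ∀ s ∈ K.faces, ∃ φ : V →ᵃ[ℝ] W, EqOn F φ (convexHull ℝ (s : Set V))

/-- `F` restricts to a PL embedding of the compact polyhedron `X`: it is PL on `X`, and it has an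
inverse `F(X) → X` which is PL. -/
def IsPLEmbeddingOn (F : V → W) (X : Set V) : Prop :=
  IsPLOn F X ∧ ∃ G : W → V, IsPLOn G (F '' X) ∧ LeftInvOn G F X

/-- The dimension of a polyhedron: the supremum of the dimensions of the simplices contained
in it (`⊥` for the empty polyhedron). -/
noncomputable def polyhedronDim (X : Set V) : WithBot ℕ∞ :=
  ⨆ (s : Finset V) (_ : s.Nonempty) (_ : AffineIndependent ℝ ((↑) : s → V))
    (_ : convexHull ℝ (s : Set V) ⊆ X), (((s.card - 1 : ℕ) : ℕ∞) : WithBot ℕ∞)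

/-- `f` restricts to a PL map `N → M`. -/
def IsPLMap (f : V → W) (N : Set V) (M : Set W) : Prop :=
  IsPLOn f N ∧ MapsTo f N M

/-- `f : N → M` has no point-inverses of dimension `> 0`. -/
def IsNondegenerate (f : V → W) (N : Set V) (M : Set W) : Prop :=
  ∀ y ∈ M, polyhedronDim {x ∈ N | f x = y} ≤ 0

end PL

section Lifts

variable {V W : Type*} [NormedAddCommGroup V] [NormedSpace ℝ V]
  [NormedAddCommGroup W] [NormedSpace ℝ W]

/-- The space of topological embeddings `N → M × ℝᵏ` which lift `f : N → M`, with the topology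
induced from the compact-open topology (that is, of uniform convergence, when `N` is compact). -/
abbrev EmbeddedLifts (f : V → W) (N : Set V) (M : Set W) (k : ℕ) : Type _ :=
  {e : C(N, M × EuclideanSpace ℝ (Fin k)) // IsEmbedding e ∧ ∀ p : N, ((e p).1 : W) = f p}

/-- For `S ⊆ ℝⁿ`, the map `E` restricts to a PL embedding `N × S → M × ℝᵏ × S` which lifts
`f × id_S`. -/
def IsPLEmbeddedLiftOver (f : V → W) (N : Set V) (k n : ℕ) (S : Set (Fin n → ℝ))
    (E : V × (Fin n → ℝ) → W × EuclideanSpace ℝ (Fin k) × (Fin n → ℝ)) : Prop :=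
  IsPLEmbeddingOn E (N ×ˢ S) ∧ ∀ p ∈ N, ∀ b ∈ S, (E (p, b)).1 = f p ∧ (E (p, b)).2.2 = b

/-- `E`, as a map on `N × S`, is `r`-close to `e × id_S`. -/
def IsCloseOver {N : Set V} {M : Set W} {k n : ℕ} (e : N → M × EuclideanSpace ℝ (Fin k))
    (S : Set (Fin n → ℝ)) (E : V × (Fin n → ℝ) → W × EuclideanSpace ℝ (Fin k) × (Fin n → ℝ))
    (r : ℝ) : Prop :=
  ∀ p : N, ∀ b ∈ S, dist (E (p, b)) (((e p).1 : W), (e p).2, b) < r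

/-- The standard PL ball `Bⁿ = [-1, 1]ⁿ`. -/
def plBall (n : ℕ) : Set (Fin n → ℝ) := Metric.closedBall 0 1

/-- The boundary `∂Bⁿ` of the standard PL ball `[-1, 1]ⁿ` (empty for `n = 0`). -/
def plSphere (n : ℕ) : Set (Fin n → ℝ) := Metric.sphere 0 1

end Lifts

/-!
A lift of `f` is the same thing as its height `h : N → ℝᵏ`, which has to separate the points of each
fibre of `f`. Triangulate so that `f` is affine and injective on each simplex. If `M` is a star with
centre `w`, then `f⁻¹(M)` is a finite union of cones, one for each `v ∈ f⁻¹(w)`, and a family of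
lifts over `∂B` extends conically: over the point `(v, 0)` of `N × B` put the height `e v` of the
given lift `e`, and extend linearly along the rays issuing from these points to `N × ∂B` and to the
part of the preimage over the link of `w`, over which the family has been extended before. As `f`
and the parameter in the cone are respected, fibres stay separated within each cone. Different cones
do not interfere as long as the simplices are so small that the heights over the cone at `v` remain
close to `e v`. The same formula serves topological families, where it is applied to the constant
family on `[-1, 1]` to produce a contraction, and PL families.

The size of the simplices thus has to be bounded in terms of the distance of the values of `e` at
different points of one fibre, which has no positive lower bound because the points of a fibre may
merge. Hence the induction on the skeleta of `M`: let `Y` be a polyhedron disjoint from the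
`(i - 1)`-skeleton. No two simplices of `N` merge over the intersection of `Y` with the open
`i`-simplices, so over `Y` there is a positive gap at the points of the `i`-skeleton. In a
triangulation finer than this gap, remove from `Y` the open stars of all the vertices in the
`i`-skeleton; what is left is disjoint from the `i`-skeleton, and the stars are put back one at a
time as cones.
-/

open Geometry Geometry.SimplicialComplex

/-! ### Stellar subdivision -/

section BarycentricWeights

variable {V W : Type*} [AddCommGroup V] [Module ℝ V] [AddCommGroup W] [Module ℝ W]
  {s t : Finset V} {w w' : V →₀ ℝ} {x y : V}

/-- `w` is a system of convex weights on the finite set `s` with barycentre `x`. The weights are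
finitely supported functions on all of `V`, so that weights on different simplices can be compared,
and moved from one simplex to another linearly. -/
structure IsBarycentric (s : Finset V) (w : V →₀ ℝ) (x : V) : Prop where
  nonneg : ∀ v, 0 ≤ w v
  support_subset : w.support ⊆ s
  total : Finsupp.linearCombination ℝ (fun _ : V => (1 : ℝ)) w = 1
  barycentre : Finsupp.linearCombination ℝ id w = x

namespace IsBarycentric

theorem mono (h : IsBarycentric s w x) (hst : s ⊆ t) : IsBarycentric t w x :=
  ⟨h.nonneg, h.support_subset.trans hst, h.total, h.barycentre⟩

theorem restrict (h : IsBarycentric s w x) (ht : w.support ⊆ t) : IsBarycentric t w x :=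
  ⟨h.nonneg, ht, h.total, h.barycentre⟩

theorem eq_zero_of_notMem (h : IsBarycentric s w x) {v : V} (hv : v ∉ s) : w v = 0 :=
  Finsupp.notMem_support_iff.1 fun hw => hv (h.support_subset hw)

theorem pos_of_mem_support (h : IsBarycentric s w x) {v : V} (hv : v ∈ w.support) : 0 < w v :=
  (h.nonneg v).lt_of_ne' (Finsupp.mem_support_iff.1 hv)

theorem sum_eq_one (h : IsBarycentric s w x) : ∑ v ∈ s, w v = 1 := by
  have := h.total
  rw [Finsupp.linearCombination_apply, Finsupp.sum_of_support_subset w h.support_subset _ (by simp)]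
    at this
  simpa only [smul_eq_mul, mul_one] using this

theorem sum_smul_eq (h : IsBarycentric s w x) : ∑ v ∈ s, w v • v = x := by
  have := h.barycentre
  rwa [Finsupp.linearCombination_apply,
    Finsupp.sum_of_support_subset w h.support_subset _ (by simp)] at this

theorem mem_convexHull (h : IsBarycentric s w x) : x ∈ convexHull ℝ (s : Set V) :=
  Finset.mem_convexHull'.2 ⟨w, fun v _ => h.nonneg v, h.sum_eq_one, h.sum_smul_eq⟩

theorem support_nonempty (h : IsBarycentric s w x) : w.support.Nonempty := by
  rw [Finset.nonempty_iff_ne_empty, Ne, Finsupp.support_eq_empty]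
  rintro rfl
  exact zero_ne_one ((map_zero _).symm.trans h.total)

theorem map_affine (h : IsBarycentric s w x) (φ : V →ᵃ[ℝ] W) : φ x = ∑ v ∈ s, w v • φ v := by
  have hφ : ∀ v, φ v = φ.linear v + φ 0 := fun v => congrFun φ.decomp v
  calc φ x = ∑ v ∈ s, w v • φ.linear v + (∑ v ∈ s, w v) • φ 0 := by
        rw [hφ x, h.sum_eq_one, one_smul, ← h.sum_smul_eq, map_sum]
        simp_rw [map_smul]
    _ = ∑ v ∈ s, w v • φ v := by
        rw [Finset.sum_smul, ← Finset.sum_add_distrib]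
        exact Finset.sum_congr rfl fun v _ => by rw [hφ v, smul_add]

theorem single (hx : x ∈ s) : IsBarycentric s (Finsupp.single x 1) x where
  nonneg v := by classical rw [Finsupp.single_apply]; split_ifs <;> norm_num
  support_subset := Finsupp.support_single_subset.trans (Finset.singleton_subset_iff.2 hx)
  total := by simp
  barycentre := by simp

theorem convexComb (h : IsBarycentric s w x) (h' : IsBarycentric s w' y) {a b : ℝ} (ha : 0 ≤ a)
    (hb : 0 ≤ b) (hab : a + b = 1) : IsBarycentric s (a • w + b • w') (a • x + b • y) where
  nonneg v := add_nonneg (mul_nonneg ha (h.nonneg v)) (mul_nonneg hb (h'.nonneg v))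
  support_subset := by
    classical
    exact Finsupp.support_add.trans (Finset.union_subset
      (Finsupp.support_smul.trans h.support_subset) (Finsupp.support_smul.trans h'.support_subset))
  total := by simp only [map_add, map_smul, h.total, h'.total, smul_eq_mul, mul_one, hab]
  barycentre := by simp only [map_add, map_smul, h.barycentre, h'.barycentre]

/-- Expand the vertex `c` by convex weights `u` with barycentre `c`: its weight is handed over
to the support of `u`. -/
theorem replace [DecidableEq V] (h : IsBarycentric s w x) {u : V →₀ ℝ} {c : V}
    (hu : IsBarycentric t u c) : IsBarycentric (s.erase c ∪ t) (w.erase c + w c • u) x where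
  nonneg v := by
    refine add_nonneg ?_ (mul_nonneg (h.nonneg c) (hu.nonneg v))
    rw [Finsupp.erase_apply]
    split_ifs
    exacts [le_rfl, h.nonneg v]
  support_subset := by
    refine Finsupp.support_add.trans (Finset.union_subset_union ?_
      (Finsupp.support_smul.trans hu.support_subset))
    rw [Finsupp.support_erase]
    exact Finset.erase_subset_erase c h.support_subset
  total := by
    have hw := h.total
    rw [← Finsupp.erase_add_single c w, map_add, Finsupp.linearCombination_single] at hw
    rwa [map_add, map_smul, hu.total]
  barycentre := by
    have hw := h.barycentre
    rw [← Finsupp.erase_add_single c w, map_add, Finsupp.linearCombination_single] at hw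
    rwa [map_add, map_smul, hu.barycentre]

/-- The inverse of `IsBarycentric.replace`: the vertex `c` absorbs a multiple of the weights `u`. -/
theorem absorb [DecidableEq V] (h : IsBarycentric s w x) {u : V →₀ ℝ} {c : V}
    (hu : IsBarycentric s u c) {m : ℝ} (hm : 0 ≤ m) (hmu : ∀ v, m * u v ≤ w v) :
    IsBarycentric (insert c s) (w - m • u + Finsupp.single c m) x where
  nonneg v := by
    refine add_nonneg (sub_nonneg.2 (hmu v)) ?_
    rw [Finsupp.single_apply]
    split_ifs
    exacts [hm, le_rfl]
  support_subset := by
    refine Finsupp.support_add.trans (Finset.union_subset ?_ ?_)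
    · exact (Finsupp.support_sub.trans (Finset.union_subset h.support_subset
        (Finsupp.support_smul.trans hu.support_subset))).trans (Finset.subset_insert c s)
    · exact Finsupp.support_single_subset.trans (by simp)
  total := by simp [h.total, hu.total]
  barycentre := by simp [h.barycentre, hu.barycentre]

end IsBarycentric

theorem exists_isBarycentric (h : x ∈ convexHull ℝ (s : Set V)) : ∃ w, IsBarycentric s w x := by
  classical
  obtain ⟨w, hw, hw₁, hwx⟩ := Finset.mem_convexHull'.1 h
  refine ⟨Finsupp.indicator s fun v _ => w v, fun v => ?_, Finsupp.support_indicator_subset _ _,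
    ?_, ?_⟩
  · rw [Finsupp.indicator_apply]
    split_ifs with hv
    exacts [hw v hv, le_rfl]
  all_goals rw [Finsupp.linearCombination_apply,
    Finsupp.sum_of_support_subset _ (Finsupp.support_indicator_subset _ _) _ (by simp)]
  · refine Eq.trans ?_ hw₁
    exact Finset.sum_congr rfl fun v hv => by rw [Finsupp.indicator_of_mem hv, smul_eq_mul, mul_one]
  · refine Eq.trans ?_ hwx
    exact Finset.sum_congr rfl fun v hv => by rw [Finsupp.indicator_of_mem hv, id]

theorem exists_isBarycentric_support_eq (hs : s.Nonempty) :
    ∃ w x, IsBarycentric s w x ∧ w.support = s := by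
  classical
  have hcard : (0 : ℝ) < s.card := Nat.cast_pos.2 hs.card_pos
  let w : V →₀ ℝ := Finsupp.indicator s fun _ _ => (s.card : ℝ)⁻¹
  have hsupp : w.support = s := by
    ext v
    simp [w, hs.ne_empty]
  refine ⟨w, Finsupp.linearCombination ℝ id w, ⟨fun v => ?_, hsupp.le, ?_, rfl⟩, hsupp⟩
  · simp only [w, Finsupp.indicator_apply]
    split_ifs <;> positivity
  · rw [Finsupp.linearCombination_apply, Finsupp.sum_of_support_subset _ hsupp.le _ (by simp)]
    simp only [smul_eq_mul, mul_one]
    rw [Finset.sum_congr rfl fun v hv => Finsupp.indicator_of_mem hv _, Finset.sum_const,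
      nsmul_eq_mul, mul_inv_cancel₀ hcard.ne']

theorem isBarycentric_unique_of_affineIndependent (hs : AffineIndependent ℝ ((↑) : s → V))
    (h : IsBarycentric s w x) (h' : IsBarycentric s w' x) : w = w' := by
  rw [affineIndependent_iff] at hs
  have hw := hs Finset.univ (fun v => w v - w' v)
    (by rw [Finset.sum_coe_sort s (fun v => w v - w' v), Finset.sum_sub_distrib, h.sum_eq_one,
      h'.sum_eq_one, sub_self])
    (by
      rw [Finset.sum_coe_sort s (fun v => (w v - w' v) • v)]
      simp_rw [sub_smul]
      rw [Finset.sum_sub_distrib, h.sum_smul_eq, h'.sum_smul_eq, sub_self])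
  ext v
  by_cases hv : v ∈ s
  · exact sub_eq_zero.1 (hw ⟨v, hv⟩ (Finset.mem_univ _))
  · rw [h.eq_zero_of_notMem hv, h'.eq_zero_of_notMem hv]

/-- By Radon's theorem, a dependent set has two disjoint parts with intersecting hulls. -/
theorem affineIndependent_of_isBarycentric_unique
    (hs : ∀ w w' x, IsBarycentric s w x → IsBarycentric s w' x → w = w') :
    AffineIndependent ℝ ((↑) : s → V) := by
  classical
  by_contra hdep
  obtain ⟨I, x, hxI, hxI'⟩ := Convex.radon_partition hdep
  have hcoe : ∀ J : Set s,
      ((↑) '' J : Set V) = ((J.toFinite.toFinset.image (↑) : Finset V) : Set V) := fun J => by simp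
  have hsub : ∀ J : Finset s, J.image (↑) ⊆ s := fun J v hv => by
    obtain ⟨y, -, rfl⟩ := Finset.mem_image.1 hv
    exact y.2
  rw [hcoe] at hxI hxI'
  obtain ⟨w, hw⟩ := exists_isBarycentric hxI
  obtain ⟨w', hw'⟩ := exists_isBarycentric hxI'
  obtain rfl := hs w w' x (hw.mono (hsub _)) (hw'.mono (hsub _))
  obtain ⟨v, hv⟩ := hw.support_nonempty
  obtain ⟨y, hyI, rfl⟩ := Finset.mem_image.1 (hw.support_subset hv)
  obtain ⟨z, hzI, hyz⟩ := Finset.mem_image.1 (hw'.support_subset hv)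
  rw [Subtype.coe_injective hyz] at hzI
  exact (Finite.mem_toFinset _).1 hzI ((Finite.mem_toFinset _).1 hyI)

end BarycentricWeights

section Carriers

variable {V : Type*} [AddCommGroup V] [Module ℝ V]

theorem isBarycentric_unique_of_mem_faces {K : SimplicialComplex ℝ V} {s t : Finset V}
    (hs : s ∈ K.faces) (ht : t ∈ K.faces) {w w' : V →₀ ℝ} {x : V} (h : IsBarycentric s w x)
    (h' : IsBarycentric t w' x) : w = w' := by
  classical
  have hx := K.inter_subset_convexHull hs ht ⟨h.mem_convexHull, h'.mem_convexHull⟩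
  rw [← Finset.coe_inter] at hx
  obtain ⟨u, hu⟩ := exists_isBarycentric hx
  rw [isBarycentric_unique_of_affineIndependent (K.indep hs) h (hu.mono Finset.inter_subset_left),
    isBarycentric_unique_of_affineIndependent (K.indep ht) h' (hu.mono Finset.inter_subset_right)]

/-- The simplicial complex with a given down-closed family of faces, nonempty finite sets of points
in which convex weights are determined by their barycentre. -/
def complexOfUniqueWeights (F : Set (Finset V)) (hF : IsRelLowerSet F Finset.Nonempty)
    (huniq : ∀ s ∈ F, ∀ t ∈ F, ∀ w w' x, IsBarycentric s w x → IsBarycentric t w' x → w = w') :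
    SimplicialComplex ℝ V where
  faces := F
  isRelLowerSet_faces := hF
  indep {s} hs := affineIndependent_of_isBarycentric_unique (huniq s hs s hs)
  inter_subset_convexHull {s t} hs ht := by
    classical
    rintro x ⟨hxs, hxt⟩
    obtain ⟨w, hw⟩ := exists_isBarycentric hxs
    obtain ⟨w', hw'⟩ := exists_isBarycentric hxt
    obtain rfl := huniq s hs t ht w w' x hw hw'
    rw [← Finset.coe_inter]
    exact (hw.restrict (Finset.subset_inter hw.support_subset hw'.support_subset)).mem_convexHull

/-- `s` is the carrier of `x` in `K`: the face whose relative interior contains `x`. -/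
def IsCarrier (K : SimplicialComplex ℝ V) (x : V) (s : Finset V) : Prop :=
  s ∈ K.faces ∧ ∃ w, IsBarycentric s w x ∧ w.support = s

namespace IsCarrier

variable {K : SimplicialComplex ℝ V} {s t : Finset V} {x : V}

theorem mem_faces (hs : IsCarrier K x s) : s ∈ K.faces := hs.1

theorem mem_convexHull (hs : IsCarrier K x s) : x ∈ convexHull ℝ (s : Set V) := by
  obtain ⟨-, w, hw, -⟩ := hs
  exact hw.mem_convexHull

theorem subset (hs : IsCarrier K x s) (ht : t ∈ K.faces) (hx : x ∈ convexHull ℝ (t : Set V)) :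
    s ⊆ t := by
  obtain ⟨hsK, w, hw, rfl⟩ := hs
  obtain ⟨w', hw'⟩ := exists_isBarycentric hx
  obtain rfl := isBarycentric_unique_of_mem_faces hsK ht hw hw'
  exact hw'.support_subset

/-- Maximum principle. -/
theorem eq_zero_of_nonpos (hs : IsCarrier K x s) {h : V →ᵃ[ℝ] ℝ} (hneg : ∀ v ∈ s, h v ≤ 0)
    (hx : 0 ≤ h x) {v : V} (hv : v ∈ s) : h v = 0 := by
  obtain ⟨-, w, hw, rfl⟩ := hs
  have hle : ∀ v ∈ w.support, w v * h v ≤ 0 := fun v hv =>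
    mul_nonpos_of_nonneg_of_nonpos (hw.nonneg v) (hneg v hv)
  have hsum : ∑ v ∈ w.support, w v * h v = 0 := by
    refine le_antisymm (Finset.sum_nonpos hle) ?_
    simpa only [smul_eq_mul, hw.map_affine h] using hx
  have hwv := (Finset.sum_eq_zero_iff_of_nonpos hle).1 hsum v hv
  exact (mul_eq_zero.1 hwv).resolve_left (hw.pos_of_mem_support hv).ne'

end IsCarrier

theorem IsBarycentric.isCarrier_support {K : SimplicialComplex ℝ V} {s : Finset V} {w : V →₀ ℝ}
    {x : V} (h : IsBarycentric s w x) (hs : s ∈ K.faces) : IsCarrier K x w.support :=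
  ⟨K.down_closed hs h.support_subset h.support_nonempty, w, h.restrict subset_rfl, rfl⟩

theorem exists_isCarrier_of_mem_convexHull {K : SimplicialComplex ℝ V} {s : Finset V} {x : V}
    (hs : s ∈ K.faces) (hx : x ∈ convexHull ℝ (s : Set V)) : ∃ t, IsCarrier K x t := by
  obtain ⟨w, hw⟩ := exists_isBarycentric hx
  exact ⟨_, hw.isCarrier_support hs⟩

theorem exists_isCarrier_of_mem_space {K : SimplicialComplex ℝ V} {x : V} (hx : x ∈ K.space) :
    ∃ t, IsCarrier K x t := by
  obtain ⟨s, hs, hxs⟩ := mem_space_iff.1 hx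
  exact exists_isCarrier_of_mem_convexHull hs hxs

theorem exists_isCarrier_of_mem_faces {K : SimplicialComplex ℝ V} {s : Finset V}
    (hs : s ∈ K.faces) : ∃ x, IsCarrier K x s := by
  obtain ⟨w, x, hw⟩ := exists_isBarycentric_support_eq (K.nonempty_of_mem_faces hs)
  exact ⟨x, hs, w, hw⟩

end Carriers

section StellarSubdivision

variable {V : Type*} [AddCommGroup V] [Module ℝ V]

/-- `K'` is a subdivision of `K`. -/
def Subdivides (K' K : SimplicialComplex ℝ V) : Prop :=
  K'.space = K.space ∧
    ∀ s ∈ K'.faces, ∃ t ∈ K.faces, convexHull ℝ (s : Set V) ⊆ convexHull ℝ (t : Set V)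

theorem Subdivides.refl (K : SimplicialComplex ℝ V) : Subdivides K K :=
  ⟨rfl, fun s hs => ⟨s, hs, Subset.rfl⟩⟩

theorem Subdivides.trans {K₁ K₂ K₃ : SimplicialComplex ℝ V} (h : Subdivides K₁ K₂)
    (h' : Subdivides K₂ K₃) : Subdivides K₁ K₃ := by
  refine ⟨h.1.trans h'.1, fun s hs => ?_⟩
  obtain ⟨t, ht, hst⟩ := h.2 s hs
  obtain ⟨u, hu, htu⟩ := h'.2 t ht
  exact ⟨u, hu, hst.trans htu⟩

variable {K : SimplicialComplex ℝ V} {s t : Finset V} {c x : V} {u w w' : V →₀ ℝ}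

/-- The weight at `c` is recovered as the minimal ratio between the expanded weights and `u`, which
is attained at a vertex of `t` where `w'` vanishes. -/
theorem apply_le_of_replace_eq (hts : ¬ t ⊆ s) (hw' : IsBarycentric s w' x) (hw : ∀ v, 0 ≤ w v)
    (hu : ∀ v ∈ t, 0 < u v) (hct : c ∉ t)
    (heq : w.erase c + w c • u = w'.erase c + w' c • u) : w c ≤ w' c := by
  obtain ⟨v, hvt, hvs⟩ := Finset.not_subset.1 hts
  have hvc : v ≠ c := fun h => hct (h ▸ hvt)
  have hv := DFunLike.congr_fun heq v
  simp only [Finsupp.add_apply, Finsupp.smul_apply, smul_eq_mul, Finsupp.erase_ne hvc,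
    hw'.eq_zero_of_notMem hvs, zero_add] at hv
  exact le_of_mul_le_mul_right (by linarith [hw v]) (hu v hvt)

variable [DecidableEq V]

/-- The faces of the complex obtained from `K` by starring its face `t` at an interior point `c`. -/
def stellarFaces (K : SimplicialComplex ℝ V) (t : Finset V) (c : V) : Set (Finset V) :=
  {s | ¬ t ⊆ s ∧ (s ∈ K.faces ∨ c ∈ s ∧ s.erase c ∪ t ∈ K.faces)}

theorem isRelLowerSet_stellarFaces : IsRelLowerSet (stellarFaces K t c) Finset.Nonempty := by
  rintro s ⟨hts, hs⟩
  refine ⟨hs.elim K.nonempty_of_mem_faces fun h => ⟨c, h.1⟩, fun r hrs hr =>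
    ⟨fun htr => hts (htr.trans hrs), ?_⟩⟩
  rcases hs with hs | ⟨-, hs⟩
  · exact Or.inl (K.down_closed hs hrs hr)
  by_cases hcr : c ∈ r
  · refine Or.inr ⟨hcr, K.down_closed hs
      (Finset.union_subset_union (Finset.erase_subset_erase c hrs) subset_rfl) ?_⟩
    rw [Finset.union_nonempty]
    exact Or.inr (Finset.nonempty_iff_ne_empty.2 fun ht => hts (ht ▸ Finset.empty_subset s))
  · refine Or.inl (K.down_closed hs ?_ hr)
    exact (Finset.subset_erase.2 ⟨hrs, hcr⟩).trans Finset.subset_union_left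

theorem finite_stellarFaces (hK : K.faces.Finite) : (stellarFaces K t c).Finite := by
  refine (hK.biUnion (t := fun r => ((insert c r).powerset : Set (Finset V)))
    fun r _ => Finset.finite_toSet _).subset ?_
  rintro s ⟨-, hs | ⟨-, hs⟩⟩
  · exact mem_biUnion hs (Finset.mem_powerset.2 (Finset.subset_insert c s))
  · exact mem_biUnion hs (Finset.mem_powerset.2 fun v hv => by by_cases v = c <;> simp [*])

theorem exists_mem_faces_isBarycentric_replace (hs : s ∈ stellarFaces K t c)
    (hu : IsBarycentric t u c) (hc : c ∉ K.vertices) :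
    ∃ r ∈ K.faces, ∀ w x, IsBarycentric s w x → IsBarycentric r (w.erase c + w c • u) x := by
  obtain ⟨-, hs | ⟨-, hs⟩⟩ := hs
  · refine ⟨s, hs, fun w x hw => ?_⟩
    have hcs : c ∉ s := fun h => hc (K.down_closed hs (Finset.singleton_subset_iff.2 h) (by simp))
    have hwc := hw.eq_zero_of_notMem hcs
    rwa [hwc, zero_smul, add_zero, Finsupp.erase_of_notMem_support (by simpa using hwc)]
  · exact ⟨_, hs, fun w x hw => hw.replace hu⟩

theorem isBarycentric_unique_of_mem_stellarFaces (hu : IsBarycentric t u c) (hut : u.support = t)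
    (hc : c ∉ K.vertices) (hct : c ∉ t) {s' : Finset V} (hs : s ∈ stellarFaces K t c)
    (hs' : s' ∈ stellarFaces K t c) (hw : IsBarycentric s w x) (hw' : IsBarycentric s' w' x) :
    w = w' := by
  obtain ⟨r, hr, hwr⟩ := exists_mem_faces_isBarycentric_replace hs hu hc
  obtain ⟨r', hr', hwr'⟩ := exists_mem_faces_isBarycentric_replace hs' hu hc
  have heq := isBarycentric_unique_of_mem_faces hr hr' (hwr w x hw) (hwr' w' x hw')
  have hpos : ∀ v ∈ t, 0 < u v := fun v hv => hu.pos_of_mem_support (hut.symm ▸ hv)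
  have hwc : w c = w' c := le_antisymm (apply_le_of_replace_eq hs'.1 hw' hw.nonneg hpos hct heq)
    (apply_le_of_replace_eq hs.1 hw hw'.nonneg hpos hct heq.symm)
  rw [hwc, add_left_inj] at heq
  rw [← Finsupp.single_add_erase c w, ← Finsupp.single_add_erase c w', hwc, heq]

/-- The new vertex absorbs the largest multiple of `u` for which the weights stay nonnegative; this
kills the weight of a vertex of `t`. -/
theorem exists_mem_stellarFaces_mem_convexHull (hu : IsBarycentric t u c) (hut : u.support = t)
    (hct : c ∉ t) {r : Finset V} (hr : r ∈ K.faces) (hx : x ∈ convexHull ℝ (r : Set V)) :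
    ∃ s ∈ stellarFaces K t c, x ∈ convexHull ℝ (s : Set V) := by
  by_cases htr : t ⊆ r
  swap
  · exact ⟨r, ⟨htr, Or.inl hr⟩, hx⟩
  obtain ⟨w, hw⟩ := exists_isBarycentric hx
  have hpos : ∀ v ∈ t, 0 < u v := fun v hv => hu.pos_of_mem_support (hut.symm ▸ hv)
  obtain ⟨a, hat, hmin⟩ := t.exists_min_image (fun v => w v / u v) (hut ▸ hu.support_nonempty)
  have hmu : ∀ v, w a / u a * u v ≤ w v := by
    intro v
    by_cases hv : v ∈ t
    · exact (le_div_iff₀ (hpos v hv)).1 (hmin v hv)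
    · simpa only [hu.eq_zero_of_notMem hv, mul_zero] using hw.nonneg v
  have hac : a ≠ c := fun h => hct (h ▸ hat)
  have hw' := hw.absorb (hu.mono htr) (div_nonneg (hw.nonneg a) (hu.nonneg a)) hmu
  refine ⟨insert c (r.erase a), ⟨fun h => ?_, Or.inr ⟨Finset.mem_insert_self _ _, ?_⟩⟩,
    (hw'.restrict fun v hv => ?_).mem_convexHull⟩
  · simpa [hac] using h hat
  · refine K.down_closed hr (Finset.union_subset ?_ htr)
      ((hut ▸ hu.support_nonempty).mono Finset.subset_union_right)
    exact (Finset.erase_insert_subset _ _).trans (Finset.erase_subset _ _)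
  · have hva : v ≠ a := by
      rintro rfl
      refine Finsupp.mem_support_iff.1 hv ?_
      simp [Finsupp.single_eq_of_ne hac, div_mul_cancel₀ _ (hpos v hat).ne']
    simpa [hva] using hw'.support_subset hv

theorem exists_subdivides_faces_eq_stellarFaces (hu : IsBarycentric t u c) (hut : u.support = t)
    (hc : c ∉ K.vertices) (hct : c ∉ t) :
    ∃ K' : SimplicialComplex ℝ V, Subdivides K' K ∧ K'.faces = stellarFaces K t c := by
  have hsub : ∀ s ∈ stellarFaces K t c, ∃ r ∈ K.faces,
      convexHull ℝ (s : Set V) ⊆ convexHull ℝ (r : Set V) := by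
    intro s hs
    obtain ⟨r, hr, hwr⟩ := exists_mem_faces_isBarycentric_replace hs hu hc
    refine ⟨r, hr, fun x hx => ?_⟩
    obtain ⟨w, hw⟩ := exists_isBarycentric hx
    exact (hwr w x hw).mem_convexHull
  refine ⟨complexOfUniqueWeights (stellarFaces K t c) isRelLowerSet_stellarFaces
    fun s hs s' hs' w w' x => isBarycentric_unique_of_mem_stellarFaces hu hut hc hct hs hs',
    ⟨Subset.antisymm (fun x hx => ?_) fun x hx => ?_, hsub⟩, rfl⟩
  · obtain ⟨s, hs, hxs⟩ := mem_space_iff.1 hx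
    obtain ⟨r, hr, hsr⟩ := hsub s hs
    exact mem_space_iff.2 ⟨r, hr, hsr hxs⟩
  · obtain ⟨r, hr, hxr⟩ := mem_space_iff.1 hx
    exact mem_space_iff.2 (exists_mem_stellarFaces_mem_convexHull hu hut hct hr hxr)

end StellarSubdivision

section Slicing

variable {V : Type*} [AddCommGroup V] [Module ℝ V]

/-- `h` does not change sign on any face of `K`. -/
def HasConstSignOnFaces (K : SimplicialComplex ℝ V) (h : V →ᵃ[ℝ] ℝ) : Prop :=
  ∀ s ∈ K.faces, (∀ v ∈ convexHull ℝ (s : Set V), 0 ≤ h v) ∨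
    ∀ v ∈ convexHull ℝ (s : Set V), h v ≤ 0

theorem HasConstSignOnFaces.of_subdivides {K K' : SimplicialComplex ℝ V} {h : V →ᵃ[ℝ] ℝ}
    (hK : HasConstSignOnFaces K h) (hK' : Subdivides K' K) : HasConstSignOnFaces K' h := by
  intro s hs
  obtain ⟨t, ht, hst⟩ := hK'.2 s hs
  exact (hK t ht).imp (fun H v hv => H v (hst hv)) fun H v hv => H v (hst hv)

theorem nonneg_on_convexHull {s : Set V} {h : V →ᵃ[ℝ] ℝ} (hs : ∀ v ∈ s, 0 ≤ h v) :
    ∀ v ∈ convexHull ℝ s, 0 ≤ h v :=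
  convexHull_min (t := h ⁻¹' Ici 0) hs ((convex_Ici 0).affine_preimage h)

theorem nonpos_on_convexHull {s : Set V} {h : V →ᵃ[ℝ] ℝ} (hs : ∀ v ∈ s, h v ≤ 0) :
    ∀ v ∈ convexHull ℝ s, h v ≤ 0 :=
  convexHull_min (t := h ⁻¹' Iic 0) hs ((convex_Iic 0).affine_preimage h)

/-- The edges of `K` crossing the hyperplane `h = 0`, from its positive to its negative side. -/
def crossingEdges (K : SimplicialComplex ℝ V) (h : V →ᵃ[ℝ] ℝ) : Set (V × V) :=
  {p | ∃ s ∈ K.faces, p.1 ∈ s ∧ p.2 ∈ s ∧ 0 < h p.1 ∧ h p.2 < 0}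

variable {K : SimplicialComplex ℝ V} {h : V →ᵃ[ℝ] ℝ}

theorem finite_crossingEdges (hK : K.faces.Finite) : (crossingEdges K h).Finite := by
  refine (hK.biUnion (t := fun s => ((s ×ˢ s : Finset (V × V)) : Set (V × V)))
    fun t _ => Finset.finite_toSet _).subset ?_
  rintro p ⟨s, hs, hp₁, hp₂, -⟩
  exact mem_biUnion hs (by simp [hp₁, hp₂])

theorem hasConstSignOnFaces_of_crossingEdges_eq_empty (hK : crossingEdges K h = ∅) :
    HasConstSignOnFaces K h := by
  intro s hs
  by_cases! hpos : ∃ a ∈ s, 0 < h a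
  · obtain ⟨a, ha, ha0⟩ := hpos
    refine Or.inl (nonneg_on_convexHull fun b hb => ?_)
    by_contra! hb0
    have hab : (a, b) ∈ crossingEdges K h := ⟨s, hs, ha, hb, ha0, hb0⟩
    rw [hK] at hab
    exact hab
  · exact Or.inr (nonpos_on_convexHull hpos)

theorem exists_mem_segment_eq_zero {a b : V} (ha : 0 < h a) (hb : h b < 0) :
    ∃ c ∈ segment ℝ a b, h c = 0 := by
  have hd : 0 < h a - h b := by linarith
  refine ⟨AffineMap.lineMap a b (h a / (h a - h b)),
    lineMap_mem_segment ℝ a b ⟨by positivity, (div_le_one hd).2 (by linarith)⟩, ?_⟩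
  rw [AffineMap.apply_lineMap, AffineMap.lineMap_apply_ring]
  field_simp
  ring

theorem crossingEdges_ssubset [DecidableEq V] {K' : SimplicialComplex ℝ V} {a b c : V}
    (hab : (a, b) ∈ crossingEdges K h) (hc : h c = 0)
    (hK' : K'.faces = stellarFaces K {a, b} c) : crossingEdges K' h ⊂ crossingEdges K h := by
  rw [ssubset_iff_of_subset]
  · refine ⟨(a, b), hab, ?_⟩
    rintro ⟨s, hs, has, hbs, -⟩
    rw [hK'] at hs
    exact hs.1 (by simp [Finset.insert_subset_iff, has, hbs])
  · rintro ⟨p, q⟩ ⟨s, hs, hps, hqs, hp, hq⟩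
    rw [hK'] at hs
    obtain ⟨-, hs | ⟨-, hs⟩⟩ := hs
    · exact ⟨s, hs, hps, hqs, hp, hq⟩
    · have hpc : p ≠ c := by rintro rfl; exact hp.ne' hc
      have hqc : q ≠ c := by rintro rfl; exact hq.ne hc
      exact ⟨_, hs, Finset.mem_union_left _ (Finset.mem_erase.2 ⟨hpc, hps⟩),
        Finset.mem_union_left _ (Finset.mem_erase.2 ⟨hqc, hqs⟩), hp, hq⟩

theorem IsBarycentric.support_eq_pair [DecidableEq V] {a b c : V} {u : V →₀ ℝ}
    (hu : IsBarycentric {a, b} u c) (ha : a ≠ c) (hb : b ≠ c) : u.support = {a, b} := by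
  have hne : ∀ p q : V, q ≠ c → IsBarycentric {p, q} u c → u p ≠ 0 := by
    intro p q hqc hu hup
    have hq : IsBarycentric {q} u c := hu.restrict fun v hv => by
      have hvp : v ≠ p := by rintro rfl; exact Finsupp.mem_support_iff.1 hv hup
      simpa [hvp] using hu.support_subset hv
    have hcq := hq.mem_convexHull
    rw [Finset.coe_singleton, convexHull_singleton] at hcq
    exact hqc hcq.symm
  refine hu.support_subset.antisymm fun v hv => Finsupp.mem_support_iff.2 ?_
  rcases Finset.mem_insert.1 hv with rfl | hv
  · exact hne _ _ hb hu
  · rw [Finset.mem_singleton.1 hv]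
    exact hne _ _ ha (Finset.pair_comm a b ▸ hu)

theorem exists_subdivides_crossingEdges_ssubset (hK : K.faces.Finite)
    (hne : (crossingEdges K h).Nonempty) :
    ∃ K' : SimplicialComplex ℝ V, K'.faces.Finite ∧ Subdivides K' K ∧
      crossingEdges K' h ⊂ crossingEdges K h := by
  classical
  obtain ⟨⟨a, b⟩, hcross⟩ := hne
  obtain ⟨s, hs, has, hbs, ha, hb⟩ := hcross
  have hab : {a, b} ∈ K.faces := K.down_closed hs
    (Finset.insert_subset has (Finset.singleton_subset_iff.2 hbs)) (Finset.insert_nonempty _ _)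
  obtain ⟨c, hcab, hc⟩ := exists_mem_segment_eq_zero ha hb
  rw [← convexHull_pair, ← Finset.coe_pair] at hcab
  obtain ⟨u, hu⟩ := exists_isBarycentric hcab
  have hac : a ≠ c := by rintro rfl; exact ha.ne' hc
  have hbc : b ≠ c := by rintro rfl; exact hb.ne hc
  have hct : c ∉ ({a, b} : Finset V) := by simp [hac.symm, hbc.symm]
  have hc_vertices : c ∉ K.vertices := fun h =>
    hct ((vertex_mem_convexHull_iff h hab).1 hcab)
  obtain ⟨K', hK', hfaces⟩ := exists_subdivides_faces_eq_stellarFaces hu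
    (hu.support_eq_pair hac hbc) hc_vertices hct
  exact ⟨K', hfaces ▸ finite_stellarFaces hK, hK',
    crossingEdges_ssubset ⟨s, hs, has, hbs, ha, hb⟩ hc hfaces⟩

theorem exists_subdivides_hasConstSignOnFaces (h : V →ᵃ[ℝ] ℝ) {K : SimplicialComplex ℝ V}
    (hK : K.faces.Finite) :
    ∃ K' : SimplicialComplex ℝ V, K'.faces.Finite ∧ Subdivides K' K ∧ HasConstSignOnFaces K' h := by
  induction hn : (crossingEdges K h).ncard using Nat.strong_induction_on generalizing K with
  | _ n ih =>
    obtain hempty | hne := (crossingEdges K h).eq_empty_or_nonempty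
    · exact ⟨K, hK, Subdivides.refl K, hasConstSignOnFaces_of_crossingEdges_eq_empty hempty⟩
    obtain ⟨K₁, hK₁, hK₁K, hlt⟩ := exists_subdivides_crossingEdges_ssubset hK hne
    obtain ⟨K₂, hK₂, hK₂K₁, hsign⟩ :=
      ih _ (hn ▸ ncard_lt_ncard hlt (finite_crossingEdges hK)) hK₁ rfl
    exact ⟨K₂, hK₂, hK₂K₁.trans hK₁K, hsign⟩

theorem exists_subdivides_forall_hasConstSignOnFaces {H : Set (V →ᵃ[ℝ] ℝ)} (hH : H.Finite)
    (K : SimplicialComplex ℝ V) (hK : K.faces.Finite) :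
    ∃ K' : SimplicialComplex ℝ V, K'.faces.Finite ∧ Subdivides K' K ∧
      ∀ h ∈ H, HasConstSignOnFaces K' h := by
  induction H, hH using Set.Finite.induction_on with
  | empty => exact ⟨K, hK, Subdivides.refl K, fun _ hh => absurd hh (notMem_empty _)⟩
  | @insert h H _ _ ih =>
    obtain ⟨K₁, hK₁, hK₁K, hsign⟩ := ih
    obtain ⟨K₂, hK₂, hK₂K₁, hsign'⟩ := exists_subdivides_hasConstSignOnFaces h hK₁
    refine ⟨K₂, hK₂, hK₂K₁.trans hK₁K, ?_⟩
    rintro g (rfl | hg)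
    exacts [hsign', (hsign g hg).of_subdivides hK₂K₁]

end Slicing

/-! ### Polytopes and piecewise linear maps -/

section AffineExtension

variable {V W : Type*} [AddCommGroup V] [Module ℝ V] [FiniteDimensional ℝ V]
  [AddCommGroup W] [Module ℝ W] {s : Finset V}

theorem exists_affineBasis_of_affineIndependent (hs : AffineIndependent ℝ ((↑) : s → V)) :
    ∃ (t : Finset V) (b : AffineBasis t ℝ V), s ⊆ t ∧ ∀ i, b i = i := by
  obtain ⟨t, hst, ht, htop⟩ := exists_subset_affineIndependent_affineSpan_eq_top hs
  lift t to Finset V using finite_set_of_fin_dim_affineIndependent ℝ ht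
  exact ⟨t, ⟨((↑) : t → V), ht, by simpa using htop⟩, hst, fun _ => rfl⟩

theorem exists_affineMap_forall_mem_eq (hs : AffineIndependent ℝ ((↑) : s → V)) (g : V → W) :
    ∃ φ : V →ᵃ[ℝ] W, ∀ v ∈ s, φ v = g v := by
  classical
  obtain ⟨t, b, hst, hb⟩ := exists_affineBasis_of_affineIndependent hs
  refine ⟨(Fintype.linearCombination ℝ fun i : t => g i).toAffineMap.comp b.coords, fun v hv => ?_⟩
  have hcoord : ∀ i, b.coord i v = if i = ⟨v, hst hv⟩ then 1 else 0 := fun i => by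
    rw [← b.coord_apply, hb]
  simp [Fintype.linearCombination_apply, hcoord]

/-- A simplex is the intersection of the half-spaces `0 ≤ bᵢ`, and `bᵢ ≤ 0` for the vertices `i`
not in it, where the `bᵢ` are the barycentric coordinates of an affine basis containing `s`. -/
theorem exists_halfspaces_of_affineIndependent (hs : AffineIndependent ℝ ((↑) : s → V)) :
    ∃ H : Set (V →ᵃ[ℝ] ℝ), H.Finite ∧ ∀ x, x ∈ convexHull ℝ (s : Set V) ↔ ∀ h ∈ H, 0 ≤ h x := by
  classical
  obtain ⟨t, b, hst, hb⟩ := exists_affineBasis_of_affineIndependent hs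
  have hcoord : ∀ (i : t) (w : V →₀ ℝ) (x : V), IsBarycentric t w x → b.coord i x = w i := by
    intro i w x hw
    have hbv : ∀ v : t, b.coord i v = if i = v then 1 else 0 := fun v => by
      rw [← b.coord_apply, hb]
    rw [hw.map_affine, ← Finset.sum_coe_sort]
    simp [hbv]
  refine ⟨range b.coord ∪ (fun i => -b.coord i) '' {i : t | (i : V) ∉ s},
    (finite_range _).union ((toFinite _).image _), fun x => ⟨fun hx => ?_, fun hx => ?_⟩⟩
  · obtain ⟨w, hw⟩ := exists_isBarycentric hx
    rintro _ (⟨i, rfl⟩ | ⟨i, hi, rfl⟩)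
    · exact (hw.nonneg i).trans_eq (hcoord i w x (hw.mono hst)).symm
    · simp only [AffineMap.coe_neg, Pi.neg_apply, hcoord i w x (hw.mono hst),
        hw.eq_zero_of_notMem hi, neg_zero, le_refl]
  · have hxt : x ∈ convexHull ℝ (t : Set V) := by
      have hrange : range b = t := by ext v; simp [hb]
      rw [← hrange, b.convexHull_eq_nonneg_coord]
      exact fun i => hx _ (Or.inl ⟨i, rfl⟩)
    obtain ⟨w, hw⟩ := exists_isBarycentric hxt
    refine (hw.restrict fun v hv => ?_).mem_convexHull
    by_contra hvs
    have hv0 : 0 ≤ (-b.coord ⟨v, hw.support_subset hv⟩) x := hx _ (Or.inr ⟨_, hvs, rfl⟩)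
    rw [AffineMap.coe_neg, Pi.neg_apply, hcoord _ w x hw] at hv0
    linarith [hw.pos_of_mem_support hv]

end AffineExtension

section Compatibility

variable {V : Type*} [AddCommGroup V] [Module ℝ V] {K : SimplicialComplex ℝ V}

/-- Every face of `K` whose relative interior meets `R` lies in `R`. -/
def IsCompatible (K : SimplicialComplex ℝ V) (R : Set V) : Prop :=
  ∀ x ∈ R, ∀ s, IsCarrier K x s → convexHull ℝ (s : Set V) ⊆ R

theorem IsCompatible.biUnion {ι : Type*} {I : Set ι} {R : ι → Set V}
    (h : ∀ i ∈ I, IsCompatible K (R i)) : IsCompatible K (⋃ i ∈ I, R i) := by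
  intro x hx s hs
  obtain ⟨i, hi, hxi⟩ := mem_iUnion₂.1 hx
  exact (h i hi x hxi s hs).trans (subset_biUnion_of_mem (u := R) hi)

theorem isCompatible_of_hasConstSignOnFaces {H : Set (V →ᵃ[ℝ] ℝ)} {R : Set V}
    (hR : ∀ x, x ∈ R ↔ ∀ h ∈ H, 0 ≤ h x) (hK : ∀ h ∈ H, HasConstSignOnFaces K h) :
    IsCompatible K R := by
  intro x hx s hs v hv
  refine (hR v).2 fun h hh => ?_
  rcases hK h hh s hs.mem_faces with hpos | hneg
  · exact hpos v hv
  · refine nonneg_on_convexHull (fun u hu => ?_) v hv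
    exact (hs.eq_zero_of_nonpos (fun u hu => hneg u (subset_convexHull ℝ _ hu))
      ((hR x).1 hx h hh) hu).ge

theorem exists_simplicialComplex_of_affineIndependent {s : Finset V}
    (hs : AffineIndependent ℝ ((↑) : s → V)) :
    ∃ K : SimplicialComplex ℝ V, K.faces.Finite ∧ K.space = convexHull ℝ (s : Set V) := by
  have hF : IsRelLowerSet {t | t ⊆ s ∧ t.Nonempty} Finset.Nonempty :=
    fun t ht => ⟨ht.2, fun r hrt hr => ⟨hrt.trans ht.1, hr⟩⟩
  refine ⟨complexOfUniqueWeights _ hF fun t ht r hr w w' x hw hw' =>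
    isBarycentric_unique_of_affineIndependent hs (hw.mono ht.1) (hw'.mono hr.1), ?_, ?_⟩
  · exact (Finset.finite_toSet s.powerset).subset fun t ht => Finset.mem_powerset.2 ht.1
  · refine Subset.antisymm (fun x hx => ?_) fun x hx => mem_space_iff.2 ⟨s, ?_, hx⟩
    · obtain ⟨t, ht, hxt⟩ := mem_space_iff.1 hx
      exact convexHull_mono (Finset.coe_subset.2 ht.1) hxt
    · exact ⟨subset_rfl, Finset.coe_nonempty.1 (convexHull_nonempty_iff.1 ⟨x, hx⟩)⟩

theorem exists_subdivides_isCompatible [FiniteDimensional ℝ V] {K : SimplicialComplex ℝ V}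
    (hK : K.faces.Finite) {S : Set (Finset V)} (hS : S.Finite) :
    ∃ L : SimplicialComplex ℝ V, L.faces.Finite ∧ Subdivides L K ∧
      ∀ s ∈ S, IsCompatible L (convexHull ℝ (s : Set V)) := by
  -- By Carathéodory's theorem a polytope is the union of the simplices spanned by its vertices.
  let S' : Set (Finset V) := {r | (∃ s ∈ S, r ⊆ s) ∧ AffineIndependent ℝ ((↑) : r → V)}
  have hS' : S'.Finite := by
    refine (hS.biUnion (t := fun s => (s.powerset : Set (Finset V)))
      fun s _ => Finset.finite_toSet _).subset ?_
    rintro r ⟨⟨s, hs, hrs⟩, -⟩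
    exact mem_biUnion hs (Finset.mem_coe.2 (Finset.mem_powerset.2 hrs))
  choose! H hHfin hH using fun r (hr : r ∈ S') => exists_halfspaces_of_affineIndependent hr.2
  obtain ⟨L, hL, hLK, hsign⟩ :=
    exists_subdivides_forall_hasConstSignOnFaces (hS'.biUnion hHfin) K hK
  refine ⟨L, hL, hLK, fun s hs => ?_⟩
  have hunion : convexHull ℝ (s : Set V) = ⋃ r ∈ {r : Finset V | r ⊆ s ∧
      AffineIndependent ℝ ((↑) : r → V)}, convexHull ℝ (r : Set V) := by
    rw [convexHull_eq_union]
    simp only [mem_ofPred_eq, Finset.coe_subset, iUnion_and]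
  rw [hunion]
  refine IsCompatible.biUnion fun r hr => ?_
  have hrS' : r ∈ S' := ⟨⟨s, hs, hr.1⟩, hr.2⟩
  exact isCompatible_of_hasConstSignOnFaces (hH r hrS') fun h hh => hsign h (mem_biUnion hrS' hh)

end Compatibility

section Triangulation

variable {E : Type*} [NormedAddCommGroup E] [NormedSpace ℝ E]

theorem isCompact_convexHull_finset (s : Finset E) : IsCompact (convexHull ℝ (s : Set E)) :=
  s.finite_toSet.isCompact_convexHull (𝕜 := ℝ)

variable [FiniteDimensional ℝ E]

theorem exists_affineIndependent_convexHull_mem_nhds (x : E) {U : Set E} (hU : U ∈ 𝓝 x) :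
    ∃ s : Finset E, AffineIndependent ℝ ((↑) : s → E) ∧ convexHull ℝ (s : Set E) ∈ 𝓝 x ∧
      convexHull ℝ (s : Set E) ⊆ U := by
  obtain ⟨b, hb, hbU⟩ := exists_mem_interior_convexHull_affineBasis hU
  obtain ⟨s, hs⟩ := (finite_range b).exists_finset_coe
  have hind : AffineIndependent ℝ (fun v : (s : Set E) => (v : E)) := by
    rw [hs]
    exact b.ind.range
  exact ⟨s, hind, hs ▸ mem_interior_iff_mem_nhds.1 hb, hs ▸ hbU⟩

open Pointwise in
theorem exists_affineIndependent_subset_convexHull {B : Set E} (hB : Bornology.IsBounded B) :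
    ∃ s : Finset E, AffineIndependent ℝ ((↑) : s → E) ∧ B ⊆ convexHull ℝ (s : Set E) := by
  obtain ⟨b, hb, -⟩ := exists_mem_interior_convexHull_affineBasis (x := (0 : E)) Filter.univ_mem
  obtain ⟨r, hr, hBr⟩ := (NormedSpace.isVonNBounded_of_isBounded ℝ hB
    (mem_interior_iff_mem_nhds.1 hb)).exists_pos
  let u : ℝˣ := Units.mk0 r hr.ne'
  obtain ⟨s, hs⟩ := (finite_range (u • b)).exists_finset_coe
  have hind : AffineIndependent ℝ (fun v : (s : Set E) => (v : E)) := by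
    rw [hs]
    exact (u • b).ind.range
  refine ⟨s, hind, ?_⟩
  have hrange : (s : Set E) = r • range b := by
    rw [hs, AffineBasis.coe_smul, ← image_smul, ← range_comp]
    rfl
  rw [hrange, convexHull_smul]
  exact hBr r (le_abs_self r)

theorem exists_finite_cover_small_simplices {B : Set E} (hB : IsCompact B) {η : ℝ} (hη : 0 < η) :
    ∃ S : Set (Finset E), S.Finite ∧ B ⊆ (⋃ s ∈ S, convexHull ℝ (s : Set E)) ∧
      ∀ s ∈ S, ∀ x ∈ convexHull ℝ (s : Set E), ∀ y ∈ convexHull ℝ (s : Set E), dist x y < η := by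
  choose σ _ hσ_nhds hσ_small using fun x : E =>
    exists_affineIndependent_convexHull_mem_nhds x (Metric.ball_mem_nhds x (half_pos hη))
  obtain ⟨T, -, hT⟩ := hB.elim_nhds_subcover (fun x => convexHull ℝ (σ x : Set E))
    fun x _ => hσ_nhds x
  refine ⟨σ '' T, T.finite_toSet.image σ, by rwa [biUnion_image], ?_⟩
  rintro _ ⟨p, -, rfl⟩ x hx y hy
  calc dist x y ≤ dist x p + dist y p := dist_triangle_right _ _ _
    _ < η / 2 + η / 2 := add_lt_add (hσ_small p hx) (hσ_small p hy)
    _ = η := add_halves η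

theorem exists_triangulation {S : Set (Finset E)} (hS : S.Finite) {η : ℝ} (hη : 0 < η) :
    ∃ L : SimplicialComplex ℝ E, L.faces.Finite ∧
      (∀ s ∈ S, convexHull ℝ (s : Set E) ⊆ L.space ∧
        IsCompatible L (convexHull ℝ (s : Set E))) ∧
      ∀ s ∈ L.faces, ∀ x ∈ convexHull ℝ (s : Set E), ∀ y ∈ convexHull ℝ (s : Set E),
        dist x y < η := by
  have hbdd : Bornology.IsBounded (⋃ s ∈ S, convexHull ℝ (s : Set E)) :=
    (Bornology.isBounded_biUnion hS).2 fun s _ => (isCompact_convexHull_finset s).isBounded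
  obtain ⟨Δ, hΔ, hsub⟩ := exists_affineIndependent_subset_convexHull hbdd
  obtain ⟨K, hK, hKΔ⟩ := exists_simplicialComplex_of_affineIndependent hΔ
  obtain ⟨T, hT, hcover, hsmall⟩ :=
    exists_finite_cover_small_simplices (isCompact_convexHull_finset Δ) hη
  obtain ⟨L, hL, hLK, hcompat⟩ := exists_subdivides_isCompatible hK (hS.union hT)
  have hspace : L.space = convexHull ℝ (Δ : Set E) := hLK.1.trans hKΔ
  refine ⟨L, hL, fun s hs => ⟨?_, hcompat s (Or.inl hs)⟩, fun s hs x hx y hy => ?_⟩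
  · rw [hspace]
    exact (subset_biUnion_of_mem (u := fun s : Finset E => convexHull ℝ (s : Set E)) hs).trans hsub
  · obtain ⟨z, hz⟩ := exists_isCarrier_of_mem_faces hs
    obtain ⟨r, hr, hzr⟩ := mem_iUnion₂.1
      (hcover (hspace ▸ mem_space_iff.2 ⟨s, hs, hz.mem_convexHull⟩))
    have hsr := hcompat r (Or.inr hr) z hzr s hz
    exact hsmall r hr x (hsr hx) y (hsr hy)

end Triangulation

section ConvexAffine

variable {V W W' : Type*} [AddCommGroup V] [Module ℝ V] [AddCommGroup W] [Module ℝ W]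
  [AddCommGroup W'] [Module ℝ W']

/-- `F` preserves convex combinations of points of `C`. -/
def ConvexAffineOn (F : V → W) (C : Set V) : Prop :=
  ∀ x ∈ C, ∀ y ∈ C, ∀ a b : ℝ, 0 ≤ a → 0 ≤ b → a + b = 1 →
    F (a • x + b • y) = a • F x + b • F y

namespace ConvexAffineOn

variable {F G : V → W} {C D : Set V}

theorem mono (h : ConvexAffineOn F D) (hCD : C ⊆ D) : ConvexAffineOn F C :=
  fun x hx y hy => h x (hCD hx) y (hCD hy)

theorem congr (h : ConvexAffineOn F C) (hC : Convex ℝ C) (hFG : EqOn G F C) :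
    ConvexAffineOn G C := by
  intro x hx y hy a b ha hb hab
  rw [hFG (hC hx hy ha hb hab), hFG hx, hFG hy, h x hx y hy a b ha hb hab]

theorem of_affineMap (φ : V →ᵃ[ℝ] W) (C : Set V) : ConvexAffineOn φ C :=
  fun _ _ _ _ _ _ _ _ hab => Convex.combo_affine_apply hab

theorem prodMk {F' : V → W'} (hF : ConvexAffineOn F C) (hF' : ConvexAffineOn F' C) :
    ConvexAffineOn (fun x => (F x, F' x)) C := by
  intro x hx y hy a b ha hb hab
  simp only [hF x hx y hy a b ha hb hab, hF' x hx y hy a b ha hb hab, Prod.smul_mk,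
    Prod.mk_add_mk]

theorem linear_comp (hF : ConvexAffineOn F C) (L : W →ₗ[ℝ] W') :
    ConvexAffineOn (fun x => L (F x)) C := by
  intro x hx y hy a b ha hb hab
  simp only [hF x hx y hy a b ha hb hab, map_add, map_smul]

theorem comp_linear {F' : W → W'} (L : V →ₗ[ℝ] W) (hF' : ConvexAffineOn F' (L '' C)) :
    ConvexAffineOn (fun x => F' (L x)) C := by
  intro x hx y hy a b ha hb hab
  simp only [map_add, map_smul]
  exact hF' _ (mem_image_of_mem _ hx) _ (mem_image_of_mem _ hy) a b ha hb hab

theorem eqOn_affineMap {s : Finset V} (hF : ConvexAffineOn F (convexHull ℝ (s : Set V)))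
    {φ : V →ᵃ[ℝ] W} (h : ∀ v ∈ s, F v = φ v) : EqOn F φ (convexHull ℝ (s : Set V)) := by
  have hconv : Convex ℝ {x ∈ convexHull ℝ (s : Set V) | F x = φ x} := by
    intro x hx y hy a b ha hb hab
    refine ⟨convex_convexHull ℝ _ hx.1 hy.1 ha hb hab, ?_⟩
    rw [hF x hx.1 y hy.1 a b ha hb hab, hx.2, hy.2, Convex.combo_affine_apply hab]
  exact fun x hx =>
    (convexHull_min (t := {x ∈ convexHull ℝ (s : Set V) | F x = φ x})
      (fun v hv => ⟨subset_convexHull ℝ _ hv, h v hv⟩) hconv hx).2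

end ConvexAffineOn

end ConvexAffine

section PLCovers

variable {V W W' : Type*} [AddCommGroup V] [Module ℝ V] [AddCommGroup W] [Module ℝ W]
  [AddCommGroup W'] [Module ℝ W']

/-- A finite union of polytopes. -/
def IsPolyhedral (X : Set V) : Prop :=
  ∃ S : Set (Finset V), S.Finite ∧ X = ⋃ s ∈ S, convexHull ℝ (s : Set V)

/-- `X` is a finite union of polytopes on each of which `F` preserves convex combinations. In finite
dimension this is the same as `IsPLOn F X`, but the polytopes need not fit together. -/
def HasPLCover (F : V → W) (X : Set V) : Prop :=
  ∃ S : Set (Finset V), S.Finite ∧ X = (⋃ s ∈ S, convexHull ℝ (s : Set V)) ∧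
    ∀ s ∈ S, ConvexAffineOn F (convexHull ℝ (s : Set V))

variable {F G : V → W} {X Y : Set V}

theorem HasPLCover.isPolyhedral (h : HasPLCover F X) : IsPolyhedral X := by
  obtain ⟨S, hS, hX, -⟩ := h
  exact ⟨S, hS, hX⟩

theorem IsPLOn.hasPLCover (h : IsPLOn F X) : HasPLCover F X := by
  obtain ⟨K, hK, hKX, hF⟩ := h
  refine ⟨K.faces, hK, hKX.symm, fun s hs => ?_⟩
  obtain ⟨φ, hφ⟩ := hF s hs
  exact (ConvexAffineOn.of_affineMap φ _).congr (convex_convexHull ℝ _) hφ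

theorem isPolyhedral_convexHull (s : Finset V) : IsPolyhedral (convexHull ℝ (s : Set V)) :=
  ⟨{s}, finite_singleton _, by simp⟩

theorem IsPolyhedral.biUnion {ι : Type*} {I : Set ι} (hI : I.Finite) {X : ι → Set V}
    (h : ∀ i ∈ I, IsPolyhedral (X i)) : IsPolyhedral (⋃ i ∈ I, X i) := by
  choose! S hS hX using h
  refine ⟨⋃ i ∈ I, S i, hI.biUnion hS, ?_⟩
  simp only [biUnion_iUnion]
  exact iUnion₂_congr hX

theorem HasPLCover.biUnion {ι : Type*} {I : Set ι} (hI : I.Finite) {X : ι → Set V}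
    (h : ∀ i ∈ I, HasPLCover F (X i)) : HasPLCover F (⋃ i ∈ I, X i) := by
  choose! S hS hX hF using h
  refine ⟨⋃ i ∈ I, S i, hI.biUnion hS, ?_, ?_⟩
  · simp only [biUnion_iUnion]
    exact iUnion₂_congr hX
  · intro s hs
    obtain ⟨i, hi, his⟩ := mem_iUnion₂.1 hs
    exact hF i hi s his

theorem HasPLCover.union (hX : HasPLCover F X) (hY : HasPLCover F Y) : HasPLCover F (X ∪ Y) := by
  obtain ⟨S, hS, rfl, hFS⟩ := hX
  obtain ⟨T, hT, rfl, hFT⟩ := hY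
  exact ⟨S ∪ T, hS.union hT, by rw [biUnion_union], fun s hs => hs.elim (hFS s) (hFT s)⟩

theorem HasPLCover.congr (hF : HasPLCover F X) (h : EqOn G F X) : HasPLCover G X := by
  obtain ⟨S, hS, rfl, hF⟩ := hF
  exact ⟨S, hS, rfl, fun s hs => (hF s hs).congr (convex_convexHull ℝ _)
    (h.mono (subset_biUnion_of_mem (u := fun s : Finset V => convexHull ℝ (s : Set V)) hs))⟩

theorem HasPLCover.linear_comp (hF : HasPLCover F X) (L : W →ₗ[ℝ] W') :
    HasPLCover (fun x => L (F x)) X := by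
  obtain ⟨S, hS, hX, hF⟩ := hF
  exact ⟨S, hS, hX, fun s hs => (hF s hs).linear_comp L⟩

theorem IsPolyhedral.hasPLCover_affineMap (hX : IsPolyhedral X) (φ : V →ᵃ[ℝ] W) :
    HasPLCover φ X := by
  obtain ⟨S, hS, hX⟩ := hX
  exact ⟨S, hS, hX, fun s _ => ConvexAffineOn.of_affineMap φ _⟩

theorem HasPLCover.comp_fst_prod {Y : Set W'} (hF : HasPLCover F X) (hY : IsPolyhedral Y) :
    HasPLCover (fun p : V × W' => F p.1) (X ×ˢ Y) := by
  obtain ⟨S, hS, rfl, hF⟩ := hF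
  obtain ⟨T, hT, rfl⟩ := hY
  refine ⟨(fun p : Finset V × Finset W' => p.1 ×ˢ p.2) '' (S ×ˢ T), (hS.prod hT).image _, ?_, ?_⟩
  · rw [biUnion_image]
    simp only [Finset.coe_product, convexHull_prod]
    ext ⟨x, y⟩
    simp only [mem_prod, mem_iUnion, exists_prop, Prod.exists]
    tauto
  · rintro _ ⟨⟨s, t⟩, ⟨hs, -⟩, rfl⟩
    refine ConvexAffineOn.comp_linear (LinearMap.fst ℝ V W') ((hF s hs).mono ?_)
    rintro _ ⟨⟨x, y⟩, hxy, rfl⟩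
    rw [Finset.coe_product, convexHull_prod] at hxy
    exact hxy.1

theorem IsPolyhedral.prod {Y : Set W} (hX : IsPolyhedral X) (hY : IsPolyhedral Y) :
    IsPolyhedral (X ×ˢ Y) :=
  ((hX.hasPLCover_affineMap (AffineMap.const ℝ V (0 : ℝ))).comp_fst_prod hY).isPolyhedral

theorem isPolyhedral_plBall (n : ℕ) : IsPolyhedral (plBall n) := by
  classical
  refine ⟨{Fintype.piFinset fun _ => {-1, 1}}, finite_singleton _, ?_⟩
  have hseg : convexHull ℝ ({-1, 1} : Set ℝ) = Icc (-1) 1 := by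
    rw [convexHull_pair, segment_eq_Icc (by norm_num)]
  rw [biUnion_singleton, Fintype.coe_piFinset, convexHull_pi]
  ext x
  simp only [Finset.coe_insert, Finset.coe_singleton, hseg, plBall, mem_closedBall_zero_iff,
    pi_norm_le_iff_of_nonneg zero_le_one, Real.norm_eq_abs, abs_le, mem_univ_pi, mem_Icc]

end PLCovers

section PLCalculus

variable {V : Type*} [NormedAddCommGroup V] [NormedSpace ℝ V]
  {W W' : Type*} [AddCommGroup W] [Module ℝ W] [AddCommGroup W'] [Module ℝ W']
  {F : V → W} {X Y : Set V}

theorem IsPolyhedral.isCompact (hX : IsPolyhedral X) : IsCompact X := by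
  obtain ⟨S, hS, rfl⟩ := hX
  exact hS.isCompact_biUnion fun s _ => isCompact_convexHull_finset s

variable [FiniteDimensional ℝ V]

theorem exists_common_refinement {S T : Set (Finset V)} (hS : S.Finite) (hT : T.Finite) :
    ∃ K : SimplicialComplex ℝ V, K.faces.Finite ∧
      K.space = (⋃ s ∈ S, convexHull ℝ (s : Set V)) ∩ (⋃ s ∈ T, convexHull ℝ (s : Set V)) ∧
      ∀ r ∈ K.faces, (∃ s ∈ S, convexHull ℝ (r : Set V) ⊆ convexHull ℝ (s : Set V)) ∧
        ∃ s ∈ T, convexHull ℝ (r : Set V) ⊆ convexHull ℝ (s : Set V) := by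
  obtain ⟨L, hL, hLR, -⟩ := exists_triangulation (hS.union hT) one_pos
  let K : SimplicialComplex ℝ V :=
    { faces := {r | r ∈ L.faces ∧
        (∃ s ∈ S, convexHull ℝ (r : Set V) ⊆ convexHull ℝ (s : Set V)) ∧
          ∃ s ∈ T, convexHull ℝ (r : Set V) ⊆ convexHull ℝ (s : Set V)}
      indep := fun hs => L.indep hs.1
      isRelLowerSet_faces := by
        rintro r ⟨hr, ⟨s, hs, hrs⟩, ⟨t, ht, hrt⟩⟩
        refine ⟨L.nonempty_of_mem_faces hr, fun r' hr' hne => ?_⟩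
        have hsub := convexHull_mono (𝕜 := ℝ) (Finset.coe_subset.2 hr')
        exact ⟨L.down_closed hr hr' hne, ⟨s, hs, hsub.trans hrs⟩, ⟨t, ht, hsub.trans hrt⟩⟩
      inter_subset_convexHull := fun hs ht => L.inter_subset_convexHull hs.1 ht.1 }
  refine ⟨K, hL.subset fun r hr => hr.1, Subset.antisymm ?_ ?_, fun r hr => hr.2⟩
  · intro x hx
    obtain ⟨r, ⟨-, ⟨s, hs, hrs⟩, ⟨t, ht, hrt⟩⟩, hxr⟩ := mem_space_iff.1 hx
    exact ⟨mem_biUnion hs (hrs hxr), mem_biUnion ht (hrt hxr)⟩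
  · rintro x ⟨hxS, hxT⟩
    obtain ⟨s, hs, hxs⟩ := mem_iUnion₂.1 hxS
    obtain ⟨t, ht, hxt⟩ := mem_iUnion₂.1 hxT
    obtain ⟨hsL, hs_compat⟩ := hLR s (Or.inl hs)
    obtain ⟨-, ht_compat⟩ := hLR t (Or.inr ht)
    obtain ⟨r, hr⟩ := exists_isCarrier_of_mem_space (hsL hxs)
    exact mem_space_iff.2 ⟨r, ⟨hr.mem_faces, ⟨s, hs, hs_compat x hxs r hr⟩,
      ⟨t, ht, ht_compat x hxt r hr⟩⟩, hr.mem_convexHull⟩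

theorem HasPLCover.isPLOn (h : HasPLCover F X) : IsPLOn F X := by
  obtain ⟨S, hS, rfl, hF⟩ := h
  obtain ⟨K, hK, hKS, hK'⟩ := exists_common_refinement hS hS
  refine ⟨K, hK, by rw [hKS, inter_self], fun r hr => ?_⟩
  obtain ⟨⟨s, hs, hrs⟩, -⟩ := hK' r hr
  obtain ⟨φ, hφ⟩ := exists_affineMap_forall_mem_eq (K.indep hr) F
  exact ⟨φ, ((hF s hs).mono hrs).eqOn_affineMap fun v hv => (hφ v hv).symm⟩

theorem HasPLCover.inter (h : HasPLCover F X) (hY : IsPolyhedral Y) : HasPLCover F (X ∩ Y) := by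
  obtain ⟨S, hS, rfl, hF⟩ := h
  obtain ⟨T, hT, rfl⟩ := hY
  obtain ⟨K, hK, hKS, hK'⟩ := exists_common_refinement hS hT
  refine ⟨K.faces, hK, hKS.symm, fun r hr => ?_⟩
  obtain ⟨⟨s, hs, hrs⟩, -⟩ := hK' r hr
  exact (hF s hs).mono hrs

theorem HasPLCover.mono (h : HasPLCover F X) (hY : IsPolyhedral Y) (hYX : Y ⊆ X) :
    HasPLCover F Y :=
  inter_eq_right.2 hYX ▸ h.inter hY

theorem HasPLCover.prodMk {G : V → W'} (hF : HasPLCover F X) (hG : HasPLCover G X) :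
    HasPLCover (fun x => (F x, G x)) X := by
  obtain ⟨S, hS, hXS, hF⟩ := hF
  obtain ⟨T, hT, hXT, hG⟩ := hG
  obtain ⟨K, hK, hKS, hK'⟩ := exists_common_refinement hS hT
  refine ⟨K.faces, hK, ?_, fun r hr => ?_⟩
  · rw [← hXS, ← hXT, inter_self] at hKS
    exact hKS.symm
  · obtain ⟨⟨s, hs, hrs⟩, ⟨t, ht, hrt⟩⟩ := hK' r hr
    exact ((hF s hs).mono hrs).prodMk ((hG t ht).mono hrt)

variable {E : Type*} [NormedAddCommGroup E] [NormedSpace ℝ E]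

theorem HasPLCover.continuousOn {F : V → E} (h : HasPLCover F X) : ContinuousOn F X := by
  obtain ⟨K, hK, rfl, hF⟩ := h.isPLOn
  have := hK.to_subtype
  rw [SimplicialComplex.space, biUnion_eq_iUnion]
  refine (locallyFinite_of_finite _).continuousOn_iUnion
    (fun s => (isCompact_convexHull_finset s.1).isClosed) fun s => ?_
  obtain ⟨φ, hφ⟩ := hF s.1 s.2
  exact φ.continuous_of_finiteDimensional.continuousOn.congr hφ

theorem HasPLCover.isPLEmbeddingOn [FiniteDimensional ℝ E] {F : V → E} (h : HasPLCover F X)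
    (hinj : InjOn F X) : IsPLEmbeddingOn F X := by
  classical
  have hleft := hinj.leftInvOn_invFunOn
  refine ⟨h.isPLOn, Function.invFunOn F X, ?_, hleft⟩
  obtain ⟨K, hK, rfl, hF⟩ := h.isPLOn
  choose! φ hφ using hF
  have himg : ∀ s ∈ K.faces, F '' convexHull ℝ (s : Set V) =
      convexHull ℝ ((s.image (φ s) : Finset E) : Set E) := by
    intro s hs
    rw [(hφ s hs).image_eq, AffineMap.image_convexHull, Finset.coe_image]
  refine HasPLCover.isPLOn ⟨(fun s => s.image (φ s)) '' K.faces, hK.image _, ?_, ?_⟩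
  · rw [biUnion_image, SimplicialComplex.space, image_iUnion₂]
    exact iUnion₂_congr himg
  · rintro _ ⟨s, hs, rfl⟩
    simp only
    rw [← himg s hs]
    rintro _ ⟨x, hx, rfl⟩ _ ⟨y, hy, rfl⟩ a b ha hb hab
    have hsub : ∀ z ∈ convexHull ℝ (s : Set V), z ∈ K.space := fun z hz =>
      mem_space_iff.2 ⟨s, hs, hz⟩
    have hz := convex_convexHull ℝ (s : Set V) hx hy ha hb hab
    have hFz : a • F x + b • F y = F (a • x + b • y) := by
      rw [hφ s hs hz, hφ s hs hx, hφ s hs hy, Convex.combo_affine_apply hab]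
    rw [hFz, hleft (hsub _ hz), hleft (hsub _ hx), hleft (hsub _ hy)]

end PLCalculus

/-! ### Conical extension of families of lifts -/

section ConeOver

variable {V W : Type*} [AddCommGroup V] [Module ℝ V] [AddCommGroup W] [Module ℝ W]

/-- The cone with apex `v` over `B`; unlike `convexJoin ℝ {v} B`, it contains `v` also when `B` is
empty. -/
def coneOver (v : V) (B : Set V) : Set V :=
  insert v (convexJoin ℝ {v} B)

variable {v x : V} {B : Set V}

theorem mem_coneOver_iff :
    x ∈ coneOver v B ↔ x = v ∨ ∃ q ∈ B, ∃ m ∈ Icc (0 : ℝ) 1, x = AffineMap.lineMap v q m := by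
  simp only [coneOver, convexJoin_singleton_left, segment_eq_image_lineMap, mem_insert_iff,
    mem_iUnion, mem_image, exists_prop, eq_comm]

theorem apex_mem_coneOver (v : V) (B : Set V) : v ∈ coneOver v B :=
  mem_insert _ _

theorem lineMap_mem_coneOver {q : V} (hq : q ∈ B) {m : ℝ} (hm : m ∈ Icc (0 : ℝ) 1) :
    AffineMap.lineMap v q m ∈ coneOver v B :=
  mem_coneOver_iff.2 (Or.inr ⟨q, hq, m, hm, rfl⟩)

theorem subset_coneOver (v : V) (B : Set V) : B ⊆ coneOver v B := fun q hq => by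
  simpa using lineMap_mem_coneOver (v := v) hq (right_mem_Icc.2 zero_le_one)

theorem lineMap_lineMap_right (v q : V) (m m' : ℝ) :
    AffineMap.lineMap v (AffineMap.lineMap v q m) m' = AffineMap.lineMap v q (m' * m) := by
  simp only [AffineMap.lineMap_apply, vsub_eq_sub, vadd_eq_add, add_sub_cancel_right, smul_smul]

theorem lineMap_right_injective (v : V) {m : ℝ} (hm : m ≠ 0) :
    Function.Injective fun q : V => AffineMap.lineMap v q m := by
  intro q q' h
  simpa only [lineMap_lineMap_right, inv_mul_cancel₀ hm, AffineMap.lineMap_apply_one] using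
    congrArg (fun x => AffineMap.lineMap v x m⁻¹) h

theorem lineMap_mem_coneOver_of_mem {q : V} (hq : q ∈ coneOver v B) {m : ℝ}
    (hm : m ∈ Icc (0 : ℝ) 1) : AffineMap.lineMap v q m ∈ coneOver v B := by
  rcases mem_coneOver_iff.1 hq with rfl | ⟨q', hq', m', hm', rfl⟩
  · simpa using apex_mem_coneOver q B
  · rw [lineMap_lineMap_right]
    exact lineMap_mem_coneOver hq' (unitInterval.mul_mem hm hm')

theorem coneOver_biUnion {ι : Type*} (v : V) (I : Set ι) (B : ι → Set V) :
    coneOver v (⋃ i ∈ I, B i) = insert v (⋃ i ∈ I, coneOver v (B i)) := by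
  ext x
  simp only [mem_insert_iff, mem_iUnion, mem_coneOver_iff, exists_prop]
  grind

theorem convexHull_insert_eq_coneOver (v : V) (s : Set V) :
    convexHull ℝ (insert v s) = coneOver v (convexHull ℝ s) := by
  rcases s.eq_empty_or_nonempty with rfl | hs
  · simp [coneOver]
  · rw [convexHull_insert hs, coneOver, insert_eq_of_mem]
    rw [convexJoin_singleton_left]
    obtain ⟨q, hq⟩ := hs
    exact mem_biUnion (subset_convexHull ℝ s hq) (left_mem_segment ℝ v q)

theorem exists_common_dilation {a b m m' : ℝ} (ha : 0 ≤ a) (hb : 0 ≤ b) (hab : a + b = 1)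
    (hm : m ∈ Icc (0 : ℝ) 1) (hm' : m' ∈ Icc (0 : ℝ) 1) :
    ∃ M ∈ Icc (0 : ℝ) 1, ∃ α β : ℝ, 0 ≤ α ∧ 0 ≤ β ∧ α + β = 1 ∧ M * α = a * m ∧ M * β = b * m' := by
  have ham := mul_nonneg ha hm.1
  have hbm := mul_nonneg hb hm'.1
  rcases (add_nonneg ham hbm).eq_or_lt with h0 | h0
  · exact ⟨0, left_mem_Icc.2 zero_le_one, 1, 0, zero_le_one, le_rfl, add_zero 1, by linarith,
      by linarith⟩
  · refine ⟨a * m + b * m', ⟨h0.le, ?_⟩, a * m / (a * m + b * m'), b * m' / (a * m + b * m'),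
      div_nonneg ham h0.le, div_nonneg hbm h0.le, ?_, mul_div_cancel₀ _ h0.ne',
      mul_div_cancel₀ _ h0.ne'⟩
    · linarith [mul_le_of_le_one_right ha hm.2, mul_le_of_le_one_right hb hm'.2]
    · rw [← add_div, div_self h0.ne']

theorem combo_lineMap_eq_lineMap_combo {a b m m' M α β : ℝ} (hab : a + b = 1) (hαβ : α + β = 1)
    (hα : M * α = a * m) (hβ : M * β = b * m') (p q q' : V) :
    a • AffineMap.lineMap p q m + b • AffineMap.lineMap p q' m' =
      AffineMap.lineMap p (α • q + β • q') M := by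
  have hM : M = a * m + b * m' := by rw [← hα, ← hβ, ← mul_add, hαβ, mul_one]
  obtain rfl : b = 1 - a := by linarith
  simp only [AffineMap.lineMap_apply_module, smul_add M, smul_smul, hα, hβ]
  rw [hM]
  module

theorem ConvexAffineOn.coneOver {F : V → W} (hB : Convex ℝ B) (hF : ConvexAffineOn F B)
    (hcone : ∀ q ∈ B, ∀ m ∈ Icc (0 : ℝ) 1,
      F (AffineMap.lineMap v q m) = AffineMap.lineMap (F v) (F q) m) :
    ConvexAffineOn F (coneOver v B) := by
  rcases B.eq_empty_or_nonempty with rfl | ⟨q₀, hq₀⟩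
  · intro x hx y hy a b _ _ hab
    obtain rfl : x = v := by simpa [_root_.coneOver] using hx
    obtain rfl : y = x := by simpa [_root_.coneOver] using hy
    rw [← add_smul, ← add_smul, hab, one_smul, one_smul]
  have hrep : ∀ x ∈ _root_.coneOver v B, ∃ q ∈ B, ∃ m ∈ Icc (0 : ℝ) 1,
      x = AffineMap.lineMap v q m := fun x hx =>
    (mem_coneOver_iff.1 hx).elim
      (fun h => ⟨q₀, hq₀, 0, left_mem_Icc.2 zero_le_one, by simpa using h⟩) id
  intro x hx y hy a b ha hb hab
  obtain ⟨q, hq, m, hm, rfl⟩ := hrep x hx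
  obtain ⟨q', hq', m', hm', rfl⟩ := hrep y hy
  obtain ⟨M, hM, α, β, hα, hβ, hαβ, hMα, hMβ⟩ := exists_common_dilation ha hb hab hm hm'
  rw [combo_lineMap_eq_lineMap_combo hab hαβ hMα hMβ, hcone _ (hB hq hq' hα hβ hαβ) M hM,
    hF q hq q' hq' α β hα hβ hαβ, hcone q hq m hm, hcone q' hq' m' hm',
    combo_lineMap_eq_lineMap_combo hab hαβ hMα hMβ]

theorem HasPLCover.coneOver {F : V → W} (hF : HasPLCover F B)
    (hcone : ∀ q ∈ B, ∀ m ∈ Icc (0 : ℝ) 1,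
      F (AffineMap.lineMap v q m) = AffineMap.lineMap (F v) (F q) m) :
    HasPLCover F (coneOver v B) := by
  classical
  obtain ⟨S, hS, rfl, hF⟩ := hF
  refine ⟨insert {v} ((insert v) '' S), (hS.image _).insert _, ?_, ?_⟩
  · rw [coneOver_biUnion, biUnion_insert, biUnion_image]
    simp only [Finset.coe_singleton, convexHull_singleton, Finset.coe_insert,
      convexHull_insert_eq_coneOver, singleton_union]
  · rintro r (rfl | ⟨r, hr, rfl⟩)
    · rw [← insert_empty_eq, Finset.coe_insert, convexHull_insert_eq_coneOver]
      exact ConvexAffineOn.coneOver (convex_convexHull ℝ _) (by simp [ConvexAffineOn]) (by simp)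
    · rw [Finset.coe_insert, convexHull_insert_eq_coneOver]
      exact (hF r hr).coneOver (convex_convexHull ℝ _) fun q hq => hcone q (mem_biUnion hr hq)

theorem IsPolyhedral.coneOver (hB : IsPolyhedral B) (v : V) : IsPolyhedral (coneOver v B) :=
  ((hB.hasPLCover_affineMap (AffineMap.const ℝ V (0 : ℝ))).coneOver fun q _ m _ => by
    simp).isPolyhedral

theorem exists_eq_lineMap_of_mem_coneOver (hx : x ∈ coneOver v B) :
    ∃ μ ∈ Icc (0 : ℝ) 1, (μ = 0 → x = v) ∧ ∀ m, μ ≤ m → 0 < m →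
      ∃ y ∈ coneOver v B, x = AffineMap.lineMap v y m ∧ (m = μ → y ∈ B) := by
  rcases mem_coneOver_iff.1 hx with rfl | ⟨q, hq, μ, hμ, rfl⟩
  · exact ⟨0, left_mem_Icc.2 zero_le_one, fun _ => rfl,
      fun m _ hm => ⟨x, hx, by simp, fun h => absurd h hm.ne'⟩⟩
  · refine ⟨μ, hμ, fun h => by simp [h], fun m hμm hm => ⟨AffineMap.lineMap v q (μ / m),
      lineMap_mem_coneOver hq ⟨div_nonneg hμ.1 hm.le, (div_le_one hm).2 hμm⟩, ?_, ?_⟩⟩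
    · rw [lineMap_lineMap_right, mul_div_cancel₀ _ hm.ne']
    · rintro rfl
      simpa [hm.ne'] using hq

theorem coneOver_prod_closedBall (A : Type*) [NormedAddCommGroup A] [NormedSpace ℝ A] (v : V)
    (B : Set V) : coneOver v B ×ˢ Metric.closedBall (0 : A) 1 =
      coneOver (v, 0) (B ×ˢ Metric.closedBall 0 1 ∪ coneOver v B ×ˢ Metric.sphere 0 1) := by
  apply Subset.antisymm
  · rintro ⟨x, b⟩ ⟨hx, hb⟩
    rw [mem_closedBall_zero_iff] at hb
    dsimp only at hx hb
    obtain ⟨μ, hμ, hμ0, hray⟩ := exists_eq_lineMap_of_mem_coneOver hx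
    set m := max μ ‖b‖ with hm
    have hmI : m ∈ Icc (0 : ℝ) 1 := ⟨hμ.1.trans (le_max_left _ _), max_le hμ.2 hb⟩
    rcases hmI.1.eq_or_lt with h0 | hpos
    · obtain rfl : b = 0 := norm_le_zero_iff.1 (h0 ▸ le_max_right _ _)
      obtain rfl : x = v := hμ0 (le_antisymm (h0 ▸ le_max_left _ _) hμ.1)
      exact apex_mem_coneOver _ _
    obtain ⟨y, hy, rfl, hyB⟩ := hray m (le_max_left _ _) hpos
    have hnorm : ‖m⁻¹ • b‖ = ‖b‖ / m := by
      rw [norm_smul, norm_inv, Real.norm_of_nonneg hmI.1, div_eq_inv_mul]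
    refine mem_coneOver_iff.2 (Or.inr ⟨(y, m⁻¹ • b), ?_, m, hmI, ?_⟩)
    · rcases max_choice μ ‖b‖ with h | h
      · exact Or.inl ⟨hyB h, mem_closedBall_zero_iff.2
          (hnorm ▸ (div_le_one hpos).2 (le_max_right _ _))⟩
      · exact Or.inr ⟨hy, mem_sphere_zero_iff_norm.2
          (hnorm.trans ((div_eq_one_iff_eq hpos.ne').2 (hm.trans h).symm))⟩
    · simp [AffineMap.lineMap_apply, smul_smul, hpos.ne']
  · rintro p hp
    rcases mem_coneOver_iff.1 hp with rfl | ⟨q, hq, m, hm, rfl⟩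
    · exact ⟨apex_mem_coneOver v B, by simp⟩
    have hq' : q ∈ coneOver v B ×ˢ Metric.closedBall (0 : A) 1 :=
      union_subset (prod_mono_left (subset_coneOver v B))
        (prod_mono_right Metric.sphere_subset_closedBall) hq
    rw [mem_prod, AffineMap.fst_lineMap, AffineMap.snd_lineMap]
    exact ⟨lineMap_mem_coneOver_of_mem hq'.1 hm,
      (convex_closedBall (0 : A) 1).lineMap_mem (by simp) hq'.2 hm⟩

end ConeOver

section LiftFamilies

variable {V W E A : Type*}

/-- `H` is a family, parametrized by the second coordinate, of maps which take values in the
prescribed regions `R x` and separate the points of each fibre of `f`: over each parameter,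
`x ↦ (f x, H (x, b))` is an injective lift of `f`. -/
structure IsLiftFamily (f : V → W) (R : V → Set E) (X : Set (V × A)) (H : V × A → E) : Prop where
  mem : ∀ p ∈ X, H p ∈ R p.1
  injOn : InjOn (fun p => (f p.1, H p, p.2)) X

variable {f : V → W} {R R' : V → Set E} {X Y : Set (V × A)} {G H : V × A → E}

theorem IsLiftFamily.mono (h : IsLiftFamily f R X H) (hYX : Y ⊆ X) : IsLiftFamily f R Y H :=
  ⟨fun p hp => h.mem p (hYX hp), h.injOn.mono hYX⟩

theorem IsLiftFamily.mono_region (h : IsLiftFamily f R X H) (hR : ∀ p ∈ X, R p.1 ⊆ R' p.1) :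
    IsLiftFamily f R' X H :=
  ⟨fun p hp => hR p hp (h.mem p hp), h.injOn⟩

theorem IsLiftFamily.congr (h : IsLiftFamily f R X H) (hG : EqOn G H X) :
    IsLiftFamily f R X G :=
  ⟨fun p hp => hG hp ▸ h.mem p hp, h.injOn.congr fun p hp => by simp only [hG hp]⟩

variable {N N₁ : Set V}

theorem IsLiftFamily.of_injOn {g : V → E} (hg : ∀ x ∈ N, g x ∈ R x)
    (hinj : InjOn (fun x => (f x, g x)) N) (S : Set A) :
    IsLiftFamily f R (N ×ˢ S) (fun p => g p.1) where
  mem p hp := hg p.1 hp.1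
  injOn p hp q hq hpq := by
    simp only [Prod.mk.injEq] at hpq
    exact Prod.ext (hinj hp.1 hq.1 (Prod.ext hpq.1 hpq.2.1)) hpq.2.2

theorem IsLiftFamily.injOn_slice {S : Set A} (h : IsLiftFamily f R (N ×ˢ S) H) {a : A}
    (ha : a ∈ S) : InjOn (fun x => (f x, H (x, a))) N := by
  intro x hx y hy hxy
  obtain ⟨hf, hH⟩ := Prod.mk.inj hxy
  exact congrArg Prod.fst <| h.injOn (x₁ := (x, a)) (x₂ := (y, a)) ⟨hx, ha⟩ ⟨hy, ha⟩
    (Prod.ext hf (Prod.ext hH rfl))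

open Classical in
theorem piecewise_fst_eqOn {S : Set A} {H₁ : V × A → E}
    (h : EqOn H₁ G (N₁ ×ˢ S)) :
    EqOn ((Prod.fst ⁻¹' N₁).piecewise H₁ G) G (N ×ˢ S) := fun p hp => by
  by_cases hp₁ : p ∈ Prod.fst ⁻¹' N₁
  · rw [piecewise_eq_of_mem _ _ _ hp₁, h ⟨hp₁, hp.2⟩]
  · rw [piecewise_eq_of_notMem _ _ _ hp₁]

open Classical in
theorem piecewise_fst_eqOn_left (N₁ : Set V) (S : Set A) (H₁ G : V × A → E) :
    EqOn ((Prod.fst ⁻¹' N₁).piecewise H₁ G) H₁ (N₁ ×ˢ S) := fun _ hp =>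
  piecewise_eq_of_mem _ _ _ hp.1

variable [NormedAddCommGroup A]

/-- The points of `N × closedBall 0 1` at which the map to be extended is already defined. -/
def coneDom (A : Type*) [NormedAddCommGroup A] (N N₁ : Set V) : Set (V × A) :=
  N₁ ×ˢ Metric.closedBall 0 1 ∪ N ×ˢ Metric.sphere 0 1

theorem isLiftFamily_coneDom (hN : N₁ ⊆ N)
    (h₁ : IsLiftFamily f R (N₁ ×ˢ Metric.closedBall 0 1) H)
    (hS : IsLiftFamily f R (N ×ˢ Metric.sphere 0 1) H) :
    IsLiftFamily f R (coneDom A N N₁) H := by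
  refine ⟨fun p hp => hp.elim (h₁.mem p) (hS.mem p), fun p hp p' hp' heq => ?_⟩
  have hsnd : p.2 = p'.2 := congrArg (fun t => t.2.2) heq
  rcases hp with hp | hp
  · rcases hp' with hp' | hp'
    · exact h₁.injOn hp hp' heq
    · exact hS.injOn ⟨hN hp.1, hsnd ▸ hp'.2⟩ hp' heq
  · rcases hp' with hp' | hp'
    · exact hS.injOn hp ⟨hN hp'.1, hsnd ▸ hp.2⟩ heq
    · exact hS.injOn hp hp' heq

end LiftFamilies

section Cone

variable {V W E A : Type*} [AddCommGroup V] [Module ℝ V] [AddCommGroup W] [Module ℝ W]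
  [NormedAddCommGroup E] [NormedSpace ℝ E]

/-- `N` is obtained from `N₁` by attaching, for each `v ∈ F`, the cone with apex `v` over
`B v ⊆ N₁`. The map `f` is linear along the rays of these cones, and so is the parameter `s`, which
vanishes at the apexes, equals `1` on `N₁` and is constant on the fibres of `f`. -/
structure IsCone (f : V → W) (N N₁ F : Set V) (B : V → Set V) (s : V → ℝ) : Prop where
  finite : F.Finite
  eq_union : N = N₁ ∪ ⋃ v ∈ F, coneOver v (B v)
  isPolyhedral : IsPolyhedral N₁
  isPolyhedral_base : ∀ v ∈ F, IsPolyhedral (B v)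
  base_subset : ∀ v ∈ F, B v ⊆ N₁
  param_eq_one : ∀ x ∈ N₁, s x = 1
  param_apex : ∀ v ∈ F, s v = 0
  param_lineMap : ∀ v ∈ F, ∀ q ∈ B v, ∀ m ∈ Icc (0 : ℝ) 1, s (AffineMap.lineMap v q m) = m
  map_lineMap : ∀ v ∈ F, ∀ q ∈ B v, ∀ m ∈ Icc (0 : ℝ) 1,
    f (AffineMap.lineMap v q m) = AffineMap.lineMap (f v) (f q) m
  param_eq_of_map_eq : ∀ x ∈ N, ∀ x' ∈ N, f x = f x' → s x = s x'
  apex_unique : ∀ v ∈ F, ∀ v' ∈ F, ∀ x, x ∈ coneOver v (B v) → x ∈ coneOver v' (B v') →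
    s x < 1 → v = v'

/-- The regions `R x` prescribed for the values at `x` are compatible with the cones over `B v`:
they contain neighbourhoods of the values of `e`, regions over points of one cone are joined
linearly to `e v`, and the regions over points of different cones are disjoint. -/
structure IsConeRegion (e : V → E) (N F : Set V) (B : V → Set V) (R : V → Set E) : Prop where
  ray : ∀ v ∈ F, ∀ q ∈ coneOver v (B v), ∀ m ∈ Ioc (0 : ℝ) 1, ∀ z ∈ R q,
    AffineMap.lineMap (e v) z m ∈ R (AffineMap.lineMap v q m)
  ball : ∃ δ > 0, ∀ x ∈ N, Metric.ball (e x) δ ⊆ R x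
  sep : ∃ ρ, (∀ v ∈ F, ∀ x ∈ coneOver v (B v), R x ⊆ Metric.ball (e v) ρ) ∧
    ∀ v ∈ F, ∀ v' ∈ F, v ≠ v' → 2 * ρ ≤ dist (e v) (e v')

theorem IsCone.prod_eq_union {f : V → W} {N N₁ F : Set V} {B : V → Set V} {s : V → ℝ}
    (hC : IsCone f N N₁ F B s) (Y : Set A) :
    N ×ˢ Y = N₁ ×ˢ Y ∪ ⋃ v ∈ F, coneOver v (B v) ×ˢ Y := by
  simp only [hC.eq_union, union_prod, iUnion_prod_const]

/-- The part of `coneDom` lying over the cone with apex `v`; by `coneOver_prod_closedBall` its cone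
from `(v, 0)` is the product of that cone with the ball. -/
def coneBase (A : Type*) [NormedAddCommGroup A] (B : V → Set V) (v : V) : Set (V × A) :=
  B v ×ˢ Metric.closedBall 0 1 ∪ coneOver v (B v) ×ˢ Metric.sphere 0 1

variable [NormedAddCommGroup A]

/-- The parameter of `p` in the cones from the points `(v, 0)` over `coneBase`. -/
def coneParam (s : V → ℝ) (p : V × A) : ℝ :=
  max (s p.1) ‖p.2‖

theorem fst_mem_coneOver_of_mem_coneBase {B : V → Set V} {v : V} {q : V × A}
    (hq : q ∈ coneBase A B v) : q.1 ∈ coneOver v (B v) :=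
  hq.elim (fun h => subset_coneOver _ _ h.1) fun h => h.1

namespace IsCone

variable {f : V → W} {N N₁ F : Set V} {B : V → Set V} {s : V → ℝ} {e : V → E} {R : V → Set E}
  {H : V × A → E} {v x : V} {p q : V × A} {m : ℝ}

theorem subset_left (hC : IsCone f N N₁ F B s) : N₁ ⊆ N := by
  rw [hC.eq_union]
  exact subset_union_left

theorem coneOver_subset (hC : IsCone f N N₁ F B s) (hv : v ∈ F) : coneOver v (B v) ⊆ N := by
  rw [hC.eq_union]
  exact (subset_biUnion_of_mem (u := fun v => coneOver v (B v)) hv).trans subset_union_right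

theorem coneBase_subset (hC : IsCone f N N₁ F B s) (hv : v ∈ F) :
    coneBase A B v ⊆ coneDom A N N₁ :=
  union_subset_union (prod_mono_left (hC.base_subset v hv)) (prod_mono_left (hC.coneOver_subset hv))

theorem coneDom_subset (hC : IsCone f N N₁ F B s) :
    coneDom A N N₁ ⊆ N ×ˢ Metric.closedBall 0 1 :=
  union_subset (prod_mono_left hC.subset_left) (prod_mono_right Metric.sphere_subset_closedBall)

theorem param_lineMap_of_mem (hC : IsCone f N N₁ F B s) (hv : v ∈ F) (hx : x ∈ coneOver v (B v))
    (hm : m ∈ Icc (0 : ℝ) 1) : s (AffineMap.lineMap v x m) = m * s x := by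
  rcases mem_coneOver_iff.1 hx with rfl | ⟨q, hq, m', hm', rfl⟩
  · simp [hC.param_apex x hv]
  · rw [lineMap_lineMap_right, hC.param_lineMap v hv q hq _ (unitInterval.mul_mem hm hm'),
      hC.param_lineMap v hv q hq m' hm']

theorem map_lineMap_of_mem (hC : IsCone f N N₁ F B s) (hv : v ∈ F) (hx : x ∈ coneOver v (B v))
    (hm : m ∈ Icc (0 : ℝ) 1) : f (AffineMap.lineMap v x m) = AffineMap.lineMap (f v) (f x) m := by
  rcases mem_coneOver_iff.1 hx with rfl | ⟨q, hq, m', hm', rfl⟩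
  · simp
  · rw [lineMap_lineMap_right, hC.map_lineMap v hv q hq _ (unitInterval.mul_mem hm hm'),
      hC.map_lineMap v hv q hq m' hm', lineMap_lineMap_right]

theorem param_mem_Icc (hC : IsCone f N N₁ F B s) (hx : x ∈ N) : s x ∈ Icc (0 : ℝ) 1 := by
  rw [hC.eq_union] at hx
  rcases hx with hx | hx
  · simp [hC.param_eq_one x hx]
  · obtain ⟨v, hv, hx⟩ := mem_iUnion₂.1 hx
    rcases mem_coneOver_iff.1 hx with rfl | ⟨q, hq, m, hm, rfl⟩
    · simp [hC.param_apex x hv]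
    · rwa [hC.param_lineMap v hv q hq m hm]

theorem mem_of_param_eq_one (hC : IsCone f N N₁ F B s) (hx : x ∈ N) (hsx : s x = 1) : x ∈ N₁ := by
  rw [hC.eq_union] at hx
  rcases hx with hx | hx
  · exact hx
  obtain ⟨v, hv, hx⟩ := mem_iUnion₂.1 hx
  rcases mem_coneOver_iff.1 hx with rfl | ⟨q, hq, m, hm, rfl⟩
  · simp [hC.param_apex x hv] at hsx
  · obtain rfl : m = 1 := by rw [← hsx, hC.param_lineMap v hv q hq m hm]
    simpa using hC.base_subset v hv hq

theorem coneParam_mem_Icc (hC : IsCone f N N₁ F B s) (hp : p ∈ N ×ˢ Metric.closedBall (0 : A) 1) :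
    coneParam s p ∈ Icc (0 : ℝ) 1 :=
  ⟨(norm_nonneg _).trans (le_max_right _ _),
    max_le (hC.param_mem_Icc hp.1).2 (mem_closedBall_zero_iff.1 hp.2)⟩

theorem coneParam_eq_one_iff (hC : IsCone f N N₁ F B s)
    (hp : p ∈ N ×ˢ Metric.closedBall (0 : A) 1) : coneParam s p = 1 ↔ p ∈ coneDom A N N₁ := by
  constructor
  · intro h
    rcases max_choice (s p.1) ‖p.2‖ with hmax | hmax
    · exact Or.inl ⟨hC.mem_of_param_eq_one hp.1 (hmax.symm.trans h), hp.2⟩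
    · exact Or.inr ⟨hp.1, mem_sphere_zero_iff_norm.2 (hmax.symm.trans h)⟩
  · rintro (⟨hx, hb⟩ | ⟨hx, hb⟩)
    · rw [coneParam, hC.param_eq_one _ hx, max_eq_left (mem_closedBall_zero_iff.1 hb)]
    · rw [coneParam, mem_sphere_zero_iff_norm.1 hb, max_eq_right (hC.param_mem_Icc hx).2]

theorem inter_coneOver_eq (hC : IsCone f N N₁ F B s) (hv : v ∈ F) :
    N₁ ∩ coneOver v (B v) = B v := by
  refine Subset.antisymm ?_ (subset_inter (hC.base_subset v hv) (subset_coneOver _ _))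
  rintro x ⟨hx₁, hx⟩
  have hsx := hC.param_eq_one x hx₁
  rcases mem_coneOver_iff.1 hx with rfl | ⟨q, hq, m, hm, rfl⟩
  · simp [hC.param_apex x hv] at hsx
  · obtain rfl : m = 1 := by rw [← hsx, hC.param_lineMap v hv q hq m hm]
    simpa using hq

theorem coneDom_inter_eq (hC : IsCone f N N₁ F B s) (hv : v ∈ F) :
    coneDom A N N₁ ∩ coneOver v (B v) ×ˢ Metric.closedBall 0 1 = coneBase A B v := by
  rw [coneDom, coneBase, union_inter_distrib_right, prod_inter_prod, prod_inter_prod,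
    hC.inter_coneOver_eq hv, inter_self, inter_eq_right.2 (hC.coneOver_subset hv),
    inter_eq_left.2 Metric.sphere_subset_closedBall]

theorem coneParam_apex (hC : IsCone f N N₁ F B s) (hv : v ∈ F) :
    coneParam s (v, (0 : A)) = 0 := by
  simp [coneParam, hC.param_apex v hv]

variable [NormedSpace ℝ A]

theorem coneParam_lineMap (hC : IsCone f N N₁ F B s) (hv : v ∈ F) (hq : q ∈ coneBase A B v)
    (hm : m ∈ Icc (0 : ℝ) 1) : coneParam s (AffineMap.lineMap (v, 0) q m) = m := by
  have hqD := hC.coneBase_subset hv hq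
  have h1 : max (s q.1) ‖q.2‖ = 1 := (hC.coneParam_eq_one_iff (hC.coneDom_subset hqD)).2 hqD
  rw [coneParam, AffineMap.fst_lineMap, AffineMap.snd_lineMap,
    hC.param_lineMap_of_mem hv (fst_mem_coneOver_of_mem_coneBase hq) hm,
    AffineMap.lineMap_apply_module, smul_zero, zero_add, norm_smul, Real.norm_of_nonneg hm.1,
    ← mul_max_of_nonneg _ _ hm.1, h1, mul_one]

theorem lineMap_inv_coneParam_mem (hC : IsCone f N N₁ F B s) (hv : v ∈ F)
    (hp : p ∈ coneOver v (B v) ×ˢ Metric.closedBall (0 : A) 1) (hpos : 0 < coneParam s p) :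
    AffineMap.lineMap (v, 0) p (coneParam s p)⁻¹ ∈ coneBase A B v := by
  rw [coneOver_prod_closedBall] at hp
  rcases mem_coneOver_iff.1 hp with rfl | ⟨q, hq, m, hm, rfl⟩
  · exact absurd (hC.coneParam_apex hv) hpos.ne'
  · have hm0 : m ≠ 0 := by simpa only [hC.coneParam_lineMap hv hq hm] using hpos.ne'
    rwa [hC.coneParam_lineMap hv hq hm, lineMap_lineMap_right, inv_mul_cancel₀ hm0,
      AffineMap.lineMap_apply_one]

theorem exists_mem_coneOver_coneBase (hC : IsCone f N N₁ F B s)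
    (hp : p ∈ N ×ˢ Metric.closedBall (0 : A) 1) (hp1 : coneParam s p < 1) :
    ∃ v ∈ F, p ∈ coneOver (v, 0) (coneBase A B v) := by
  have hpD : p ∉ coneDom A N N₁ := fun h => hp1.ne ((hC.coneParam_eq_one_iff hp).2 h)
  rw [hC.prod_eq_union] at hp
  obtain ⟨v, hv, hpv⟩ := mem_iUnion₂.1 (hp.resolve_left fun h => hpD (Or.inl h))
  exact ⟨v, hv, (coneOver_prod_closedBall A v (B v)).subset hpv⟩

theorem exists_apexMap (hC : IsCone f N N₁ F B s) :
    ∃ c : V → V, ∀ v ∈ F, ∀ x ∈ coneOver v (B v), s x < 1 → c x = v := by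
  classical
  refine ⟨fun x => if h : ∃ v ∈ F, x ∈ coneOver v (B v) then h.choose else x,
    fun v hv x hx hs => ?_⟩
  have h : ∃ v ∈ F, x ∈ coneOver v (B v) := ⟨v, hv, hx⟩
  simp only [dif_pos h]
  exact hC.apex_unique _ h.choose_spec.1 v hv x h.choose_spec.2 hx hs

/-- The apex of the cone containing a point of `N` outside `N₁`. -/
noncomputable def apex (hC : IsCone f N N₁ F B s) : V → V :=
  hC.exists_apexMap.choose

theorem apex_eq (hC : IsCone f N N₁ F B s) (hv : v ∈ F) (hx : x ∈ coneOver v (B v))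
    (hsx : s x < 1) : hC.apex x = v :=
  hC.exists_apexMap.choose_spec v hv x hx hsx

/-- The conical extension to `N × closedBall 0 1` of a map `H` on `coneDom`, with value `e v` at the
apex `(v, 0)`. -/
noncomputable def extend (hC : IsCone f N N₁ F B s) (e : V → E) (H : V × A → E) (p : V × A) : E :=
  AffineMap.lineMap (e (hC.apex p.1))
    (H (AffineMap.lineMap (hC.apex p.1, 0) p (coneParam s p)⁻¹)) (coneParam s p)

theorem extend_eqOn (hC : IsCone f N N₁ F B s) (e : V → E) (H : V × A → E) :
    EqOn (hC.extend e H) H (coneDom A N N₁) := fun p hp => by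
  simp [extend, (hC.coneParam_eq_one_iff (hC.coneDom_subset hp)).2 hp]

theorem extend_eq_of_mem (hC : IsCone f N N₁ F B s) (hv : v ∈ F)
    (hp : p ∈ coneOver v (B v) ×ˢ Metric.closedBall (0 : A) 1) :
    hC.extend e H p = AffineMap.lineMap (e v)
      (H (AffineMap.lineMap (v, 0) p (coneParam s p)⁻¹)) (coneParam s p) := by
  have hpN : p ∈ N ×ˢ Metric.closedBall (0 : A) 1 := ⟨hC.coneOver_subset hv hp.1, hp.2⟩
  rcases (hC.coneParam_mem_Icc hpN).2.lt_or_eq with h | h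
  · rw [extend, hC.apex_eq hv hp.1 ((le_max_left _ _).trans_lt h)]
  · simp [extend, h]

theorem extend_apex (hC : IsCone f N N₁ F B s) (hv : v ∈ F) :
    hC.extend e H (v, (0 : A)) = e v := by
  rw [hC.extend_eq_of_mem hv ⟨apex_mem_coneOver _ _, by simp⟩, hC.coneParam_apex hv,
    AffineMap.lineMap_apply_zero]

theorem extend_lineMap (hC : IsCone f N N₁ F B s) (hv : v ∈ F) (hq : q ∈ coneBase A B v)
    (hm : m ∈ Icc (0 : ℝ) 1) :
    hC.extend e H (AffineMap.lineMap (v, 0) q m) = AffineMap.lineMap (e v) (H q) m := by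
  have hmem := lineMap_mem_coneOver (v := ((v, 0) : V × A)) hq hm
  rw [hC.extend_eq_of_mem hv ((coneOver_prod_closedBall A v (B v)).superset hmem),
    hC.coneParam_lineMap hv hq hm]
  rcases eq_or_ne m 0 with rfl | hm0
  · simp
  · rw [lineMap_lineMap_right, inv_mul_cancel₀ hm0, AffineMap.lineMap_apply_one]

theorem extend_zero_eq (hC : IsCone f N N₁ F B s) {H' : V × A → E}
    (hHH' : ∀ x ∈ N₁, H (x, 0) = H' (x, 0)) {x : V} (hx : x ∈ N) :
    hC.extend e H (x, 0) = hC.extend e H' (x, 0) := by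
  have hmem : (x, (0 : A)) ∈ N ×ˢ Metric.closedBall (0 : A) 1 := ⟨hx, by simp⟩
  have heq : ∀ q ∈ coneDom A N N₁, q.2 = 0 → H q = H' q := by
    rintro ⟨y, b⟩ (hq | hq) rfl
    · exact hHH' y hq.1
    · simp at hq
  rcases (hC.coneParam_mem_Icc hmem).2.lt_or_eq with h | h
  · obtain ⟨v, hv, hpv⟩ := hC.exists_mem_coneOver_coneBase hmem h
    rcases mem_coneOver_iff.1 hpv with hxv | ⟨q, hq, m, hm, hxq⟩
    · rw [hxv, hC.extend_apex hv, hC.extend_apex hv]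
    · rw [hxq, hC.extend_lineMap hv hq hm, hC.extend_lineMap hv hq hm]
      have hmq : m = 0 ∨ q.2 = 0 := by
        simpa [AffineMap.lineMap_apply_module, eq_comm] using congrArg Prod.snd hxq
      rcases hmq with rfl | hq0
      · simp
      · rw [heq q (hC.coneBase_subset hv hq) hq0]
  · have hD := (hC.coneParam_eq_one_iff hmem).1 h
    rw [hC.extend_eqOn e H hD, hC.extend_eqOn e H' hD, heq _ hD rfl]

theorem extend_mem (hC : IsCone f N N₁ F B s) (hR : IsConeRegion e N F B R)
    (hH : ∀ p ∈ coneDom A N N₁, H p ∈ R p.1) (hp : p ∈ N ×ˢ Metric.closedBall (0 : A) 1) :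
    hC.extend e H p ∈ R p.1 := by
  rcases (hC.coneParam_mem_Icc hp).2.lt_or_eq with h | h
  · obtain ⟨v, hv, hpv⟩ := hC.exists_mem_coneOver_coneBase hp h
    have hapex : e v ∈ R v := by
      obtain ⟨δ, hδ, hball⟩ := hR.ball
      exact hball v (hC.coneOver_subset hv (apex_mem_coneOver _ _)) (Metric.mem_ball_self hδ)
    rcases mem_coneOver_iff.1 hpv with rfl | ⟨q, hq, m, hm, rfl⟩
    · rwa [hC.extend_apex hv]
    rw [hC.extend_lineMap hv hq hm]
    rcases hm.1.eq_or_lt with rfl | hm0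
    · simpa using hapex
    · rw [AffineMap.fst_lineMap]
      exact hR.ray v hv q.1 (fst_mem_coneOver_of_mem_coneBase hq) m ⟨hm0, hm.2⟩ _
        (hH q (hC.coneBase_subset hv hq))
  · have hpD := (hC.coneParam_eq_one_iff hp).1 h
    rw [hC.extend_eqOn e H hpD]
    exact hH p hpD

theorem eq_of_extend_eq (hC : IsCone f N N₁ F B s) {p' : V × A}
    (hH : InjOn (fun p => (f p.1, H p, p.2)) (coneDom A N N₁)) (hv : v ∈ F)
    (hp : p ∈ coneOver (v, 0) (coneBase A B v)) (hp' : p' ∈ coneOver (v, 0) (coneBase A B v))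
    (hparam : coneParam s p = coneParam s p') (hf : f p.1 = f p'.1)
    (hext : hC.extend e H p = hC.extend e H p') (hsnd : p.2 = p'.2) : p = p' := by
  have hzero : ∀ p ∈ coneOver (v, 0) (coneBase A B v), coneParam s p = 0 → p = (v, 0) := by
    intro p hp hp0
    rcases mem_coneOver_iff.1 hp with rfl | ⟨q, hq, m, hm, rfl⟩
    · rfl
    · obtain rfl : m = 0 := by rw [← hp0, hC.coneParam_lineMap hv hq hm]
      exact AffineMap.lineMap_apply_zero _ _
  rcases eq_or_ne (coneParam s p) 0 with h0 | hne
  · rw [hzero p hp h0, hzero p' hp' (hparam ▸ h0)]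
  rcases mem_coneOver_iff.1 hp with rfl | ⟨q, hq, m, hm, rfl⟩
  · exact absurd (hC.coneParam_apex hv) hne
  rcases mem_coneOver_iff.1 hp' with rfl | ⟨q', hq', m', hm', rfl⟩
  · exact absurd (hC.coneParam_apex hv) (hparam ▸ hne)
  obtain rfl : m = m' := by
    rwa [hC.coneParam_lineMap hv hq hm, hC.coneParam_lineMap hv hq' hm'] at hparam
  rw [hC.coneParam_lineMap hv hq hm] at hne
  simp only [AffineMap.fst_lineMap, AffineMap.snd_lineMap,
    hC.map_lineMap_of_mem hv (fst_mem_coneOver_of_mem_coneBase hq) hm,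
    hC.map_lineMap_of_mem hv (fst_mem_coneOver_of_mem_coneBase hq') hm,
    hC.extend_lineMap hv hq hm, hC.extend_lineMap hv hq' hm] at hf hext hsnd
  have hqq' := hH (hC.coneBase_subset hv hq) (hC.coneBase_subset hv hq')
    (Prod.ext (lineMap_right_injective _ hne hf)
      (Prod.ext (lineMap_right_injective _ hne hext) (lineMap_right_injective _ hne hsnd)))
  rw [hqq']

theorem isLiftFamily_extend (hC : IsCone f N N₁ F B s) (hR : IsConeRegion e N F B R)
    (hH : IsLiftFamily f R (coneDom A N N₁) H) :
    IsLiftFamily f R (N ×ˢ Metric.closedBall 0 1) (hC.extend e H) := by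
  refine ⟨fun p hp => hC.extend_mem hR hH.mem hp, fun p hp p' hp' heq => ?_⟩
  obtain ⟨hf, hext, hsnd⟩ : f p.1 = f p'.1 ∧ hC.extend e H p = hC.extend e H p' ∧ p.2 = p'.2 := by
    simpa only [Prod.mk.injEq] using heq
  have hparam : coneParam s p = coneParam s p' := by
    rw [coneParam, coneParam, hC.param_eq_of_map_eq _ hp.1 _ hp'.1 hf, hsnd]
  rcases (hC.coneParam_mem_Icc hp).2.lt_or_eq with h | h
  · obtain ⟨v, hv, hpv⟩ := hC.exists_mem_coneOver_coneBase hp h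
    obtain ⟨v', hv', hpv'⟩ := hC.exists_mem_coneOver_coneBase hp' (hparam ▸ h)
    obtain rfl : v = v' := by
      by_contra hne
      obtain ⟨ρ, hball, hdist⟩ := hR.sep
      have hpρ := hball v hv _ ((coneOver_prod_closedBall A v (B v)).superset hpv).1
        (hC.extend_mem hR hH.mem hp)
      have hpρ' := hball v' hv' _ ((coneOver_prod_closedBall A v' (B v')).superset hpv').1
        (hC.extend_mem hR hH.mem hp')
      rw [← hext] at hpρ'
      rw [Metric.mem_ball] at hpρ hpρ'
      linarith [hdist v hv v' hv' hne, dist_triangle_left (e v) (e v') (hC.extend e H p)]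
    exact hC.eq_of_extend_eq hH.injOn hv hpv hpv' hparam hf hext hsnd
  · have hpD := (hC.coneParam_eq_one_iff hp).1 h
    have hpD' := (hC.coneParam_eq_one_iff hp').1 (hparam ▸ h)
    rw [hC.extend_eqOn e H hpD, hC.extend_eqOn e H hpD'] at hext
    exact hH.injOn hpD hpD' (Prod.ext hf (Prod.ext hext hsnd))

end IsCone

end Cone

section ConeRegularity

variable {V W E A : Type*} [NormedAddCommGroup V] [NormedSpace ℝ V]
  [AddCommGroup W] [Module ℝ W] [NormedAddCommGroup E] [NormedSpace ℝ E]
  [NormedAddCommGroup A] [NormedSpace ℝ A]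
  {f : V → W} {N N₁ F : Set V} {B : V → Set V} {s : V → ℝ} {e : V → E} {R : V → Set E} {v : V}

theorem IsCone.isClosed_coneOver (hC : IsCone f N N₁ F B s) (hv : v ∈ F) :
    IsClosed (coneOver v (B v)) :=
  ((hC.isPolyhedral_base v hv).coneOver v).isCompact.isClosed

theorem IsCone.isClosed (hC : IsCone f N N₁ F B s) : IsClosed N := by
  rw [hC.eq_union]
  exact hC.isPolyhedral.isCompact.isClosed.union
    (hC.finite.isClosed_biUnion fun v hv => hC.isClosed_coneOver hv)

/-- Where `m` vanishes, `g` need only be bounded. -/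
theorem continuousOn_lineMap_of_dist_le {X : Type*} [TopologicalSpace X] {T : Set X} {m : X → ℝ}
    {g : X → E} {a : E} {ρ : ℝ} (hm : ContinuousOn m T) (hm0 : ∀ p ∈ T, 0 ≤ m p)
    (hg : ContinuousOn g (T ∩ {p | 0 < m p})) (hgρ : ∀ p ∈ T, 0 < m p → dist a (g p) ≤ ρ) :
    ContinuousOn (fun p => AffineMap.lineMap a (g p) (m p)) T := by
  intro p hp
  rcases (hm0 p hp).eq_or_lt with h0 | h0
  · have hbound : ∀ q ∈ T, dist (AffineMap.lineMap a (g q) (m q)) a ≤ m q * ρ := by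
      intro q hq
      rw [dist_lineMap_left, Real.norm_of_nonneg (hm0 q hq)]
      rcases (hm0 q hq).eq_or_lt with hq0 | hq0
      · simp [← hq0]
      · exact mul_le_mul_of_nonneg_left (hgρ q hq hq0) hq0.le
    have hlim : Filter.Tendsto (fun q => m q * ρ) (𝓝[T] p) (𝓝 0) := by
      have hmul : Filter.Tendsto (fun q => m q * ρ) (𝓝[T] p) (𝓝 (m p * ρ)) :=
        Filter.Tendsto.mul_const ρ (hm p hp)
      rwa [← h0, zero_mul] at hmul
    rw [ContinuousWithinAt, ← h0, AffineMap.lineMap_apply_zero, tendsto_iff_dist_tendsto_zero]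
    exact squeeze_zero' (Filter.Eventually.of_forall fun q => dist_nonneg)
      (Filter.eventually_of_mem self_mem_nhdsWithin hbound) hlim
  · have hpos : {q | 0 < m q} ∈ 𝓝[T] p := hm p hp (Ioi_mem_nhds h0)
    rw [← continuousWithinAt_inter' hpos]
    exact continuousWithinAt_const.lineMap (hg p ⟨hp, h0⟩) ((hm p hp).mono inter_subset_left)

variable [FiniteDimensional ℝ V]

theorem IsCone.hasPLCover_extend [FiniteDimensional ℝ A] {H : V × A → E}
    (hC : IsCone f N N₁ F B s) (hA : IsPolyhedral (Metric.closedBall (0 : A) 1))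
    (hH : HasPLCover H (coneDom A N N₁)) :
    HasPLCover (hC.extend e H) (N ×ˢ Metric.closedBall 0 1) := by
  have hDom : HasPLCover (hC.extend e H) (coneDom A N N₁) := hH.congr (hC.extend_eqOn e H)
  rw [hC.prod_eq_union]
  refine HasPLCover.union (hDom.mono (hC.isPolyhedral.prod hA) subset_union_left)
    (HasPLCover.biUnion hC.finite fun v hv => ?_)
  have hbase := hDom.inter (((hC.isPolyhedral_base v hv).coneOver v).prod hA)
  rw [hC.coneDom_inter_eq hv] at hbase
  rw [coneOver_prod_closedBall]
  refine hbase.coneOver fun q hq m hm => ?_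
  rw [hC.extend_lineMap hv hq hm, hC.extend_apex hv,
    hC.extend_eqOn e H (hC.coneBase_subset hv hq)]

theorem IsCone.continuousOn_param (hC : IsCone f N N₁ F B s) (hv : v ∈ F) :
    ContinuousOn s (coneOver v (B v)) := by
  have hone : ∀ q ∈ B v, s q = 1 := fun q hq => hC.param_eq_one q (hC.base_subset v hv hq)
  have hbase : HasPLCover s (B v) :=
    ((hC.isPolyhedral_base v hv).hasPLCover_affineMap (AffineMap.const ℝ V 1)).congr hone
  refine (hbase.coneOver fun q hq m hm => ?_).continuousOn
  rw [hC.param_lineMap v hv q hq m hm, hC.param_apex v hv, hone q hq]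
  simp [AffineMap.lineMap_apply]

theorem IsCone.continuousOn_extend_coneOver {Z : Type*} [TopologicalSpace Z] {H : Z → V × A → E}
    (hC : IsCone f N N₁ F B s) (hv : v ∈ F) (hR : IsConeRegion e N F B R)
    (hHR : ∀ z, ∀ p ∈ coneDom A N N₁, H z p ∈ R p.1)
    (hH : ContinuousOn (fun p : Z × V × A => H p.1 p.2) (univ ×ˢ coneDom A N N₁)) :
    ContinuousOn (fun p : Z × V × A => hC.extend e (H p.1) p.2)
      (univ ×ˢ coneOver v (B v) ×ˢ Metric.closedBall 0 1) := by
  set T : Set (Z × V × A) := univ ×ˢ coneOver v (B v) ×ˢ Metric.closedBall 0 1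
  have hparam : ContinuousOn (fun p : Z × V × A => coneParam s p.2) T :=
    ((hC.continuousOn_param hv).comp (by fun_prop : ContinuousOn (fun p : Z × V × A => p.2.1) T)
      fun p hp => hp.2.1).sup (by fun_prop)
  have hbase : ∀ p ∈ T, 0 < coneParam s p.2 →
      AffineMap.lineMap (v, 0) p.2 (coneParam s p.2)⁻¹ ∈ coneBase A B v := fun p hp hpos =>
    hC.lineMap_inv_coneParam_mem hv hp.2 hpos
  obtain ⟨ρ, hρ, -⟩ := hR.sep
  refine (continuousOn_lineMap_of_dist_le (a := e v) (ρ := ρ) hparam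
    (fun _ _ => (norm_nonneg _).trans (le_max_right _ _)) ?_ fun p hp hpos => ?_).congr
    fun p hp => hC.extend_eq_of_mem hv hp.2
  · have hray : ContinuousOn (fun p : Z × V × A =>
        (p.1, AffineMap.lineMap ((v, 0) : V × A) p.2 (coneParam s p.2)⁻¹))
        (T ∩ {p | 0 < coneParam s p.2}) :=
      continuousOn_fst.prodMk (continuousOn_const.lineMap continuousOn_snd
        ((hparam.mono inter_subset_left).inv₀ fun p hp => ne_of_gt hp.2))
    exact hH.comp hray fun p hp =>
      ⟨mem_univ _, hC.coneBase_subset hv (hbase p hp.1 hp.2)⟩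
  · have hq := hbase p hp hpos
    have hmem := hρ v hv _ (fst_mem_coneOver_of_mem_coneBase hq)
      (hHR p.1 _ (hC.coneBase_subset hv hq))
    rw [dist_comm]
    exact (Metric.mem_ball.1 hmem).le

theorem IsCone.continuousOn_extend {Z : Type*} [TopologicalSpace Z] {H : Z → V × A → E}
    (hC : IsCone f N N₁ F B s) (hR : IsConeRegion e N F B R)
    (hHR : ∀ z, ∀ p ∈ coneDom A N N₁, H z p ∈ R p.1)
    (hH : ContinuousOn (fun p : Z × V × A => H p.1 p.2) (univ ×ˢ coneDom A N N₁)) :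
    ContinuousOn (fun p : Z × V × A => hC.extend e (H p.1) p.2)
      (univ ×ˢ N ×ˢ Metric.closedBall 0 1) := by
  have hclosed : ∀ v ∈ F, IsClosed ((univ : Set Z) ×ˢ coneOver v (B v) ×ˢ
      Metric.closedBall (0 : A) 1) := fun v hv =>
    isClosed_univ.prod ((hC.isClosed_coneOver hv).prod Metric.isClosed_closedBall)
  rw [hC.prod_eq_union, prod_union, prod_iUnion₂]
  refine ContinuousOn.union_of_isClosed ?_ ?_
    (isClosed_univ.prod (hC.isPolyhedral.isCompact.isClosed.prod Metric.isClosed_closedBall))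
    (hC.finite.isClosed_biUnion hclosed)
  · exact (hH.mono (prod_mono_right subset_union_left)).congr fun p hp =>
      hC.extend_eqOn e (H p.1) (Or.inl hp.2)
  have := hC.finite.to_subtype
  rw [biUnion_eq_iUnion]
  refine (locallyFinite_of_finite _).continuousOn_iUnion (fun v => hclosed v v.2) fun v => ?_
  exact hC.continuousOn_extend_coneOver v.2 hR hHR hH

end ConeRegularity

section Contraction

universe u

variable {V W E : Type*} [NormedAddCommGroup V] [NormedAddCommGroup E]
  {f : V → W} {e : V → E} {N N₁ F : Set V} {B : V → Set V} {s : V → ℝ} {R R' : V → Set E}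

/-- Families of lifts of `f` over `N` close to `e` contract through lifts with values in the
regions `R x`: there is a path parametrized by `[-1, 1]` from each lift to itself, which passes
over `0` through a lift that does not depend on the member of the family. -/
def ContractsTop (f : V → W) (e : V → E) (N : Set V) (R : V → Set E) : Prop :=
  ∃ δ > 0, ∀ (Z : Type u) [TopologicalSpace Z] (G : Z → V → E),
    ContinuousOn (fun p : Z × V => G p.1 p.2) (univ ×ˢ N) →
    (∀ z, IsLiftFamily f (fun x => Metric.ball (e x) δ) (N ×ˢ Metric.sphere (0 : ℝ) 1)
      (fun p => G z p.1)) →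
    ∃ H : Z → V × ℝ → E,
      ContinuousOn (fun p : Z × V × ℝ => H p.1 p.2) (univ ×ˢ N ×ˢ Metric.closedBall 0 1) ∧
      (∀ z, IsLiftFamily f R (N ×ˢ Metric.closedBall 0 1) (H z)) ∧
      (∀ z, EqOn (H z) (fun p => G z p.1) (N ×ˢ Metric.sphere 0 1)) ∧
      ∀ z z', ∀ x ∈ N, H z (x, 0) = H z' (x, 0)

theorem ContractsTop.mono (h : ContractsTop.{u} f e N R) (hR : ∀ x ∈ N, R x ⊆ R' x) :
    ContractsTop.{u} f e N R' := by
  obtain ⟨δ, hδ, h⟩ := h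
  refine ⟨δ, hδ, fun Z _ G hG hlift => ?_⟩
  obtain ⟨H, hH, hHR, hHG⟩ := h Z G hG hlift
  exact ⟨H, hH, fun z => (hHR z).mono_region fun p hp => hR p.1 hp.1, hHG⟩

theorem contractsTop_empty : ContractsTop.{u} f e ∅ R :=
  ⟨1, one_pos, fun Z _ G _ _ => ⟨fun z p => G z p.1, by simp, fun z => ⟨by simp, by simp⟩,
    by simp, by simp⟩⟩

variable [NormedSpace ℝ V] [NormedSpace ℝ E]

/-- PL families of lifts of `f` over `N` close to `e`, parametrized by the PL sphere of any
dimension, extend to PL families parametrized by the ball with values in the regions `R x`. -/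
def ContractsPL (f : V → W) (e : V → E) (N : Set V) (R : V → Set E) : Prop :=
  ∃ δ > 0, ∀ (n : ℕ) (G : V × (Fin n → ℝ) → E), HasPLCover G (N ×ˢ plSphere n) →
    IsLiftFamily f (fun x => Metric.ball (e x) δ) (N ×ˢ plSphere n) G →
    ∃ H : V × (Fin n → ℝ) → E, HasPLCover H (N ×ˢ plBall n) ∧
      IsLiftFamily f R (N ×ˢ plBall n) H ∧ EqOn H G (N ×ˢ plSphere n)

theorem ContractsPL.mono (h : ContractsPL f e N R) (hR : ∀ x ∈ N, R x ⊆ R' x) :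
    ContractsPL f e N R' := by
  obtain ⟨δ, hδ, h⟩ := h
  refine ⟨δ, hδ, fun n G hG hlift => ?_⟩
  obtain ⟨H, hH, hHR, hHG⟩ := h n G hG hlift
  exact ⟨H, hH, hHR.mono_region fun p hp => hR p.1 hp.1, hHG⟩

theorem contractsPL_empty : ContractsPL f e ∅ R :=
  ⟨1, one_pos, fun n G hG _ => ⟨G, by simpa using hG, ⟨by simp, by simp⟩, by simp⟩⟩

variable [AddCommGroup W] [Module ℝ W]

theorem ContractsTop.cone [FiniteDimensional ℝ V] (hC : IsCone f N N₁ F B s)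
    (hR : IsConeRegion e N F B R) (h : ContractsTop.{u} f e N₁ R) : ContractsTop.{u} f e N R := by
  classical
  obtain ⟨δ₁, hδ₁, h⟩ := h
  obtain ⟨δ₀, hδ₀, hball⟩ := hR.ball
  refine ⟨min δ₁ δ₀, lt_min hδ₁ hδ₀, fun Z _ G hG hlift => ?_⟩
  obtain ⟨H₁, hH₁, hlift₁, hH₁G, hzero⟩ := h Z G (hG.mono (prod_mono_right hC.subset_left))
    fun z => ((hlift z).mono (prod_mono_left hC.subset_left)).mono_region fun _ _ =>
      Metric.ball_subset_ball (min_le_left _ _)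
  let H (z : Z) : V × ℝ → E := (Prod.fst ⁻¹' N₁).piecewise (H₁ z) fun p => G z p.1
  have hHH₁ (z : Z) : EqOn (H z) (H₁ z) (N₁ ×ˢ Metric.closedBall 0 1) :=
    piecewise_fst_eqOn_left _ _ _ _
  have hHG (z : Z) : EqOn (H z) (fun p => G z p.1) (N ×ˢ Metric.sphere 0 1) :=
    piecewise_fst_eqOn (hH₁G z)
  have hHlift (z : Z) : IsLiftFamily f R (coneDom ℝ N N₁) (H z) :=
    isLiftFamily_coneDom hC.subset_left ((hlift₁ z).congr (hHH₁ z)) <|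
      ((hlift z).mono_region fun p hp =>
        (Metric.ball_subset_ball (min_le_right _ _)).trans (hball p.1 hp.1)).congr (hHG z)
  have hHcont : ContinuousOn (fun p : Z × V × ℝ => H p.1 p.2) (univ ×ˢ coneDom ℝ N N₁) := by
    rw [coneDom, prod_union]
    refine ContinuousOn.union_of_isClosed (hH₁.congr fun p hp => hHH₁ p.1 hp.2)
      (ContinuousOn.congr ?_ fun p hp => hHG p.1 hp.2)
      (isClosed_univ.prod (hC.isPolyhedral.isCompact.isClosed.prod Metric.isClosed_closedBall))
      (isClosed_univ.prod (hC.isClosed.prod Metric.isClosed_sphere))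
    exact hG.comp (f := fun p : Z × V × ℝ => (p.1, p.2.1)) (by fun_prop)
      fun p hp => ⟨mem_univ _, hp.2.1⟩
  refine ⟨fun z => hC.extend e (H z), hC.continuousOn_extend hR (fun z => (hHlift z).mem) hHcont,
    fun z => hC.isLiftFamily_extend hR (hHlift z), fun z p hp => ?_, fun z z' x hx => ?_⟩
  · exact (hC.extend_eqOn e (H z) (Or.inr hp)).trans (hHG z hp)
  · refine hC.extend_zero_eq (fun y hy => ?_) hx
    have hy0 : (y, (0 : ℝ)) ∈ N₁ ×ˢ Metric.closedBall 0 1 := ⟨hy, by simp⟩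
    rw [hHH₁ z hy0, hHH₁ z' hy0, hzero z z' y hy]

theorem ContractsPL.cone [FiniteDimensional ℝ V] (hC : IsCone f N N₁ F B s)
    (hR : IsConeRegion e N F B R) (h : ContractsPL f e N₁ R) : ContractsPL f e N R := by
  classical
  obtain ⟨δ₁, hδ₁, h⟩ := h
  obtain ⟨δ₀, hδ₀, hball⟩ := hR.ball
  refine ⟨min δ₁ δ₀, lt_min hδ₁ hδ₀, fun n G hG hlift => ?_⟩
  have hG₁ : HasPLCover G (N₁ ×ˢ plSphere n) := by
    have hinter := hG.inter (hC.isPolyhedral.prod (isPolyhedral_plBall n))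
    have hsphere : plSphere n ⊆ plBall n := Metric.sphere_subset_closedBall
    rwa [prod_inter_prod, inter_eq_right.2 hC.subset_left, inter_eq_left.2 hsphere] at hinter
  obtain ⟨H₁, hH₁, hlift₁, hH₁G⟩ := h n G hG₁ <|
    (hlift.mono (prod_mono_left hC.subset_left)).mono_region fun _ _ =>
      Metric.ball_subset_ball (min_le_left _ _)
  let H : V × (Fin n → ℝ) → E := (Prod.fst ⁻¹' N₁).piecewise H₁ G
  have hHH₁ : EqOn H H₁ (N₁ ×ˢ plBall n) := piecewise_fst_eqOn_left _ _ _ _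
  have hHG : EqOn H G (N ×ˢ plSphere n) := piecewise_fst_eqOn hH₁G
  have hHlift : IsLiftFamily f R (coneDom (Fin n → ℝ) N N₁) H :=
    isLiftFamily_coneDom hC.subset_left (hlift₁.congr hHH₁) <|
      (hlift.mono_region fun p hp =>
        (Metric.ball_subset_ball (min_le_right _ _)).trans (hball p.1 hp.1)).congr hHG
  exact ⟨hC.extend e H,
    hC.hasPLCover_extend (isPolyhedral_plBall n) ((hH₁.congr hHH₁).union (hG.congr hHG)),
    hC.isLiftFamily_extend hR hHlift,
    fun p hp => (hC.extend_eqOn e H (Or.inr hp)).trans (hHG hp)⟩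

end Contraction

/-! ### Preimages of stars -/

section VertexCoord

variable {W : Type*} [AddCommGroup W] [Module ℝ W] {L : SimplicialComplex ℝ W} {τ σ : Finset W}
  {w y z : W}

open Classical in
/-- The barycentric coordinate of `y` at the vertex `w` of the simplicial complex `L`; it is `0` if
`y` does not lie in `L`, or `w` is not a vertex of the carrier of `y`. -/
noncomputable def vertexCoord (L : SimplicialComplex ℝ W) (w y : W) : ℝ :=
  if h : ∃ ω : W →₀ ℝ, ∃ τ ∈ L.faces, IsBarycentric τ ω y then h.choose w else 0

theorem vertexCoord_eq (hτ : τ ∈ L.faces) {ω : W →₀ ℝ} (hω : IsBarycentric τ ω y) (w : W) :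
    vertexCoord L w y = ω w := by
  have hex : ∃ ω : W →₀ ℝ, ∃ τ ∈ L.faces, IsBarycentric τ ω y := ⟨ω, τ, hτ, hω⟩
  obtain ⟨τ', hτ', hω'⟩ := hex.choose_spec
  rw [vertexCoord, dif_pos hex, isBarycentric_unique_of_mem_faces hτ' hτ hω' hω]

theorem vertexCoord_nonneg (hτ : τ ∈ L.faces) (hy : y ∈ convexHull ℝ (τ : Set W)) (w : W) :
    0 ≤ vertexCoord L w y := by
  obtain ⟨ω, hω⟩ := exists_isBarycentric hy
  rw [vertexCoord_eq hτ hω]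
  exact hω.nonneg w

theorem vertexCoord_eq_zero (hτ : τ ∈ L.faces) (hy : y ∈ convexHull ℝ (τ : Set W)) (hw : w ∉ τ) :
    vertexCoord L w y = 0 := by
  obtain ⟨ω, hω⟩ := exists_isBarycentric hy
  rw [vertexCoord_eq hτ hω, hω.eq_zero_of_notMem hw]

theorem vertexCoord_self (hτ : τ ∈ L.faces) (hw : w ∈ τ) : vertexCoord L w w = 1 := by
  rw [vertexCoord_eq hτ (IsBarycentric.single hw), Finsupp.single_eq_same]

theorem convexAffineOn_vertexCoord (hτ : τ ∈ L.faces) (w : W) :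
    ConvexAffineOn (vertexCoord L w) (convexHull ℝ (τ : Set W)) := by
  intro x hx y hy a b ha hb hab
  obtain ⟨ω, hω⟩ := exists_isBarycentric hx
  obtain ⟨ω', hω'⟩ := exists_isBarycentric hy
  rw [vertexCoord_eq hτ (hω.convexComb hω' ha hb hab), vertexCoord_eq hτ hω, vertexCoord_eq hτ hω']
  rfl

theorem vertexCoord_lineMap_self (hτ : τ ∈ L.faces) (hw : w ∈ τ)
    (hz : z ∈ convexHull ℝ (τ : Set W)) {m : ℝ} (hm : m ∈ Icc (0 : ℝ) 1) :
    vertexCoord L w (AffineMap.lineMap w z m) = 1 - m + m * vertexCoord L w z := by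
  rw [AffineMap.lineMap_apply_module, convexAffineOn_vertexCoord hτ w w (subset_convexHull ℝ _ hw)
    z hz _ _ (sub_nonneg.2 hm.2) hm.1 (by ring), vertexCoord_self hτ hw, smul_eq_mul, smul_eq_mul,
    mul_one]

theorem IsCarrier.mem_convexHull_of_lineMap {m : ℝ} (hσ : IsCarrier L (AffineMap.lineMap y z m) σ)
    (hτ : τ ∈ L.faces) (hy : y ∈ convexHull ℝ (τ : Set W)) (hz : z ∈ convexHull ℝ (τ : Set W))
    (hm : m ∈ Ioc (0 : ℝ) 1) : z ∈ convexHull ℝ (σ : Set W) := by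
  obtain ⟨hσL, ω, hω, rfl⟩ := hσ
  obtain ⟨υ, hυ⟩ := exists_isBarycentric hy
  obtain ⟨ζ, hζ⟩ := exists_isBarycentric hz
  rw [AffineMap.lineMap_apply_module] at hω
  have hω_eq : ω = (1 - m) • υ + m • ζ := isBarycentric_unique_of_mem_faces hσL hτ hω
    (hυ.convexComb hζ (sub_nonneg.2 hm.2) hm.1.le (by ring))
  refine (hζ.restrict fun v hv => Finsupp.mem_support_iff.2 (ne_of_gt ?_)).mem_convexHull
  rw [hω_eq]
  exact add_pos_of_nonneg_of_pos (mul_nonneg (sub_nonneg.2 hm.2) (hυ.nonneg v))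
    (mul_pos hm.1 (hζ.pos_of_mem_support hv))

end VertexCoord

section Subcomplexes

variable {W : Type*} [AddCommGroup W] [Module ℝ W] {L : SimplicialComplex ℝ W}
  {T : Set (Finset W)} {y : W}

/-- The union of the simplices spanned by the members of `T`. -/
def spaceOf (T : Set (Finset W)) : Set W := ⋃ τ ∈ T, convexHull ℝ (τ : Set W)

theorem mem_spaceOf : y ∈ spaceOf T ↔ ∃ τ ∈ T, y ∈ convexHull ℝ (τ : Set W) := by
  simp only [spaceOf, mem_iUnion, exists_prop]

/-- `T` is the set of faces of a subcomplex of `L`. -/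
structure IsSubcomplex (L : SimplicialComplex ℝ W) (T : Set (Finset W)) : Prop where
  subset_faces : T ⊆ L.faces
  down_closed : ∀ τ ∈ T, ∀ σ ⊆ τ, σ.Nonempty → σ ∈ T

namespace IsSubcomplex

theorem exists_isCarrier (hT : IsSubcomplex L T) (hy : y ∈ spaceOf T) :
    ∃ τ ∈ T, IsCarrier L y τ := by
  obtain ⟨τ, hτ, hyτ⟩ := mem_spaceOf.1 hy
  obtain ⟨σ, hσ⟩ := exists_isCarrier_of_mem_convexHull (hT.subset_faces hτ) hyτ
  exact ⟨σ, hT.down_closed τ hτ σ (hσ.subset (hT.subset_faces hτ) hyτ)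
    (L.nonempty_of_mem_faces hσ.mem_faces), hσ⟩

theorem remove (hT : IsSubcomplex L T) (A : Set W) :
    IsSubcomplex L {τ ∈ T | ∀ w ∈ A, w ∉ τ} where
  subset_faces _ h := hT.subset_faces h.1
  down_closed τ hτ σ hσ hne :=
    ⟨hT.down_closed τ hτ.1 σ hσ hne, fun w hw hwσ => hτ.2 w hw (hσ hwσ)⟩

theorem remove_vertex (hT : IsSubcomplex L T) (w : W) : IsSubcomplex L {τ ∈ T | w ∉ τ} := by
  simpa only [mem_singleton_iff, forall_eq] using hT.remove {w}

end IsSubcomplex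

end Subcomplexes

section Preimage

variable {V W : Type*} [AddCommGroup V] [Module ℝ V] [AddCommGroup W] [Module ℝ W] {f : V → W}

theorem ConvexAffineOn.image_convexHull {C : Set V} (hC : Convex ℝ C) (hf : ConvexAffineOn f C)
    {S : Set V} (hS : S ⊆ C) : f '' convexHull ℝ S = convexHull ℝ (f '' S) := by
  have hSC : convexHull ℝ S ⊆ C := convexHull_min hS hC
  apply Subset.antisymm
  · rw [image_subset_iff]
    refine fun x hx => (convexHull_min (t := {x ∈ C | f x ∈ convexHull ℝ (f '' S)})
      (fun v hv => ⟨hS hv, subset_convexHull ℝ _ (mem_image_of_mem f hv)⟩) ?_ hx).2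
    intro x hx y hy a b ha hb hab
    refine ⟨hC hx.1 hy.1 ha hb hab, ?_⟩
    rw [hf x hx.1 y hy.1 a b ha hb hab]
    exact convex_convexHull ℝ _ hx.2 hy.2 ha hb hab
  · refine convexHull_min (image_mono (subset_convexHull ℝ S)) ?_
    rintro _ ⟨x, hx, rfl⟩ _ ⟨y, hy, rfl⟩ a b ha hb hab
    exact ⟨a • x + b • y, convex_convexHull ℝ S hx hy ha hb hab,
      hf x (hSC hx) y (hSC hy) a b ha hb hab⟩

theorem ConvexAffineOn.isPolyhedral_inter_preimage {C : Set V} (hC : Convex ℝ C)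
    (hf : ConvexAffineOn f C) (hinj : InjOn f C) {T : Finset W} (hT : (T : Set W) ⊆ f '' C) :
    IsPolyhedral (C ∩ f ⁻¹' convexHull ℝ (T : Set W)) := by
  classical
  obtain ⟨S, hSC, rfl⟩ := Finset.subset_set_image_iff.1 hT
  rw [Finset.coe_image, ← hf.image_convexHull hC hSC, inter_comm,
    hinj.preimage_image_inter (convexHull_min hSC hC)]
  exact isPolyhedral_convexHull S

/-- The part of the simplex spanned by `s` which `f` maps into the simplex spanned by `τ`. -/
def cell (f : V → W) (s : Finset V) (τ : Finset W) : Set V :=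
  convexHull ℝ (s : Set V) ∩ f ⁻¹' convexHull ℝ (τ : Set W)

theorem cell_mono_right {s : Finset V} {σ τ : Finset W} (h : σ ⊆ τ) : cell f s σ ⊆ cell f s τ :=
  inter_subset_inter_right _ (preimage_mono (convexHull_mono (Finset.coe_subset.2 h)))

end Preimage

/-- A finite simplicial complex `K` on whose simplices `f` is affine and injective, and a finite
simplicial complex `L` compatible with the images of the simplices of `K` and of their
intersections. -/
structure IsSheeted {V W : Type*} [AddCommGroup V] [Module ℝ V] [AddCommGroup W] [Module ℝ W]
    (f : V → W) (K : SimplicialComplex ℝ V) (L : SimplicialComplex ℝ W) : Prop where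
  finite_domain : K.faces.Finite
  finite_range : L.faces.Finite
  convexAffineOn : ∀ s ∈ K.faces, ConvexAffineOn f (convexHull ℝ (s : Set V))
  injOn : ∀ s ∈ K.faces, InjOn f (convexHull ℝ (s : Set V))
  isCompatible : ∀ s ∈ K.faces, ∀ t ∈ K.faces,
    IsCompatible L (f '' (convexHull ℝ (s : Set V) ∩ convexHull ℝ (t : Set V)))

section ConeStructure

variable {V W : Type*} [AddCommGroup V] [Module ℝ V] [AddCommGroup W] [Module ℝ W]
  {f : V → W} {K : SimplicialComplex ℝ V} {L : SimplicialComplex ℝ W} {T : Set (Finset W)}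
  {s t : Finset V} {σ τ : Finset W} {v x : V} {w : W}

theorem IsSheeted.subset_image (h : IsSheeted f K L) (hs : s ∈ K.faces)
    (hx : x ∈ convexHull ℝ (s : Set V)) (hτ : IsCarrier L (f x) τ) :
    convexHull ℝ (τ : Set W) ⊆ f '' convexHull ℝ (s : Set V) := by
  have := h.isCompatible s hs s hs (f x) (mem_image_of_mem f ⟨hx, hx⟩) τ hτ
  rwa [inter_self] at this

theorem IsSheeted.isPolyhedral_cell (h : IsSheeted f K L) (hs : s ∈ K.faces)
    (hτ : convexHull ℝ (τ : Set W) ⊆ f '' convexHull ℝ (s : Set V)) : IsPolyhedral (cell f s τ) :=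
  (h.convexAffineOn s hs).isPolyhedral_inter_preimage (convex_convexHull ℝ _) (h.injOn s hs)
    ((subset_convexHull ℝ _).trans hτ)

theorem IsSheeted.isPolyhedral_preimage (h : IsSheeted f K L) (hT : IsSubcomplex L T) :
    IsPolyhedral (K.space ∩ f ⁻¹' spaceOf T) := by
  have heq : K.space ∩ f ⁻¹' spaceOf T = ⋃ s ∈ K.faces,
      ⋃ τ ∈ {τ ∈ T | convexHull ℝ (τ : Set W) ⊆ f '' convexHull ℝ (s : Set V)}, cell f s τ := by
    ext x
    simp only [mem_iUnion, exists_prop]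
    constructor
    · rintro ⟨hx, hfx⟩
      obtain ⟨s, hs, hxs⟩ := mem_space_iff.1 hx
      obtain ⟨τ, hτ, hcarrier⟩ := hT.exists_isCarrier hfx
      exact ⟨s, hs, τ, ⟨hτ, h.subset_image hs hxs hcarrier⟩, hxs, hcarrier.mem_convexHull⟩
    · rintro ⟨s, hs, τ, hτ, hxs, hxτ⟩
      exact ⟨mem_space_iff.2 ⟨s, hs, hxs⟩, mem_spaceOf.2 ⟨τ, hτ.1, hxτ⟩⟩
  rw [heq]
  exact IsPolyhedral.biUnion h.finite_domain fun s hs => IsPolyhedral.biUnion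
    (h.finite_range.subset fun τ hτ => hT.subset_faces hτ.1) fun τ hτ => h.isPolyhedral_cell hs hτ.2

/-- The cell over `τ` in the simplex spanned by `s` is a cone with apex `v` over the part opposite
to the vertex `w = f v` of `τ`. -/
structure IsConeCell (f : V → W) (K : SimplicialComplex ℝ V) (T : Set (Finset W)) (w : W) (v : V)
    (s : Finset V) (τ : Finset W) : Prop where
  mem_faces : s ∈ K.faces
  apex_mem : v ∈ convexHull ℝ (s : Set V)
  map_apex : f v = w
  mem : τ ∈ T
  vertex_mem : w ∈ τ
  subset_image : convexHull ℝ (τ : Set W) ⊆ f '' convexHull ℝ (s : Set V)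

/-- The base of the cone with apex `v` in the preimage of a subcomplex with vertex `w = f v`. -/
def coneBaseOver (f : V → W) (K : SimplicialComplex ℝ V) (T : Set (Finset W)) (w : W) (v : V) :
    Set V :=
  {q | ∃ s τ, IsConeCell f K T w v s τ ∧ ∃ σ ⊆ τ, w ∉ σ ∧ q ∈ cell f s σ}

namespace IsConeCell

theorem apex_mem_cell (hcell : IsConeCell f K T w v s τ) : v ∈ cell f s τ :=
  ⟨hcell.apex_mem, by
    rw [mem_preimage, hcell.map_apex]; exact subset_convexHull ℝ _ hcell.vertex_mem⟩

theorem map_lineMap (h : IsSheeted f K L) (hcell : IsConeCell f K T w v s τ)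
    (hx : x ∈ convexHull ℝ (s : Set V)) {m : ℝ} (hm : m ∈ Icc (0 : ℝ) 1) :
    f (AffineMap.lineMap v x m) = AffineMap.lineMap w (f x) m := by
  rw [AffineMap.lineMap_apply_module, AffineMap.lineMap_apply_module,
    h.convexAffineOn s hcell.mem_faces v hcell.apex_mem x hx _ _ (sub_nonneg.2 hm.2) hm.1 (by ring),
    hcell.map_apex]

theorem lineMap_mem_cell (h : IsSheeted f K L) (hcell : IsConeCell f K T w v s τ)
    (hx : x ∈ cell f s τ) {m : ℝ} (hm : m ∈ Icc (0 : ℝ) 1) :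
    AffineMap.lineMap v x m ∈ cell f s τ := by
  refine ⟨(convex_convexHull ℝ _).lineMap_mem hcell.apex_mem hx.1 hm, ?_⟩
  rw [mem_preimage, hcell.map_lineMap h hx.1 hm]
  exact (convex_convexHull ℝ _).lineMap_mem (subset_convexHull ℝ _ hcell.vertex_mem) hx.2 hm

theorem exists_eq_lineMap (h : IsSheeted f K L) (hcell : IsConeCell f K T w v s τ)
    (hx : x ∈ convexHull ℝ (s : Set V)) {z : W} (hz : z ∈ convexHull ℝ (τ : Set W)) {m : ℝ}
    (hm : m ∈ Icc (0 : ℝ) 1) (hfx : f x = AffineMap.lineMap w z m) :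
    ∃ q ∈ convexHull ℝ (s : Set V), f q = z ∧ x = AffineMap.lineMap v q m := by
  obtain ⟨q, hq, rfl⟩ := hcell.subset_image hz
  refine ⟨q, hq, rfl, h.injOn s hcell.mem_faces hx
    ((convex_convexHull ℝ _).lineMap_mem hcell.apex_mem hq hm) ?_⟩
  rw [hfx, hcell.map_lineMap h hq hm]

theorem cell_subset_coneOver (h : IsSheeted f K L) (hcell : IsConeCell f K T w v s τ) :
    cell f s τ ⊆ coneOver v (coneBaseOver f K T w v) := by
  classical
  rintro x ⟨hx, hfx⟩
  rw [mem_preimage, ← Finset.insert_erase hcell.vertex_mem, Finset.coe_insert,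
    convexHull_insert_eq_coneOver, mem_coneOver_iff] at hfx
  rcases hfx with hfx | ⟨z, hz, m, hm, hfx⟩
  · rw [h.injOn s hcell.mem_faces hx hcell.apex_mem (hfx.trans hcell.map_apex.symm)]
    exact apex_mem_coneOver _ _
  · have hzτ := convexHull_mono (Finset.coe_subset.2 (Finset.erase_subset w τ)) hz
    obtain ⟨q, hq, rfl, rfl⟩ := hcell.exists_eq_lineMap h hx hzτ hm hfx
    have hbase : q ∈ coneBaseOver f K T w v :=
      ⟨s, τ, hcell, τ.erase w, Finset.erase_subset w τ, Finset.notMem_erase w τ, hq, hz⟩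
    exact lineMap_mem_coneOver hbase hm

/-- Compatibility with the intersections of simplices of `K` carries the apex into every simplex
that meets the open star of the apex. -/
theorem exists_of_vertexCoord_pos (h : IsSheeted f K L) (hT : IsSubcomplex L T)
    (hcell : IsConeCell f K T w v s τ) (hx : x ∈ cell f s τ) (hpos : 0 < vertexCoord L w (f x))
    (ht : t ∈ K.faces) (hxt : x ∈ convexHull ℝ (t : Set V)) :
    ∃ σ, IsCarrier L (f x) σ ∧ IsConeCell f K T w v t σ := by
  obtain ⟨σ, hσ, hcarrier⟩ := hT.exists_isCarrier (mem_spaceOf.2 ⟨τ, hcell.mem, hx.2⟩)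
  have hwσ : w ∈ σ := by
    by_contra hw
    exact hpos.ne' (vertexCoord_eq_zero hcarrier.mem_faces hcarrier.mem_convexHull hw)
  obtain ⟨u, ⟨hus, hut⟩, huw⟩ := h.isCompatible s hcell.mem_faces t ht (f x)
    (mem_image_of_mem f ⟨hx.1, hxt⟩) σ hcarrier (subset_convexHull ℝ _ hwσ)
  obtain rfl := h.injOn s hcell.mem_faces hus hcell.apex_mem (huw.trans hcell.map_apex.symm)
  exact ⟨σ, hcarrier, ht, hut, huw, hσ, hwσ, h.subset_image ht hxt hcarrier⟩

end IsConeCell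

/-- The apexes of the cones into which the preimage of the star of the vertex `w` splits. -/
def apexes (f : V → W) (K : SimplicialComplex ℝ V) (T : Set (Finset W)) (w : W) : Set V :=
  {v ∈ K.space | f v = w ∧ {w} ∈ T}

theorem exists_isConeCell_of_mem_apexes (hv : v ∈ apexes f K T w) :
    ∃ s, IsConeCell f K T w v s {w} := by
  obtain ⟨hvK, hvw, hw⟩ := hv
  obtain ⟨s, hs, hvs⟩ := mem_space_iff.1 hvK
  refine ⟨s, hs, hvs, hvw, hw, Finset.mem_singleton_self w, ?_⟩
  simpa using ⟨v, hvs, hvw⟩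

theorem IsConeCell.mem_apexes (hT : IsSubcomplex L T) (hcell : IsConeCell f K T w v s τ) :
    v ∈ apexes f K T w :=
  ⟨mem_space_iff.2 ⟨s, hcell.mem_faces, hcell.apex_mem⟩, hcell.map_apex, hT.down_closed τ hcell.mem
    _ (Finset.singleton_subset_iff.2 hcell.vertex_mem) (Finset.singleton_nonempty w)⟩

theorem IsSheeted.exists_isConeCell (h : IsSheeted f K L) (hv : v ∈ apexes f K T w)
    (hx : x ∈ coneOver v (coneBaseOver f K T w v)) :
    ∃ s τ, IsConeCell f K T w v s τ ∧ x ∈ cell f s τ := by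
  rcases mem_coneOver_iff.1 hx with rfl | ⟨q, ⟨s, τ, hcell, σ, hστ, -, hq⟩, m, hm, rfl⟩
  · obtain ⟨s, hcell⟩ := exists_isConeCell_of_mem_apexes hv
    exact ⟨s, {w}, hcell, hcell.apex_mem_cell⟩
  · exact ⟨s, τ, hcell, hcell.lineMap_mem_cell h (cell_mono_right hστ hq) hm⟩

theorem IsSheeted.finite_apexes (h : IsSheeted f K L) : (apexes f K T w).Finite := by
  refine (h.finite_domain.biUnion (t := fun s => {v ∈ convexHull ℝ (s : Set V) | f v = w})
    fun s hs => Set.Subsingleton.finite ?_).subset ?_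
  · rintro x ⟨hx, hfx⟩ y ⟨hy, hfy⟩
    exact h.injOn s hs hx hy (hfx.trans hfy.symm)
  · rintro v ⟨hv, hvw, -⟩
    obtain ⟨s, hs, hvs⟩ := mem_space_iff.1 hv
    exact mem_biUnion hs ⟨hvs, hvw⟩

theorem IsSheeted.preimage_eq_union (h : IsSheeted f K L) (hT : IsSubcomplex L T) :
    K.space ∩ f ⁻¹' spaceOf T = K.space ∩ f ⁻¹' spaceOf {τ ∈ T | w ∉ τ} ∪
      ⋃ v ∈ apexes f K T w, coneOver v (coneBaseOver f K T w v) := by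
  apply Subset.antisymm
  · rintro x ⟨hx, hfx⟩
    obtain ⟨s, hs, hxs⟩ := mem_space_iff.1 hx
    obtain ⟨τ, hτ, hcarrier⟩ := hT.exists_isCarrier hfx
    by_cases hw : w ∈ τ
    · have hsub := h.subset_image hs hxs hcarrier
      obtain ⟨v, hvs, hvw⟩ := hsub (subset_convexHull ℝ _ hw)
      have hcell : IsConeCell f K T w v s τ := ⟨hs, hvs, hvw, hτ, hw, hsub⟩
      exact Or.inr (mem_biUnion (hcell.mem_apexes hT)
        (hcell.cell_subset_coneOver h ⟨hxs, hcarrier.mem_convexHull⟩))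
    · exact Or.inl ⟨hx, mem_spaceOf.2 ⟨τ, ⟨hτ, hw⟩, hcarrier.mem_convexHull⟩⟩
  · refine union_subset (inter_subset_inter_right _ (preimage_mono ?_)) (iUnion₂_subset ?_)
    · exact biUnion_subset_biUnion_left fun τ hτ => hτ.1
    · intro v hv x hx
      obtain ⟨s, τ, hcell, hxs, hxτ⟩ := h.exists_isConeCell hv hx
      exact ⟨mem_space_iff.2 ⟨s, hcell.mem_faces, hxs⟩, mem_spaceOf.2 ⟨τ, hcell.mem, hxτ⟩⟩

theorem IsSheeted.isPolyhedral_coneBaseOver (h : IsSheeted f K L) (hT : IsSubcomplex L T) :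
    IsPolyhedral (coneBaseOver f K T w v) := by
  have heq : coneBaseOver f K T w v =
      ⋃ p ∈ {p : Finset V × Finset W | IsConeCell f K T w v p.1 p.2},
        ⋃ σ ∈ {σ | σ ⊆ p.2 ∧ w ∉ σ}, cell f p.1 σ := by
    ext q
    simp only [coneBaseOver, mem_iUnion, mem_ofPred_eq, exists_prop, Prod.exists, and_assoc]
  rw [heq]
  refine IsPolyhedral.biUnion ?_ fun p hp => IsPolyhedral.biUnion ?_ fun σ hσ =>
    h.isPolyhedral_cell hp.mem_faces ?_
  · exact (h.finite_domain.prod h.finite_range).subset fun p hp =>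
      ⟨hp.mem_faces, hT.subset_faces hp.mem⟩
  · exact p.2.powerset.finite_toSet.subset fun σ hσ => Finset.mem_powerset.2 hσ.1
  · exact (convexHull_mono (Finset.coe_subset.2 hσ.1)).trans hp.subset_image

theorem coneBaseOver_subset (hT : IsSubcomplex L T) :
    coneBaseOver f K T w v ⊆ K.space ∩ f ⁻¹' spaceOf {τ ∈ T | w ∉ τ} := by
  rintro q ⟨s, τ, hcell, σ, hστ, hwσ, hqs, hqσ⟩
  have hσ : σ.Nonempty := Finset.coe_nonempty.1 (convexHull_nonempty_iff.1 ⟨f q, hqσ⟩)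
  exact ⟨mem_space_iff.2 ⟨s, hcell.mem_faces, hqs⟩,
    mem_spaceOf.2 ⟨σ, ⟨hT.down_closed τ hcell.mem σ hστ hσ, hwσ⟩, hqσ⟩⟩

theorem IsSheeted.isCone (h : IsSheeted f K L) (hT : IsSubcomplex L T) (w : W) :
    IsCone f (K.space ∩ f ⁻¹' spaceOf T) (K.space ∩ f ⁻¹' spaceOf {τ ∈ T | w ∉ τ})
      (apexes f K T w) (coneBaseOver f K T w) (fun x => 1 - vertexCoord L w (f x)) where
  finite := h.finite_apexes
  eq_union := h.preimage_eq_union hT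
  isPolyhedral := h.isPolyhedral_preimage (hT.remove_vertex w)
  isPolyhedral_base v _ := h.isPolyhedral_coneBaseOver hT
  base_subset v _ := coneBaseOver_subset hT
  param_eq_one x hx := by
    obtain ⟨τ, hτ, hfx⟩ := mem_spaceOf.1 hx.2
    rw [vertexCoord_eq_zero (hT.subset_faces hτ.1) hfx hτ.2, sub_zero]
  param_apex v hv := by
    rw [hv.2.1, vertexCoord_self (hT.subset_faces hv.2.2) (Finset.mem_singleton_self w), sub_self]
  param_lineMap := by
    rintro v - q ⟨s, τ, hcell, σ, hστ, hwσ, hqs, hqσ⟩ m hm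
    have hτ := hT.subset_faces hcell.mem
    have hσ := L.down_closed hτ hστ (Finset.coe_nonempty.1 (convexHull_nonempty_iff.1 ⟨f q, hqσ⟩))
    rw [hcell.map_lineMap h hqs hm, vertexCoord_lineMap_self hτ hcell.vertex_mem
      (convexHull_mono (Finset.coe_subset.2 hστ) hqσ) hm, vertexCoord_eq_zero hσ hqσ hwσ]
    ring
  map_lineMap := by
    rintro v hv q ⟨s, τ, hcell, σ, -, -, hqs, -⟩ m hm
    rw [hcell.map_lineMap h hqs hm, hv.2.1]
  param_eq_of_map_eq x _ x' _ hfx := by rw [hfx]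
  apex_unique := by
    intro v hv v' hv' x hx hx' hlt
    obtain ⟨s, τ, hcell, hxcell⟩ := h.exists_isConeCell hv hx
    obtain ⟨s', τ', hcell', hxcell'⟩ := h.exists_isConeCell hv' hx'
    obtain ⟨σ, -, hcell''⟩ := hcell.exists_of_vertexCoord_pos h hT hxcell (by linarith)
      hcell'.mem_faces hxcell'.1
    exact h.injOn s' hcell'.mem_faces hcell''.apex_mem hcell'.apex_mem (hv.2.1.trans hv'.2.1.symm)

end ConeStructure

section Regions

variable {V W E : Type*} [AddCommGroup V] [Module ℝ V] [AddCommGroup W] [Module ℝ W]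
  [NormedAddCommGroup E] [NormedSpace ℝ E] {f : V → W} {K : SimplicialComplex ℝ V}
  {L : SimplicialComplex ℝ W} {T : Set (Finset W)} {e : V → E} {r ρ : ℝ}

/-- The values admissible at `x`: those `ρ`-close to the hulls of the `e`-images of all the cells
containing `x`. -/
def region (f : V → W) (K : SimplicialComplex ℝ V) (L : SimplicialComplex ℝ W) (e : V → E) (ρ : ℝ)
    (x : V) : Set E :=
  {z | ∀ s ∈ K.faces, ∀ τ ∈ L.faces, x ∈ cell f s τ →
    z ∈ Metric.thickening ρ (convexHull ℝ (e '' cell f s τ))}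

theorem ball_subset_region (e : V → E) (ρ : ℝ) (x : V) :
    Metric.ball (e x) ρ ⊆ region f K L e ρ x := fun _ hz _ _ _ _ hx =>
  Metric.mem_thickening_iff.2 ⟨e x, subset_convexHull ℝ _ (mem_image_of_mem e hx), hz⟩

theorem region_subset_ball {s : Finset V} (hs : s ∈ K.faces) {τ : Finset W} (hτ : τ ∈ L.faces)
    {x y : V} (hx : x ∈ cell f s τ) (hosc : ∀ x ∈ cell f s τ, dist (e x) (e y) < r) :
    region f K L e ρ x ⊆ Metric.ball (e y) (r + ρ) := by
  intro z hz
  obtain ⟨a, ha, hza⟩ := Metric.mem_thickening_iff.1 (hz s hs τ hτ hx)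
  have himage : e '' cell f s τ ⊆ Metric.ball (e y) r := image_subset_iff.2 hosc
  have har : a ∈ Metric.ball (e y) r := convexHull_min himage (convex_ball _ _) ha
  rw [Metric.mem_ball] at har ⊢
  linarith [dist_triangle z a (e y)]

theorem IsConeCell.lineMap_mem_region (h : IsSheeted f K L) (hT : IsSubcomplex L T) (hρ : 0 < ρ)
    {v q : V} {w : W} {s : Finset V} {τ : Finset W} (hcell : IsConeCell f K T w v s τ)
    (hq : q ∈ cell f s τ) {m : ℝ} (hm : m ∈ Ioo (0 : ℝ) 1) {z : E} (hz : z ∈ region f K L e ρ q) :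
    AffineMap.lineMap (e v) z m ∈ region f K L e ρ (AffineMap.lineMap v q m) := by
  have hmI := Ioo_subset_Icc_self hm
  have hτ := hT.subset_faces hcell.mem
  have hfx := hcell.map_lineMap h hq.1 hmI
  have hpos : 0 < vertexCoord L w (f (AffineMap.lineMap v q m)) := by
    rw [hfx, vertexCoord_lineMap_self hτ hcell.vertex_mem hq.2 hmI]
    have := vertexCoord_nonneg hτ hq.2 w
    nlinarith [hm.1, hm.2]
  intro t ht τ' hτ' hx
  obtain ⟨σ, hσ, hcell'⟩ :=
    hcell.exists_of_vertexCoord_pos h hT (hcell.lineMap_mem_cell h hq hmI) hpos ht hx.1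
  have hστ' : σ ⊆ τ' := hσ.subset hτ' hx.2
  have hfq : f q ∈ convexHull ℝ (σ : Set W) := by
    rw [hfx] at hσ
    exact hσ.mem_convexHull_of_lineMap hτ (subset_convexHull ℝ _ hcell.vertex_mem) hq.2
      (Ioo_subset_Ioc_self hm)
  have hqt : q ∈ convexHull ℝ (t : Set V) := by
    obtain ⟨q', hq't, -, hqq'⟩ := hcell'.exists_eq_lineMap h hx.1 hfq hmI hfx
    exact lineMap_right_injective v hm.1.ne' hqq' ▸ hq't
  refine ((convex_convexHull ℝ _).thickening ρ).lineMap_mem ?_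
    (hz t ht τ' hτ' (cell_mono_right hστ' ⟨hqt, hfq⟩)) hmI
  exact Metric.self_subset_thickening hρ _ (subset_convexHull ℝ _
    (mem_image_of_mem e (cell_mono_right hστ' hcell'.apex_mem_cell)))

theorem IsSheeted.isConeRegion (h : IsSheeted f K L) (hT : IsSubcomplex L T) (w : W) (hρ : 0 < ρ)
    (hosc : ∀ s ∈ K.faces, ∀ τ ∈ L.faces, ∀ x ∈ cell f s τ, ∀ y ∈ cell f s τ, dist (e x) (e y) < r)
    (hgap : ∀ v ∈ apexes f K T w, ∀ v' ∈ apexes f K T w, v ≠ v' →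
      2 * (r + ρ) ≤ dist (e v) (e v')) :
    IsConeRegion e (K.space ∩ f ⁻¹' spaceOf T) (apexes f K T w) (coneBaseOver f K T w)
      (region f K L e ρ) where
  ray v hv q hq m hm z hz := by
    obtain ⟨s, τ, hcell, hqcell⟩ := h.exists_isConeCell hv hq
    rcases hm.2.eq_or_lt with rfl | hm1
    · simpa using hz
    · exact hcell.lineMap_mem_region h hT hρ hqcell ⟨hm.1, hm1⟩ hz
  ball := ⟨ρ, hρ, fun x _ => ball_subset_region e ρ x⟩
  sep := by
    refine ⟨r + ρ, fun v hv x hx => ?_, hgap⟩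
    obtain ⟨s, τ, hcell, hxcell⟩ := h.exists_isConeCell hv hx
    have hτ := hT.subset_faces hcell.mem
    exact region_subset_ball hcell.mem_faces hτ hxcell fun y hy =>
      hosc s hcell.mem_faces τ hτ y hy v hcell.apex_mem_cell

end Regions

/-! ### Induction on skeleta -/

section Strata

theorem isCompact_setOf_map_eq {X Y : Type*} [TopologicalSpace X] [T2Space X] [TopologicalSpace Y]
    [T2Space Y] {f : X → Y} {A B : Set X} {C : Set Y} (hA : IsCompact A) (hB : IsCompact B)
    (hfA : ContinuousOn f A) (hfB : ContinuousOn f B) (hC : IsClosed C) :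
    IsCompact {p ∈ A ×ˢ B | f p.1 = f p.2 ∧ f p.1 ∈ C} := by
  have hcont : ContinuousOn (Prod.map f f) (A ×ˢ B) := hfA.prodMap hfB
  have hclosed : IsClosed (diagonal Y ∩ Prod.fst ⁻¹' C) :=
    isClosed_diagonal.inter (hC.preimage continuous_fst)
  exact (hA.prod hB).of_isClosed_subset
    (hcont.preimage_isClosed_of_isClosed (hA.prod hB).isClosed hclosed) inter_subset_left

theorem continuousOn_dist_prod {X Y : Type*} [TopologicalSpace X] [PseudoMetricSpace Y]
    {g : X → Y} {A : Set X} (hg : ContinuousOn g A) :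
    ContinuousOn (fun p : X × X => dist (g p.1) (g p.2)) (A ×ˢ A) :=
  continuous_dist.comp_continuousOn (hg.prodMap hg)

section Skeleton

variable {W : Type*} [AddCommGroup W] [Module ℝ W] {L : SimplicialComplex ℝ W} {T : Set (Finset W)}
  {X Y : Set W}

/-- The union of the simplices of `L` with at most `i` vertices, that is, the `(i - 1)`-skeleton in
the usual indexing by dimension. -/
def skeleton (L : SimplicialComplex ℝ W) (i : ℕ) : Set W :=
  spaceOf {τ ∈ L.faces | τ.card ≤ i}

theorem eq_empty_of_disjoint_skeleton {d : ℕ} (hd : ∀ τ ∈ L.faces, τ.card ≤ d) (hY : Y ⊆ L.space)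
    (hdisj : Disjoint Y (skeleton L d)) : Y = ∅ := by
  refine eq_empty_of_forall_notMem fun y hy => ?_
  obtain ⟨τ, hτ, hyτ⟩ := mem_space_iff.1 (hY hy)
  exact hdisj.notMem_of_mem_left hy (mem_spaceOf.2 ⟨τ, ⟨hτ, hd τ hτ⟩, hyτ⟩)

theorem skeleton_zero : skeleton L 0 = ∅ := by
  refine eq_empty_of_forall_notMem fun y hy => ?_
  obtain ⟨τ, ⟨hτ, hcard⟩, -⟩ := mem_spaceOf.1 hy
  exact (Finset.card_pos.2 (L.nonempty_of_mem_faces hτ)).ne' (Nat.le_zero.1 hcard)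

theorem IsSubcomplex.disjoint_spaceOf_remove (hT : IsSubcomplex L T) (hX : IsCompatible L X) :
    Disjoint (spaceOf {τ ∈ T | ∀ w ∈ L.vertices ∩ X, w ∉ τ}) X := by
  rw [Set.disjoint_left]
  intro y hy hyX
  obtain ⟨σ, hσ, hcarrier⟩ := (hT.remove _).exists_isCarrier hy
  obtain ⟨u, hu⟩ := L.nonempty_of_mem_faces hcarrier.mem_faces
  have huL : u ∈ L.vertices := L.down_closed hcarrier.mem_faces (Finset.singleton_subset_iff.2 hu)
    (Finset.singleton_nonempty u)
  exact hσ.2 u ⟨huL, hX y hyX σ hcarrier (subset_convexHull ℝ _ hu)⟩ hu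

theorem finite_vertices (hL : L.faces.Finite) : L.vertices.Finite := by
  refine (hL.biUnion fun τ _ => τ.finite_toSet).subset fun w hw => ?_
  exact mem_biUnion (t := fun τ : Finset W => (τ : Set W)) hw (Finset.mem_singleton_self w)

theorem isSubcomplex_setOf_convexHull_subset (L : SimplicialComplex ℝ W) (Y : Set W) :
    IsSubcomplex L {τ ∈ L.faces | convexHull ℝ (τ : Set W) ⊆ Y} where
  subset_faces _ hτ := hτ.1
  down_closed _ hτ _ hσ hne :=
    ⟨L.down_closed hτ.1 hσ hne, (convexHull_mono (Finset.coe_subset.2 hσ)).trans hτ.2⟩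

theorem IsCompatible.spaceOf_eq (hY : IsCompatible L Y) (hYL : Y ⊆ L.space) :
    spaceOf {τ ∈ L.faces | convexHull ℝ (τ : Set W) ⊆ Y} = Y := by
  refine (iUnion₂_subset fun τ hτ => hτ.2).antisymm fun y hy => ?_
  obtain ⟨τ, hτ⟩ := exists_isCarrier_of_mem_space (hYL hy)
  exact mem_spaceOf.2 ⟨τ, ⟨hτ.mem_faces, hY y hy τ hτ⟩, hτ.mem_convexHull⟩

end Skeleton

variable {V W E : Type*} [NormedAddCommGroup V] [NormedSpace ℝ V] [NormedAddCommGroup E]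
  {f : V → W} {K : SimplicialComplex ℝ V} {e : V → E}

theorem exists_forall_dist_lt_of_dist_map_lt [NormedAddCommGroup W] {r : ℝ} (hK : K.faces.Finite)
    (hinj : ∀ s ∈ K.faces, InjOn f (convexHull ℝ (s : Set V))) (hf : ContinuousOn f K.space)
    (he : ContinuousOn e K.space) (hr : 0 < r) :
    ∃ η > 0, ∀ s ∈ K.faces, ∀ x ∈ convexHull ℝ (s : Set V), ∀ y ∈ convexHull ℝ (s : Set V),
      dist (f x) (f y) < η → dist (e x) (e y) < r := by
  let D : Set (V × V) := ⋃ s ∈ K.faces, convexHull ℝ (s : Set V) ×ˢ convexHull ℝ (s : Set V)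
  have hD : IsCompact D := hK.isCompact_biUnion fun s _ =>
    (isCompact_convexHull_finset s).prod (isCompact_convexHull_finset s)
  have hDK : D ⊆ K.space ×ˢ K.space := iUnion₂_subset fun s hs =>
    prod_mono (convexHull_subset_space hs) (convexHull_subset_space hs)
  have hfar : IsCompact (D ∩ (fun p : V × V => dist (e p.1) (e p.2)) ⁻¹' Ici r) :=
    hD.of_isClosed_subset (((continuousOn_dist_prod he).mono hDK).preimage_isClosed_of_isClosed
      hD.isClosed isClosed_Ici) inter_subset_left
  obtain ⟨η, hη, hdist⟩ := hfar.exists_forall_le' (a := 0)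
    ((continuousOn_dist_prod hf).mono (inter_subset_left.trans hDK)) <| by
      rintro ⟨x, y⟩ ⟨hxy, hxyr⟩
      obtain ⟨s, hs, hx, hy⟩ := mem_iUnion₂.1 hxy
      refine dist_pos.2 fun hfxy => hr.not_ge ?_
      obtain rfl : x = y := hinj s hs hx hy hfxy
      simpa using hxyr
  refine ⟨η, hη, fun s hs x hx y hy hlt => lt_of_not_ge fun hge => hlt.not_ge ?_⟩
  exact hdist (x, y) ⟨mem_iUnion₂.2 ⟨s, hs, hx, hy⟩, hge⟩

variable [NormedAddCommGroup W] [NormedSpace ℝ W] {L L₀ : SimplicialComplex ℝ W} {Y X : Set W}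

theorem IsSheeted.continuousOn [FiniteDimensional ℝ V] (h : IsSheeted f K L) :
    ContinuousOn f K.space :=
  HasPLCover.continuousOn ⟨K.faces, h.finite_domain, rfl, h.convexAffineOn⟩

theorem IsSheeted.eq_of_disjoint_skeleton (h : IsSheeted f K L) {i : ℕ}
    (hY : Disjoint Y (skeleton L i)) {s t : Finset V} (hs : s ∈ K.faces) (ht : t ∈ K.faces)
    {τ : Finset W} (hτ : τ ∈ L.faces) (hcard : τ.card ≤ i + 1) {x v v' : V}
    (hx : x ∈ convexHull ℝ (s : Set V) ∩ convexHull ℝ (t : Set V))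
    (hfx : f x ∈ Y ∩ convexHull ℝ (τ : Set W)) (hv : v ∈ convexHull ℝ (s : Set V))
    (hv' : v' ∈ convexHull ℝ (t : Set V)) (hvv' : f v = f v')
    (hvτ : f v ∈ convexHull ℝ (τ : Set W)) : v = v' := by
  obtain ⟨σ, hσ⟩ := exists_isCarrier_of_mem_convexHull hτ hfx.2
  have hσi : ¬ σ.card ≤ i := fun hσi =>
    hY.notMem_of_mem_left hfx.1 (mem_spaceOf.2 ⟨σ, ⟨hσ.mem_faces, hσi⟩, hσ.mem_convexHull⟩)
  obtain rfl : σ = τ := Finset.eq_of_subset_of_card_le (hσ.subset hτ hfx.2) (by omega)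
  obtain ⟨u, ⟨hus, hut⟩, hu⟩ := h.isCompatible s hs t ht (f x) (mem_image_of_mem f hx) σ hσ hvτ
  exact (h.injOn s hs hv hus hu.symm).trans (h.injOn t ht hut hv' (hu.trans hvv'))

/-- Two simplices of `K` with a common point over `Y ∩ τ`, where `τ` has `i + 1` vertices, coincide
over `τ`; the remaining pairs of simplices are handled by compactness. -/
theorem IsSheeted.exists_gap [FiniteDimensional ℝ V] (h : IsSheeted f K L₀)
    (he : ContinuousOn e K.space) (hinj : InjOn (fun x => (f x, e x)) K.space) (hY : IsClosed Y)
    {i : ℕ} (hYi : Disjoint Y (skeleton L₀ i)) :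
    ∃ γ > 0, ∀ v ∈ K.space, ∀ v' ∈ K.space, f v = f v' → f v ∈ Y → f v ∈ skeleton L₀ (i + 1) →
      v ≠ v' → γ ≤ dist (e v) (e v') := by
  let P : Set (Finset V × Finset V × Finset W) :=
    {p ∈ K.faces ×ˢ K.faces ×ˢ L₀.faces |
      ∀ x ∈ convexHull ℝ (p.1 : Set V) ∩ convexHull ℝ (p.2.1 : Set V),
        f x ∉ Y ∩ convexHull ℝ (p.2.2 : Set W)}
  have hP : P.Finite :=
    (h.finite_domain.prod (h.finite_domain.prod h.finite_range)).subset (sep_subset _ _)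
  let D : Set (V × V) := ⋃ p ∈ P,
    {q ∈ convexHull ℝ (p.1 : Set V) ×ˢ convexHull ℝ (p.2.1 : Set V) |
      f q.1 = f q.2 ∧ f q.1 ∈ Y ∩ convexHull ℝ (p.2.2 : Set W)}
  have hD : IsCompact D := hP.isCompact_biUnion fun p hp => isCompact_setOf_map_eq
    (isCompact_convexHull_finset _) (isCompact_convexHull_finset _)
    (h.continuousOn.mono (convexHull_subset_space hp.1.1))
    (h.continuousOn.mono (convexHull_subset_space hp.1.2.1))
    (hY.inter (isCompact_convexHull_finset _).isClosed)
  have hDK : D ⊆ K.space ×ˢ K.space := iUnion₂_subset fun p hp q hq =>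
    ⟨convexHull_subset_space hp.1.1 hq.1.1, convexHull_subset_space hp.1.2.1 hq.1.2⟩
  obtain ⟨γ, hγ, hdist⟩ := hD.exists_forall_le' (a := 0)
    ((continuousOn_dist_prod he).mono hDK) <| by
      rintro ⟨v, v'⟩ hq
      obtain ⟨p, hp, ⟨hv, hv'⟩, hvv', hfv⟩ := mem_iUnion₂.1 hq
      refine dist_pos.2 fun hevv' => hp.2 v ⟨hv, ?_⟩ hfv
      obtain rfl : v = v' := hinj (hDK hq).1 (hDK hq).2 (Prod.ext hvv' hevv')
      exact hv'
  refine ⟨γ, hγ, fun v hv v' hv' hvv' hvY hvi hne => hdist (v, v') ?_⟩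
  obtain ⟨s, hs, hvs⟩ := mem_space_iff.1 hv
  obtain ⟨t, ht, hvt⟩ := mem_space_iff.1 hv'
  obtain ⟨τ, ⟨hτ, hcard⟩, hvτ⟩ := mem_spaceOf.1 hvi
  refine mem_iUnion₂.2 ⟨(s, t, τ), ⟨⟨hs, ht, hτ⟩, ?_⟩, ⟨hvs, hvt⟩, hvv', hvY, hvτ⟩
  exact fun x hx hfx =>
    hne (h.eq_of_disjoint_skeleton hYi hs ht hτ hcard hx hfx hvs hvt hvv' hvτ)

theorem exists_isSheeted [FiniteDimensional ℝ W] (hK : K.faces.Finite)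
    (haff : ∀ s ∈ K.faces, ConvexAffineOn f (convexHull ℝ (s : Set V)))
    (hinj : ∀ s ∈ K.faces, InjOn f (convexHull ℝ (s : Set V))) {S : Set (Finset W)} (hS : S.Finite)
    {η : ℝ} (hη : 0 < η) :
    ∃ L : SimplicialComplex ℝ W, IsSheeted f K L ∧ MapsTo f K.space L.space ∧
      (∀ s ∈ S, convexHull ℝ (s : Set W) ⊆ L.space ∧
        IsCompatible L (convexHull ℝ (s : Set W))) ∧
      ∀ s ∈ L.faces, ∀ x ∈ convexHull ℝ (s : Set W), ∀ y ∈ convexHull ℝ (s : Set W),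
        dist x y < η := by
  classical
  have himage : ∀ s ∈ K.faces, ∀ t ∈ K.faces,
      f '' (convexHull ℝ (s : Set V) ∩ convexHull ℝ (t : Set V)) =
        convexHull ℝ (((s ∩ t).image f : Finset W) : Set W) := by
    intro s hs t ht
    rw [K.convexHull_inter_convexHull hs ht, Finset.coe_image, Finset.coe_inter]
    exact (haff s hs).image_convexHull (convex_convexHull ℝ _)
      (inter_subset_left.trans (subset_convexHull ℝ _))
  obtain ⟨L, hL, hLS, hmesh⟩ := exists_triangulation
    (hS.union ((hK.prod hK).image fun p : Finset V × Finset V => (p.1 ∩ p.2).image f)) hη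
  have hLimage : ∀ s ∈ K.faces, ∀ t ∈ K.faces,
      f '' (convexHull ℝ (s : Set V) ∩ convexHull ℝ (t : Set V)) ⊆ L.space ∧
        IsCompatible L (f '' (convexHull ℝ (s : Set V) ∩ convexHull ℝ (t : Set V))) := by
    intro s hs t ht
    rw [himage s hs t ht]
    exact hLS _ (Or.inr ⟨(s, t), ⟨hs, ht⟩, rfl⟩)
  refine ⟨L, ⟨hK, hL, haff, hinj, fun s hs t ht => (hLimage s hs t ht).2⟩, fun x hx => ?_,
    fun s hs => hLS s (Or.inl hs), hmesh⟩
  obtain ⟨s, hs, hxs⟩ := mem_space_iff.1 hx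
  exact (hLimage s hs s hs).1 (mem_image_of_mem f ⟨hxs, hxs⟩)

end Strata

section Contraction

universe u

variable {V W E : Type*} [NormedAddCommGroup V] [NormedSpace ℝ V] [NormedAddCommGroup E]
  [NormedSpace ℝ E] {f : V → W} {e : V → E} {N : Set V} {R R' : V → Set E}

/-- Both the topological and the PL contraction property. -/
def Contracts (f : V → W) (e : V → E) (N : Set V) (R : V → Set E) : Prop :=
  ContractsTop.{u} f e N R ∧ ContractsPL f e N R

theorem Contracts.mono (h : Contracts.{u} f e N R) (hR : ∀ x ∈ N, R x ⊆ R' x) :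
    Contracts.{u} f e N R' :=
  ⟨h.1.mono hR, h.2.mono hR⟩

variable [FiniteDimensional ℝ V] [NormedAddCommGroup W] [NormedSpace ℝ W]
  {K : SimplicialComplex ℝ V} {L L₀ : SimplicialComplex ℝ W} {T : Set (Finset W)} {X Y : Set W}
  {r ρ ε : ℝ}

theorem IsSheeted.contracts_of_remove (h : IsSheeted f K L) (hρ : 0 < ρ)
    (hosc : ∀ s ∈ K.faces, ∀ τ ∈ L.faces, ∀ x ∈ cell f s τ, ∀ y ∈ cell f s τ, dist (e x) (e y) < r)
    (hT : IsSubcomplex L T) {A : Set W} (hA : A.Finite)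
    (hgap : ∀ w ∈ A, ∀ v ∈ apexes f K T w, ∀ v' ∈ apexes f K T w, v ≠ v' →
      2 * (r + ρ) ≤ dist (e v) (e v'))
    (hc : Contracts.{u} f e (K.space ∩ f ⁻¹' spaceOf {τ ∈ T | ∀ w ∈ A, w ∉ τ}) (region f K L e ρ)) :
    Contracts.{u} f e (K.space ∩ f ⁻¹' spaceOf T) (region f K L e ρ) := by
  induction A, hA using Set.Finite.induction_on with
  | empty => simpa using hc
  | @insert w A _ _ ih =>
    refine ih (fun w' hw' => hgap w' (mem_insert_of_mem _ hw')) ?_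
    have hTA := hT.remove A
    have hapex : apexes f K {τ ∈ T | ∀ w ∈ A, w ∉ τ} w ⊆ apexes f K T w :=
      fun v hv => ⟨hv.1, hv.2.1, hv.2.2.1⟩
    have hcone := h.isCone hTA w
    have hregion := h.isConeRegion hTA w hρ hosc fun v hv v' hv' =>
      hgap w (mem_insert w A) v (hapex hv) v' (hapex hv')
    have hremove : {τ ∈ {τ ∈ T | ∀ w ∈ A, w ∉ τ} | w ∉ τ} =
        {τ ∈ T | ∀ w' ∈ insert w A, w' ∉ τ} := by
      ext τ
      simp only [mem_ofPred_eq, forall_mem_insert]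
      tauto
    rw [hremove] at hcone
    exact ⟨hc.1.cone hcone hregion, hc.2.cone hcone hregion⟩

theorem IsSheeted.contracts_of_disjoint (h : IsSheeted f K L) (hr : 0 < r)
    (hosc : ∀ s ∈ K.faces, ∀ τ ∈ L.faces, ∀ x ∈ cell f s τ, ∀ y ∈ cell f s τ, dist (e x) (e y) < r)
    (hX : IsCompatible L X) (hY : IsCompatible L Y) (hYL : Y ⊆ L.space)
    (hgap : ∀ v ∈ K.space, ∀ v' ∈ K.space, f v = f v' → f v ∈ Y → f v ∈ X → v ≠ v' →
      2 * (r + r) ≤ dist (e v) (e v'))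
    (hc : ∀ Y' ⊆ Y, IsPolyhedral Y' → Disjoint Y' X →
      Contracts.{u} f e (K.space ∩ f ⁻¹' Y') (fun x => Metric.ball (e x) r)) :
    Contracts.{u} f e (K.space ∩ f ⁻¹' Y) (fun x => Metric.ball (e x) (r + r)) := by
  set T : Set (Finset W) := {τ ∈ L.faces | convexHull ℝ (τ : Set W) ⊆ Y}
  have hT : IsSubcomplex L T := isSubcomplex_setOf_convexHull_subset L Y
  have hTY : spaceOf T = Y := hY.spaceOf_eq hYL
  have hremoved := hc (spaceOf {τ ∈ T | ∀ w ∈ L.vertices ∩ X, w ∉ τ})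
    (hTY ▸ biUnion_mono (fun _ hτ => hτ.1) fun _ _ => Subset.rfl)
    ⟨_, h.finite_range.subset fun τ hτ => hτ.1.1, rfl⟩ (hT.disjoint_spaceOf_remove hX)
  have hcontracts := h.contracts_of_remove hr hosc hT
    ((finite_vertices h.finite_range).subset inter_subset_left)
    (fun w hw v hv v' hv' => hgap v hv.1 v' hv'.1 (hv.2.1.trans hv'.2.1.symm)
      (hv.2.1 ▸ hv.2.2.2 (by simp)) (hv.2.1 ▸ hw.2))
    (hremoved.mono fun x _ => ball_subset_region e r x)
  rw [hTY] at hcontracts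
  refine hcontracts.mono fun x hx => ?_
  obtain ⟨s, hs, hxs⟩ := mem_space_iff.1 hx.1
  obtain ⟨τ, hτ, hxτ⟩ := mem_space_iff.1 (hYL hx.2)
  exact region_subset_ball hs hτ ⟨hxs, hxτ⟩ fun y hy => hosc s hs τ hτ y hy x ⟨hxs, hxτ⟩

variable [FiniteDimensional ℝ W]

theorem IsSheeted.contracts_of_disjoint_skeleton_succ (h : IsSheeted f K L₀)
    (he : ContinuousOn e K.space) (hinj : InjOn (fun x => (f x, e x)) K.space) {i : ℕ}
    (hsucc : ∀ Y, IsPolyhedral Y → Y ⊆ L₀.space → Disjoint Y (skeleton L₀ (i + 1)) → ∀ ε > 0,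
      Contracts.{u} f e (K.space ∩ f ⁻¹' Y) (fun x => Metric.ball (e x) ε))
    (hY : IsPolyhedral Y) (hYL : Y ⊆ L₀.space) (hYi : Disjoint Y (skeleton L₀ i)) (hε : 0 < ε) :
    Contracts.{u} f e (K.space ∩ f ⁻¹' Y) (fun x => Metric.ball (e x) ε) := by
  obtain ⟨γ, hγ, hgap⟩ := h.exists_gap he hinj hY.isCompact.isClosed hYi
  obtain ⟨r, hr, hrγ, hrε⟩ : ∃ r > 0, 2 * (r + r) ≤ γ ∧ r + r ≤ ε :=
    ⟨min (γ / 4) (ε / 2), lt_min (by linarith) (by linarith),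
      by linarith [min_le_left (γ / 4) (ε / 2)], by linarith [min_le_right (γ / 4) (ε / 2)]⟩
  obtain ⟨η, hη, hosc⟩ :=
    exists_forall_dist_lt_of_dist_map_lt h.finite_domain h.injOn h.continuousOn he hr
  obtain ⟨S, hS, rfl⟩ := hY
  obtain ⟨L, hL, -, hLS, hmesh⟩ := exists_isSheeted h.finite_domain h.convexAffineOn h.injOn
    (hS.union h.finite_range) hη
  have hcontracts := hL.contracts_of_disjoint hr
    (fun s hs τ hτ x hx y hy => hosc s hs x hx.1 y hy.1 (hmesh τ hτ _ hx.2 _ hy.2))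
    (X := skeleton L₀ (i + 1)) (.biUnion fun τ hτ => (hLS τ (Or.inr hτ.1)).2)
    (.biUnion fun s hs => (hLS s (Or.inl hs)).2)
    (iUnion₂_subset fun s hs => (hLS s (Or.inl hs)).1)
    (fun v hv v' hv' hvv' hvY hvi hne => hrγ.trans (hgap v hv v' hv' hvv' hvY hvi hne))
    fun Y' hY'Y hY' hdisj => hsucc Y' hY' (hY'Y.trans hYL) hdisj r hr
  exact hcontracts.mono fun x _ => Metric.ball_subset_ball hrε

theorem IsSheeted.contracts_of_disjoint_skeleton (h : IsSheeted f K L) (he : ContinuousOn e K.space)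
    (hinj : InjOn (fun x => (f x, e x)) K.space) (i : ℕ) (hY : IsPolyhedral Y) (hYL : Y ⊆ L.space)
    (hYi : Disjoint Y (skeleton L i)) (hε : 0 < ε) :
    Contracts.{u} f e (K.space ∩ f ⁻¹' Y) (fun x => Metric.ball (e x) ε) := by
  obtain ⟨d, hd⟩ := (h.finite_range.image Finset.card).bddAbove
  obtain ⟨j, hj⟩ : ∃ j, d ≤ i + j := ⟨d, Nat.le_add_left d i⟩
  induction j generalizing i Y ε with
  | zero =>
    have hcard : ∀ τ ∈ L.faces, τ.card ≤ i := fun τ hτ => (hd (mem_image_of_mem _ hτ)).trans hj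
    rw [eq_empty_of_disjoint_skeleton hcard hYL hYi, preimage_empty, inter_empty]
    exact ⟨contractsTop_empty, contractsPL_empty⟩
  | succ j ih =>
    exact h.contracts_of_disjoint_skeleton_succ he hinj
      (fun Y hY hYL hYi ε hε => ih (i + 1) hY hYL hYi hε (by omega)) hY hYL hYi hε

theorem contracts_of_continuousOn_of_injOn (hK : K.faces.Finite)
    (haff : ∀ s ∈ K.faces, ConvexAffineOn f (convexHull ℝ (s : Set V)))
    (hfinj : ∀ s ∈ K.faces, InjOn f (convexHull ℝ (s : Set V))) (he : ContinuousOn e K.space)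
    (hinj : InjOn (fun x => (f x, e x)) K.space) (hε : 0 < ε) :
    Contracts.{u} f e K.space (fun x => Metric.ball (e x) ε) := by
  obtain ⟨L, hL, hKL, -⟩ := exists_isSheeted hK haff hfinj (finite_empty (α := Finset W)) one_pos
  have hcontracts := hL.contracts_of_disjoint_skeleton.{u} he hinj 0 (Y := L.space)
    ⟨L.faces, hL.finite_range, rfl⟩ Subset.rfl (by simp [skeleton_zero]) hε
  have hpreimage : K.space ∩ f ⁻¹' L.space = K.space := inter_eq_left.2 hKL
  rwa [hpreimage] at hcontracts

end Contraction

/-! ### Spaces of lifts -/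

section Nondegenerate

variable {V W : Type*} [AddCommGroup V] [Module ℝ V] [AddCommGroup W] [Module ℝ W] {f : V → W}
  {N C : Set V} {M : Set W}

theorem one_le_polyhedronDim {X : Set V} {x y : V} (hne : x ≠ y) (h : segment ℝ x y ⊆ X) :
    1 ≤ polyhedronDim X := by
  classical
  have hindep : AffineIndependent ℝ ((↑) : ({x, y} : Finset V) → V) := by
    have hrange := (affineIndependent_of_ne ℝ hne).range
    rwa [Matrix.range_cons_cons_empty, ← Finset.coe_pair] at hrange
  refine le_iSup₂_of_le {x, y} (Finset.insert_nonempty _ _) (le_iSup₂_of_le hindep ?_ ?_)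
  · rwa [Finset.coe_pair, convexHull_pair]
  · rw [Finset.card_pair hne]
    rfl

theorem IsNondegenerate.injOn (h : IsNondegenerate f N M) (hfM : MapsTo f N M) (hCN : C ⊆ N)
    (hC : Convex ℝ C) (hf : ConvexAffineOn f C) : InjOn f C := by
  intro x hx y hy hxy
  by_contra hne
  have hsegment : segment ℝ x y ⊆ {z ∈ N | f z = f x} := by
    rintro _ ⟨a, b, ha, hb, hab, rfl⟩
    refine ⟨hCN (hC hx hy ha hb hab), ?_⟩
    rw [hf x hx y hy a b ha hb hab, ← hxy, ← add_smul, hab, one_smul]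
  exact not_le_of_gt zero_lt_one
    ((one_le_polyhedronDim hne hsegment).trans (h (f x) (hfM (hCN hx))))

end Nondegenerate

namespace EmbeddedLifts

variable {V W : Type*} [NormedAddCommGroup V] [NormedAddCommGroup W] {N : Set V} {M : Set W}
  {f : V → W} {k : ℕ}

open Classical in
/-- The `ℝᵏ`-component of an embedded lift, extended by zero outside `N`. It determines the lift. -/
noncomputable def height (e : EmbeddedLifts f N M k) (x : V) : EuclideanSpace ℝ (Fin k) :=
  if h : x ∈ N then (e.1 ⟨x, h⟩).2 else 0

theorem height_coe (e : EmbeddedLifts f N M k) (p : N) : e.height p = (e.1 p).2 := by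
  simp [height]

theorem continuousOn_uncurry_height [CompactSpace N] :
    ContinuousOn (fun p : EmbeddedLifts f N M k × V => p.1.height p.2) (univ ×ˢ N) := by
  rw [continuousOn_iff_continuous_domRestrict]
  have hcoe : (univ ×ˢ N).domRestrict (fun p : EmbeddedLifts f N M k × V => p.1.height p.2) =
      fun q => (q.1.1.1 ⟨q.1.2, q.2.2⟩).2 := funext fun q => q.1.1.height_coe ⟨q.1.2, q.2.2⟩
  rw [hcoe]
  refine continuous_snd.comp (Continuous.eval ?_ (Continuous.subtype_mk ?_ _)) <;> fun_prop

theorem continuousOn_height (e : EmbeddedLifts f N M k) : ContinuousOn e.height N := by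
  rw [continuousOn_iff_continuous_domRestrict, show N.domRestrict e.height = fun p => (e.1 p).2 from
    funext e.height_coe]
  exact continuous_snd.comp e.1.continuous

theorem fst_apply_eq (e e' : EmbeddedLifts f N M k) (p : N) : (e.1 p).1 = (e'.1 p).1 :=
  Subtype.ext ((e.2.2 p).trans (e'.2.2 p).symm)

theorem ext_height {e e' : EmbeddedLifts f N M k} (h : EqOn e.height e'.height N) : e = e' := by
  refine Subtype.ext (ContinuousMap.ext fun p => Prod.ext (e.fst_apply_eq e' p) ?_)
  rw [← e.height_coe, ← e'.height_coe, h p.2]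

theorem injOn_height (e : EmbeddedLifts f N M k) : InjOn (fun x => (f x, e.height x)) N := by
  intro x hx y hy hxy
  obtain ⟨hf, hheight⟩ := Prod.mk.inj hxy
  have hfst : (e.1 ⟨x, hx⟩).1 = (e.1 ⟨y, hy⟩).1 :=
    Subtype.ext ((e.2.2 ⟨x, hx⟩).trans (hf.trans (e.2.2 ⟨y, hy⟩).symm))
  have hsnd : (e.1 ⟨x, hx⟩).2 = (e.1 ⟨y, hy⟩).2 :=
    (e.height_coe ⟨x, hx⟩).symm.trans (hheight.trans (e.height_coe ⟨y, hy⟩))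
  exact congrArg Subtype.val (e.2.1.injective (Prod.ext hfst hsnd))

theorem dist_apply (e e' : EmbeddedLifts f N M k) (p : N) :
    dist (e.1 p) (e'.1 p) = dist (e.height p) (e'.height p) := by
  rw [Prod.dist_eq, e.fst_apply_eq e', dist_self, e.height_coe, e'.height_coe]
  exact max_eq_right dist_nonneg

theorem hasBasis_nhds [CompactSpace N] (e : EmbeddedLifts f N M k) :
    (𝓝 e).HasBasis (0 < ·) fun r => {e' | ∀ x ∈ N, dist (e'.height x) (e.height x) < r} := by
  rw [nhds_subtype_eq_comap]
  refine (Metric.nhds_basis_ball.comap Subtype.val).congr (fun _ => Iff.rfl) fun r hr => ?_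
  ext e'
  simp only [mem_preimage, Metric.mem_ball, ContinuousMap.dist_lt_iff hr, dist_apply e' e,
    Subtype.forall, mem_ofPred_eq]

theorem exists_continuous_eqOn_height [CompactSpace N] {Z : Type*} [TopologicalSpace Z]
    {H : Z → V → EuclideanSpace ℝ (Fin k)} (hf : ContinuousOn f N) (hfM : MapsTo f N M)
    (hH : ContinuousOn (fun p : Z × V => H p.1 p.2) (univ ×ˢ N))
    (hinj : ∀ z, InjOn (fun x => (f x, H z x)) N) :
    ∃ F : Z → EmbeddedLifts f N M k, Continuous F ∧ ∀ z, EqOn (F z).height (H z) N := by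
  let Φ : C(Z × N, M × EuclideanSpace ℝ (Fin k)) :=
    { toFun := fun q => (hfM.restrict f N M q.2, H q.1 q.2)
      continuous_toFun := ((hf.mapsToRestrict hfM).comp continuous_snd).prodMk <|
        hH.comp_continuous (f := fun q : Z × N => (q.1, (q.2 : V))) (by fun_prop)
          fun q => ⟨mem_univ _, q.2.2⟩ }
  have hembedding : ∀ z, IsEmbedding (Φ.curry z) := fun z =>
    ((Φ.curry z).continuous.isClosedEmbedding fun p p' hpp' => Subtype.ext <|
      hinj z p.2 p'.2 (congrArg (Prod.map Subtype.val id) hpp')).isEmbedding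
  let F : Z → EmbeddedLifts f N M k := fun z => ⟨Φ.curry z, hembedding z, fun _ => rfl⟩
  exact ⟨F, Φ.curry.continuous.subtype_mk _, fun z x hx => (F z).height_coe ⟨x, hx⟩⟩

end EmbeddedLifts

section LocalContractibility

universe u v

variable {V : Type u} {W : Type v} [NormedAddCommGroup V] [NormedAddCommGroup W] {N : Set V}
  {M : Set W} {f : V → W} {k : ℕ}

/-- The parameter space of the family to be contracted is a ball in the space of lifts. -/
theorem locallyContractibleSpace_embeddedLifts (hN : IsCompact N) (hf : ContinuousOn f N)
    (hfM : MapsTo f N M)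
    (h : ∀ e : EmbeddedLifts f N M k, ∀ ε > (0 : ℝ),
      ContractsTop.{max u v} f e.height N (fun x => Metric.ball (e.height x) ε)) :
    LocallyContractibleSpace (EmbeddedLifts f N M k) := by
  have : CompactSpace N := isCompact_iff_compactSpace.1 hN
  intro e U hU
  obtain ⟨ε, hε, hεU⟩ := e.hasBasis_nhds.mem_iff.1 hU
  obtain ⟨δ, hδ, hcontract⟩ := h e ε hε
  let Z : Set (EmbeddedLifts f N M k) := {z | ∀ x ∈ N, dist (z.height x) (e.height x) < min δ ε}
  have hZ : Z ∈ 𝓝 e := e.hasBasis_nhds.mem_of_mem (lt_min hδ hε)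
  have hZU : Z ⊆ U := fun z hz => hεU fun x hx => (hz x hx).trans_le (min_le_right δ ε)
  refine ⟨Z, hZU, hZ, ?_⟩
  obtain ⟨H, hH, hlift, hbase, hapex⟩ := hcontract Z (fun z => z.1.height)
    (EmbeddedLifts.continuousOn_uncurry_height.comp (f := fun p : Z × V => (p.1.1, p.2))
      (by fun_prop) fun p hp => ⟨mem_univ _, hp.2⟩)
    fun z => .of_injOn (fun x hx => Metric.mem_ball.2 ((z.2 x hx).trans_le (min_le_left δ ε)))
      z.1.injOn_height _
  have htime : ∀ t : unitInterval, (1 - t : ℝ) ∈ Metric.closedBall (0 : ℝ) 1 := fun t => by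
    rw [mem_closedBall_zero_iff, Real.norm_eq_abs, abs_le]
    constructor <;> linarith [t.2.1, t.2.2]
  obtain ⟨F, hF, hFheight⟩ := EmbeddedLifts.exists_continuous_eqOn_height (M := M)
    (Z := unitInterval × Z) (H := fun q x => H q.2 (x, 1 - q.1)) hf hfM
    (hH.comp (f := fun p : (unitInterval × Z) × V => (p.1.2, p.2, (1 - p.1.1 : ℝ)))
      (by fun_prop) fun p hp => ⟨mem_univ _, hp.2, htime _⟩)
    fun q => (hlift q.2).injOn_slice (htime q.1)
  have hFU : ∀ q, F q ∈ U := fun q => hεU fun x hx => by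
    rw [hFheight q hx]
    exact (hlift q.2).mem (x, 1 - q.1) ⟨hx, htime _⟩
  let z₀ : Z := ⟨e, mem_of_mem_nhds hZ⟩
  refine ⟨⟨F (1, z₀), hFU _⟩, ⟨{
    toFun := fun q => ⟨F q, hFU q⟩
    continuous_toFun := hF.subtype_mk _
    map_zero_left := fun z => Subtype.ext (EmbeddedLifts.ext_height fun x hx => ?_)
    map_one_left := fun z => Subtype.ext (EmbeddedLifts.ext_height fun x hx => ?_) }⟩⟩
  · refine (hFheight (0, z) hx).trans ?_
    exact hbase z ⟨hx, by simp⟩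
  · refine (hFheight (1, z) hx).trans (Eq.trans ?_ (hFheight (1, z₀) hx).symm)
    simpa using hapex z z₀ x hx

end LocalContractibility

section Extension

variable {V W : Type*} [NormedAddCommGroup V] [NormedAddCommGroup W] {N : Set V} {M : Set W}
  {f : V → W} {k n : ℕ} {S : Set (Fin n → ℝ)}

theorem IsLiftFamily.isCloseOver {e : EmbeddedLifts f N M k} {ε : ℝ} (hε : 0 < ε)
    {H : V × (Fin n → ℝ) → EuclideanSpace ℝ (Fin k)}
    (hlift : IsLiftFamily f (fun x => Metric.ball (e.height x) ε) (N ×ˢ S) H) :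
    IsCloseOver e.1 S (fun p => (f p.1, H p, p.2)) ε := by
  intro p b hb
  have hdist : dist (H (p, b)) (e.height p) < ε := hlift.mem (p, b) ⟨p.2, hb⟩
  rw [e.height_coe] at hdist
  simpa only [Prod.dist_eq, e.2.2 p, dist_self, max_lt_iff, and_true, true_and, hε] using hdist

variable [NormedSpace ℝ V] [NormedSpace ℝ W]

theorem IsPLEmbeddedLiftOver.isLiftFamily {e : EmbeddedLifts f N M k} {δ : ℝ}
    {F : V × (Fin n → ℝ) → W × EuclideanSpace ℝ (Fin k) × (Fin n → ℝ)}
    (hF : IsPLEmbeddedLiftOver f N k n S F) (hclose : IsCloseOver e.1 S F δ) :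
    IsLiftFamily f (fun x => Metric.ball (e.height x) δ) (N ×ˢ S) (fun p => (F p).2.1) := by
  obtain ⟨⟨-, _, -, hinv⟩, hlift⟩ := hF
  refine ⟨fun ⟨x, b⟩ ⟨hx, hb⟩ => ?_, fun p hp q hq hpq => hinv.injOn hp hq ?_⟩
  · rw [Metric.mem_ball, e.height_coe ⟨x, hx⟩]
    exact ((le_max_left _ _).trans (le_max_right _ _)).trans_lt (hclose ⟨x, hx⟩ b hb)
  · simp only [Prod.mk.injEq] at hpq
    obtain ⟨hp₁, hp₂⟩ := hlift p.1 hp.1 p.2 hp.2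
    obtain ⟨hq₁, hq₂⟩ := hlift q.1 hq.1 q.2 hq.2
    exact Prod.ext (hp₁.trans (hpq.1.trans hq₁.symm))
      (Prod.ext hpq.2.1 (hp₂.trans (hpq.2.2.trans hq₂.symm)))

theorem IsLiftFamily.isPLEmbeddedLiftOver [FiniteDimensional ℝ V] [FiniteDimensional ℝ W]
    {R : V → Set (EuclideanSpace ℝ (Fin k))} {H : V × (Fin n → ℝ) → EuclideanSpace ℝ (Fin k)}
    (hlift : IsLiftFamily f R (N ×ˢ S) H) (hf : HasPLCover f N) (hS : IsPolyhedral S)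
    (hH : HasPLCover H (N ×ˢ S)) :
    IsPLEmbeddedLiftOver f N k n S (fun p => (f p.1, H p, p.2)) :=
  ⟨((hf.comp_fst_prod hS).prodMk (hH.prodMk (hH.isPolyhedral.hasPLCover_affineMap
    (LinearMap.snd ℝ V (Fin n → ℝ)).toAffineMap))).isPLEmbeddingOn hlift.injOn,
    fun _ _ _ _ => ⟨rfl, rfl⟩⟩

theorem exists_extension_of_contractsPL [FiniteDimensional ℝ V] [FiniteDimensional ℝ W]
    (hf : HasPLCover f N) (e : EmbeddedLifts f N M k) {ε : ℝ} (hε : 0 < ε)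
    (h : ContractsPL f e.height N (fun x => Metric.ball (e.height x) ε)) :
    ∃ δ > (0 : ℝ), ∀ n : ℕ,
      ∀ E : V × (Fin n → ℝ) → W × EuclideanSpace ℝ (Fin k) × (Fin n → ℝ),
        IsPLEmbeddedLiftOver f N k n (plSphere n) E →
        IsCloseOver e.1 (plSphere n) E δ →
        ∃ E' : V × (Fin n → ℝ) → W × EuclideanSpace ℝ (Fin k) × (Fin n → ℝ),
          IsPLEmbeddedLiftOver f N k n (plBall n) E' ∧
          EqOn E' E (N ×ˢ plSphere n) ∧
          IsCloseOver e.1 (plBall n) E' ε := by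
  obtain ⟨δ, hδ, hextend⟩ := h
  refine ⟨δ, hδ, fun n E hE hclose => ?_⟩
  obtain ⟨H, hH, hlift, hbdry⟩ := hextend n (fun p => (E p).2.1)
    (hE.1.1.hasPLCover.linear_comp (LinearMap.fst ℝ _ _ ∘ₗ LinearMap.snd ℝ _ _))
    (hE.isLiftFamily hclose)
  refine ⟨fun p => (f p.1, H p, p.2), hlift.isPLEmbeddedLiftOver hf (isPolyhedral_plBall n) hH,
    fun p hp => ?_, hlift.isCloseOver hε⟩
  obtain ⟨hfst, hsnd⟩ := hE.2 p.1 hp.1 p.2 hp.2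
  exact Prod.ext hfst.symm (Prod.ext (hbdry hp) hsnd.symm)

end Extension

theorem mainTheorem3_general {V W : Type*}
    [NormedAddCommGroup V] [NormedSpace ℝ V] [FiniteDimensional ℝ V]
    [NormedAddCommGroup W] [NormedSpace ℝ W] [FiniteDimensional ℝ W]
    (N : Set V) (M : Set W) (f : V → W) (hf : IsPLMap f N M) (hnd : IsNondegenerate f N M) (k : ℕ) :
    LocallyContractibleSpace (EmbeddedLifts f N M k) ∧
    ∀ e : EmbeddedLifts f N M k, ∀ ε > (0 : ℝ), ∃ δ > (0 : ℝ), ∀ n : ℕ,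
      ∀ E : V × (Fin n → ℝ) → W × EuclideanSpace ℝ (Fin k) × (Fin n → ℝ),
        IsPLEmbeddedLiftOver f N k n (plSphere n) E →
        IsCloseOver e.1 (plSphere n) E δ →
        ∃ E' : V × (Fin n → ℝ) → W × EuclideanSpace ℝ (Fin k) × (Fin n → ℝ),
          IsPLEmbeddedLiftOver f N k n (plBall n) E' ∧
          EqOn E' E (N ×ˢ plSphere n) ∧
          IsCloseOver e.1 (plBall n) E' ε := by
  have hcover := hf.1.hasPLCover
  obtain ⟨K, hK, rfl, hφ⟩ := hf.1
  have haff : ∀ s ∈ K.faces, ConvexAffineOn f (convexHull ℝ (s : Set V)) := fun s hs => by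
    obtain ⟨φ, hφ⟩ := hφ s hs
    exact (ConvexAffineOn.of_affineMap φ _).congr (convex_convexHull ℝ _) hφ
  have hinj : ∀ s ∈ K.faces, InjOn f (convexHull ℝ (s : Set V)) := fun s hs =>
    hnd.injOn hf.2 (convexHull_subset_space hs) (convex_convexHull ℝ _) (haff s hs)
  have hcontracts := fun (e : EmbeddedLifts f K.space M k) (ε : ℝ) (hε : ε > 0) =>
    contracts_of_continuousOn_of_injOn hK haff hinj e.continuousOn_height e.injOn_height hε
  exact ⟨locallyContractibleSpace_embeddedLifts hcover.isPolyhedral.isCompact hcover.continuousOn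
    hf.2 fun e ε hε => (hcontracts e ε hε).1,
    fun e ε hε => exists_extension_of_contractsPL hcover e hε (hcontracts e ε hε).2⟩

theorem mainTheorem3 {V W : Type*}
    [NormedAddCommGroup V] [NormedSpace ℝ V] [FiniteDimensional ℝ V]
    [NormedAddCommGroup W] [NormedSpace ℝ W] [FiniteDimensional ℝ W]
    (N : Set V) (M : Set W) (hN : IsCompactPolyhedron N) (hM : IsCompactPolyhedron M)
    (f : V → W) (hf : IsPLMap f N M) (hnd : IsNondegenerate f N M) (k : ℕ) :
    LocallyContractibleSpace (EmbeddedLifts f N M k) ∧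
    ∀ e : EmbeddedLifts f N M k, ∀ ε > (0 : ℝ), ∃ δ > (0 : ℝ), ∀ n : ℕ,
      ∀ E : V × (Fin n → ℝ) → W × EuclideanSpace ℝ (Fin k) × (Fin n → ℝ),
        IsPLEmbeddedLiftOver f N k n (plSphere n) E →
        IsCloseOver e.1 (plSphere n) E δ →
        ∃ E' : V × (Fin n → ℝ) → W × EuclideanSpace ℝ (Fin k) × (Fin n → ℝ),
          IsPLEmbeddedLiftOver f N k n (plBall n) E' ∧
          EqOn E' E (N ×ˢ plSphere n) ∧
          IsCloseOver e.1 (plBall n) E' ε :=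
  mainTheorem3_general N M f hf hnd k
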